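/- For $n\le N$ let $\mu_{n,N}$ be the Haar (rotation invariant) probability measure on the Grassmannian $G_{n,N}$ of $n$-dimensional subspaces of $\mathbb R^N$. For $E\in G_{n,N}$ let $X_E=\ell_1^N/E^{\perp}$, where $E^\perp$ is the orthogonal complement of $E$ with respect to the Euclidean inner product of $\mathbb R^N$; this is an $n$-dimensional normed space (with the quotient norm). For a linear operator $u:X\to Y$ between finite-dimensional normed spaces and an integer $k\ge 1$, the $k$-th Gelfand number of $u$ is $$c_k(u)=\inf\{\|u|_Z\| : Z\subset X \text{ a linear subspace with } \operatorname{codim} Z<k\}.$$ **Theorem 3.1.** A generic $n$-dimensional quotient $X_n$ of $\ell_1^{n^2}$ has the property that for every $T\in L(X_n)$ $$\inf_{\lambda\in\mathbb R}\ \sum_{i=1}^n c_i(T-\lambda\,\mathrm{Id})\ \le\ c\,n^{2/3}(\log n)^{3/2}\,\|T\|_{X_n},$$ where $c$ is a numerical constant. That is, there are constants $c>0$ and $\varepsilon\in(0,1)$ such that for every $n\in\mathbb N$, with $N=n^2$, $$\mu_{n,N}\Big\{E\in G_{n,N} : \inf_{\lambda\in\mathbb R}\sum_{i=1}^n c_i(T-\lambda\,\mathrm{Id}_{X_E})\le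 c\,n^{2/3}(\log n)^{3/2}\,\|T\|_{X_E}\ \text{ for every linear } T:X_E\to X_E\Big\}\ \ge\ 1-\varepsilon^n .$$ -/

import Mathlib

open MeasureTheory

namespace GenericQuotient

/-- The `k`-th Gelfand number `c_k(u) = inf {‖u|_Z‖ : Z ⊆ X a subspace, codim Z < k}` of a bounded
operator `u : X → Y` (meaningful for `k ≥ 1`, when `Z = X` is admissible). -/
noncomputable def gelfandNumber {X Y : Type*} [SeminormedAddCommGroup X] [NormedSpace ℝ X]
    [SeminormedAddCommGroup Y] [NormedSpace ℝ Y] (k : ℕ) (u : X →L[ℝ] Y) : ℝ :=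
  sInf {r : ℝ | ∃ Z : Submodule ℝ X, Module.rank ℝ (X ⧸ Z) < (k : Cardinal) ∧
    r = ‖u.comp Z.subtypeL‖}

/-- The Borel `σ`-algebra of the compact group `O(N)`. -/
instance instMeasurableSpaceOrthogonalGroup (N : ℕ) :
    MeasurableSpace (Matrix.orthogonalGroup (Fin N) ℝ) := borel _

instance instBorelSpaceOrthogonalGroup (N : ℕ) :
    BorelSpace (Matrix.orthogonalGroup (Fin N) ℝ) := ⟨rfl⟩

instance instCompactSpaceOrthogonalGroup (N : ℕ) :
    CompactSpace (Matrix.orthogonalGroup (Fin N) ℝ) := by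
  apply isCompact_iff_compactSpace.mp
  have hK : IsCompact (Set.univ.pi fun _ : Fin N => Set.univ.pi fun _ : Fin N =>
      Metric.closedBall (0 : ℝ) 1) :=
    isCompact_univ_pi fun _ => isCompact_univ_pi fun _ => isCompact_closedBall _ _
  refine IsCompact.of_isClosed_subset (X := Matrix (Fin N) (Fin N) ℝ) hK isClosed_unitary ?_
  intro U hU i _ j _
  simpa using entry_norm_bound_of_unitary hU i j

/-- The normalized Haar measure on `O(N)`. -/
noncomputable def orthogonalHaar (N : ℕ) : Measure (Matrix.orthogonalGroup (Fin N) ℝ) :=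
  Measure.haarMeasure ⊤

/-- The Grassmann manifold `G_{n,N}` of all `n`-dimensional subspaces of `ℝ^N`. -/
def Grassmannian (n N : ℕ) : Type :=
  {E : Submodule ℝ (EuclideanSpace ℝ (Fin N)) // Module.finrank ℝ E = n}

/-- The span of the first `n` unit vectors of `ℝ^N`. -/
noncomputable def coordSubspace {n N : ℕ} (h : n ≤ N) : Grassmannian n N :=
  ⟨Submodule.span ℝ (Set.range fun i : Fin n =>
      EuclideanSpace.single (Fin.castLE h i) (1 : ℝ)), by
    have hli : LinearIndependent ℝ fun i : Fin n =>
        EuclideanSpace.single (Fin.castLE h i) (1 : ℝ) := by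
      have := ((EuclideanSpace.basisFun (Fin N) ℝ).orthonormal.linearIndependent).comp
        (Fin.castLE h) (Fin.castLE_injective h)
      simpa [Function.comp_def] using this
    simpa using finrank_span_eq_card hli⟩

/-- The subspace `U(E)`, for `U ∈ O(N)` and `E ∈ G_{n,N}`. -/
noncomputable def rotate {n N : ℕ} (U : Matrix.orthogonalGroup (Fin N) ℝ)
    (E : Grassmannian n N) : Grassmannian n N :=
  ⟨E.1.map (Matrix.toEuclideanLin (U : Matrix (Fin N) (Fin N) ℝ)), by
    have hinj : Function.Injective
        (Matrix.toEuclideanLin (U : Matrix (Fin N) (Fin N) ℝ)) := by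
      intro x y hxy
      have h := congrArg (fun z : EuclideanSpace ℝ (Fin N) =>
        Matrix.mulVec (star (U : Matrix (Fin N) (Fin N) ℝ)) z.ofLp) hxy
      simp only [Matrix.toLpLin_apply, Matrix.mulVec_mulVec,
        Unitary.coe_star_mul_self, Matrix.one_mulVec] at h
      exact WithLp.ofLp_injective 2 h
    exact (LinearEquiv.finrank_eq (Submodule.equivMapOfInjective _ hinj E.1)).symm.trans E.2⟩

/-- The measurable structure of `G_{n,N} = O(N) / (O(n) × O(N - n))`: a set of subspaces is
measurable iff the set of all `U ∈ O(N)` carrying the span of the first `n` unit vectors into it is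
Borel. -/
instance instMeasurableSpaceGrassmannian (n N : ℕ) : MeasurableSpace (Grassmannian n N) where
  MeasurableSet' s := ∀ h : n ≤ N, MeasurableSet {U | rotate U (coordSubspace h) ∈ s}
  measurableSet_empty _ := MeasurableSet.empty
  measurableSet_compl _ hs h := (hs h).compl
  measurableSet_iUnion s hs h := by
    simpa only [Set.mem_iUnion, Set.ofPred_exists] using MeasurableSet.iUnion fun i => hs i h

/-- The Haar measure `μ_{n,N}` on `G_{n,N}`: the rotation invariant probability measure, i.e. the
law of `U(span(e_1, …, e_n))` for `U` distributed according to the Haar measure of `O(N)`. -/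
noncomputable def grassmannMeasure {n N : ℕ} (h : n ≤ N) : Measure (Grassmannian n N) :=
  (orthogonalHaar N).map fun U => rotate U (coordSubspace h)

/-- The orthogonal complement `E^⊥` (with respect to the Euclidean inner product of `ℝ^N`) of
`E ∈ G_{n,N}`, as a subspace of `l_1^N`. -/
noncomputable def perpInL1 {n N : ℕ} (E : Grassmannian n N) :
    Submodule ℝ (PiLp 1 fun _ : Fin N => ℝ) :=
  (E.1ᗮ).comap ((WithLp.linearEquiv 1 ℝ (Fin N → ℝ)).trans
    (WithLp.linearEquiv 2 ℝ (Fin N → ℝ)).symm).toLinearMap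

/-- The `n`-dimensional quotient `l_1^N / E^⊥` (the dual of `E ⊆ l_∞^N`), with the quotient norm of
`‖·‖_1`. -/
def L1Quotient {n N : ℕ} (E : Grassmannian n N) : Type :=
  (PiLp 1 fun _ : Fin N => ℝ) ⧸ perpInL1 E

noncomputable instance instNormedAddCommGroupL1Quotient {n N : ℕ} (E : Grassmannian n N) :
    NormedAddCommGroup (L1Quotient E) :=
  have : IsClosed (perpInL1 E : Set (PiLp 1 fun _ : Fin N => ℝ)) :=
    Submodule.closed_of_finiteDimensional _
  Submodule.Quotient.normedAddCommGroup (perpInL1 E)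

noncomputable instance instNormedSpaceL1Quotient {n N : ℕ} (E : Grassmannian n N) :
    NormedSpace ℝ (L1Quotient E) :=
  Submodule.Quotient.normedSpace (perpInL1 E) ℝ

/-- A generic `n`-dimensional quotient of `l_1^N`, `N = f n`, has the property `P = (P_n)`, where
`P_n` is expressed as a property of the subspace `E` that determines the quotient `l_1^N / E^⊥`:
there is `ε ∈ (0, 1)` such that for every `n` the subspaces violating `P_n` have measure at most
`ε ^ n`, so that those satisfying `P_n` have measure at least `1 - ε ^ n`. (Bounding the outer
measure of the violating set keeps the claim unchanged for measurable `P_n` and at least as strong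
otherwise.) -/
def IsGeneric (f : ℕ → ℕ) (hf : ∀ n, n ≤ f n) (P : ∀ n, Grassmannian n (f n) → Prop) : Prop :=
  ∃ ε : ℝ, 0 < ε ∧ ε < 1 ∧
    ∀ n : ℕ, grassmannMeasure (hf n) {E | ¬ P n E} ≤ ENNReal.ofReal (ε ^ n)

end GenericQuotient

set_option linter.unusedSectionVars false

namespace GenericQuotient

open ProbabilityTheory

/-! ### Gaussian estimates -/

/-! Take `N = n^2` independent standard Gaussian vectors `g_l` in `ℝ^n` and let `E ⊆ ℝ^N` be the
range of `θ ↦ (⟨g_l, θ⟩)_l`, a rotation invariant random subspace. Then `ℓ_1^N / E^⊥` is `ℝ^n` with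
the absolutely convex hull of the `g_l` as unit ball, up to boundary points
(`exists_equiv_absHull`), and an operator of norm less than one sends every `g_i` into this hull.

The probabilistic core concerns a fixed operator `T` that throws a `k`-dimensional space off itself,
bounded below by `α` (`IsMixing`). Resample the components of the `g_l` in that space: in the
orthogonal target directions the hull does not change, while the image of each `g_i` moves
independently and is spread out. By Maurey's lemma the hull is covered by `(2N)^m` balls of radius
of order `√n / √m`, with `m` about `k / log n`. For `α` of order `√n / (√k √m)` all `N` images fall
into the hull with probability at most `e^{-kN}`. A grid of operators has only `e^{O(n^2 log n)}`
points, and `kN ≥ n^{5/2}` once `k ≥ √n`, so with high probability no mixing operator at all is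
admissible (`gaussianFamily_exists_isMixing_le`).

The rest is deterministic. An operator that is not mixing is Euclidean-close to a scalar on a
subspace of codimension `4k` (`exists_almost_scalar_of_not_isMixing`). On a further subspace of
codimension `k` the hull has radius of order `√n / √m` (`exists_section_norm_le`), and the hull norm
is at most 20 times the Euclidean norm. Hence `T - r` has norm of order `n log n / k^{3/2}` in
codimension `5k`, and one `r` serves all `k`. This bound for `i > n^{2/3}` and a constant bound for
smaller `i` sum to order `n^{2/3} log n`, better than required.

Rotation invariance transfers the estimate to the Grassmannian
(`grassmannMeasure_le_gaussianFamily`), the exceptional set being open. The finitely many small `n`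
are absorbed in the constant. -/

lemma integral_exp_neg_mul_sq_gaussianReal_le {t : ℝ} (ht : 0 < t) (a : ℝ) :
    ∫ x, Real.exp (-t * (x - a) ^ 2) ∂(gaussianReal 0 1) ≤ (√(2 * t))⁻¹ := by
  rw [integral_gaussianReal_eq_integral_smul one_ne_zero]
  have hint : Integrable fun x : ℝ => Real.exp (-t * (x - a) ^ 2) :=
    (integrable_exp_neg_mul_sq ht).comp_sub_right a
  have h1 : ∫ x, gaussianPDFReal 0 1 x • Real.exp (-t * (x - a) ^ 2) ≤
      ∫ x, (√(2 * Real.pi))⁻¹ * Real.exp (-t * (x - a) ^ 2) := by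
    refine integral_mono_of_nonneg (Filter.Eventually.of_forall fun x => ?_) (hint.const_mul _)
      (Filter.Eventually.of_forall fun x => ?_)
    · exact smul_nonneg (gaussianPDFReal_nonneg _ _ _) (Real.exp_nonneg _)
    · simp only [gaussianPDFReal, smul_eq_mul]
      refine mul_le_mul_of_nonneg_right ?_ (Real.exp_nonneg _)
      have : Real.exp (-(x - 0) ^ 2 / (2 * ((1 : NNReal) : ℝ))) ≤ 1 := by
        rw [Real.exp_le_one_iff]
        have := sq_nonneg (x - 0)
        simp only [NNReal.coe_one]
        linarith
      calc _ ≤ (√(2 * Real.pi * ((1 : NNReal) : ℝ)))⁻¹ * 1 := by gcongr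
        _ = _ := by simp
  refine h1.trans (le_of_eq ?_)
  rw [integral_const_mul, integral_sub_right_eq_self (fun x => Real.exp (-t * x ^ 2)) a,
    integral_gaussian, ← Real.sqrt_inv, ← Real.sqrt_mul (by positivity), ← Real.sqrt_inv]
  congr 1
  have := Real.pi_pos
  field_simp

lemma integral_exp_sq_div_four_gaussianReal :
    ∫ x, Real.exp (x ^ 2 / 4) ∂(gaussianReal 0 1) = √2 := by
  rw [integral_gaussianReal_eq_integral_smul one_ne_zero]
  have h : ∀ x : ℝ, gaussianPDFReal 0 1 x • Real.exp (x ^ 2 / 4) =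
      (√(2 * Real.pi))⁻¹ * Real.exp (-(1 / 4) * x ^ 2) := by
    intro x
    simp only [gaussianPDFReal, smul_eq_mul, NNReal.coe_one, mul_one, sub_zero]
    rw [mul_assoc, ← Real.exp_add]
    congr 2
    ring
  simp_rw [h]
  rw [integral_const_mul, integral_gaussian, ← Real.sqrt_inv, ← Real.sqrt_mul (by positivity)]
  congr 1
  have := Real.pi_pos
  field_simp
  norm_num

lemma integrable_exp_sq_div_four_gaussianReal :
    Integrable (fun x : ℝ => Real.exp (x ^ 2 / 4)) (gaussianReal 0 1) := by
  apply Integrable.of_integral_ne_zero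
  rw [integral_exp_sq_div_four_gaussianReal]
  positivity

lemma integrable_exp_neg_mul_sq_gaussianReal {t : ℝ} (ht : 0 < t) (a : ℝ) :
    Integrable (fun x : ℝ => Real.exp (-t * (x - a) ^ 2)) (gaussianReal 0 1) := by
  refine Integrable.of_bound (C := 1) (by fun_prop) (Filter.Eventually.of_forall fun x => ?_)
  rw [Real.norm_eq_abs, abs_of_pos (Real.exp_pos _), Real.exp_le_one_iff]
  nlinarith [sq_nonneg (x - a)]

/-- Small ball estimate for the standard Gaussian measure. -/
lemma stdGaussian_ball_le {k : ℕ} (hk : 0 < k) {s : ℝ} (hs : 0 < s)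
    (c : EuclideanSpace ℝ (Fin k)) :
    stdGaussian (EuclideanSpace ℝ (Fin k)) {a | ‖a - c‖ ≤ s} ≤
      ENNReal.ofReal ((√(Real.exp 1 / k) * s) ^ k) := by
  have hk' : (0 : ℝ) < k := by exact_mod_cast hk
  -- This `t` minimizes the Laplace transform bound `exp (t * s ^ 2) * (2 * t) ^ (-k / 2)`.
  set t : ℝ := k / (2 * s ^ 2) with ht
  have htpos : 0 < t := by positivity
  rw [← map_pi_eq_stdGaussian, Measure.map_apply (by fun_prop)
    (measurableSet_le (by fun_prop) (by fun_prop))]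
  set μ := Measure.pi fun _ : Fin k => gaussianReal 0 1
  have hint : Integrable (fun x : Fin k → ℝ => ∏ i, Real.exp (-t * (x i - c i) ^ 2)) μ :=
    Integrable.fintype_prod (f := fun i (x : ℝ) => Real.exp (-t * (x - c i) ^ 2))
      fun i => integrable_exp_neg_mul_sq_gaussianReal htpos _
  have hval : ∫ x, ∏ i, Real.exp (-t * (x i - c i) ^ 2) ∂μ ≤ ((√(2 * t))⁻¹) ^ k := by
    rw [integral_fintype_prod_eq_prod (f := fun i (x : ℝ) => Real.exp (-t * (x - c i) ^ 2))]
    calc _ ≤ ∏ _i : Fin k, (√(2 * t))⁻¹ :=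
          Finset.prod_le_prod (fun i _ => integral_nonneg fun x => Real.exp_nonneg _)
            fun i _ => integral_exp_neg_mul_sq_gaussianReal_le htpos _
      _ = _ := by simp
  have hmarkov := mul_meas_ge_le_integral_of_nonneg (μ := μ)
    (f := fun x : Fin k → ℝ => ∏ i, Real.exp (-t * (x i - c i) ^ 2))
    (Filter.Eventually.of_forall fun x => Finset.prod_nonneg fun i _ => Real.exp_nonneg _) hint
    (Real.exp (-t * s ^ 2))
  have hsub : WithLp.toLp 2 ⁻¹' {a : EuclideanSpace ℝ (Fin k) | ‖a - c‖ ≤ s} ⊆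
      {x : Fin k → ℝ | Real.exp (-t * s ^ 2) ≤ ∏ i, Real.exp (-t * (x i - c i) ^ 2)} := by
    intro x hx
    simp only [Set.mem_preimage, Set.mem_ofPred_eq] at hx ⊢
    rw [← Real.exp_sum, Real.exp_le_exp, ← Finset.mul_sum]
    have h2 : ∑ i, (x i - c i) ^ 2 ≤ s ^ 2 := by
      have h3 := EuclideanSpace.real_norm_sq_eq (WithLp.toLp 2 x - c)
      simp only [PiLp.sub_apply] at h3
      rw [← h3]
      gcongr
    nlinarith
  refine (measure_mono hsub).trans ?_
  rw [← ofReal_measureReal (by finiteness)]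
  apply ENNReal.ofReal_le_ofReal
  have h1 : Real.exp (-t * s ^ 2) * μ.real
      {x : Fin k → ℝ | Real.exp (-t * s ^ 2) ≤ ∏ i, Real.exp (-t * (x i - c i) ^ 2)} ≤
      ((√(2 * t))⁻¹) ^ k := hmarkov.trans hval
  have h2 : Real.exp (-t * s ^ 2) = (√(Real.exp 1)⁻¹) ^ k := by
    have h3 : √(Real.exp 1)⁻¹ = Real.exp (-(1 / 2)) := by
      rw [Real.sqrt_eq_iff_mul_self_eq (by positivity) (by positivity), ← Real.exp_add,
        ← Real.exp_neg]
      norm_num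
    rw [h3, ← Real.exp_nat_mul, ht]
    congr 1
    field_simp
  have h4 : √(Real.exp 1 / k) * s = (√(2 * t))⁻¹ * (√(Real.exp 1)) := by
    rw [ht, ← Real.sqrt_inv, ← Real.sqrt_mul (by positivity)]
    have : (2 * (k / (2 * s ^ 2)))⁻¹ * Real.exp 1 = (Real.exp 1 / k) * s ^ 2 := by
      field_simp
    rw [this, Real.sqrt_mul (by positivity), Real.sqrt_sq hs.le]
  rw [h4, mul_pow]
  have hpos : 0 < √(Real.exp 1) ^ k := by positivity
  have h5 := mul_le_mul_of_nonneg_right h1 hpos.le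
  have h6 : Real.exp (-t * s ^ 2) * √(Real.exp 1) ^ k = 1 := by
    rw [h2, ← mul_pow, Real.sqrt_inv, inv_mul_cancel₀ (by positivity), one_pow]
  refine le_trans (le_of_eq ?_) h5
  rw [mul_right_comm, h6, one_mul]

/-- Norm tail estimate for the standard Gaussian measure. -/
lemma stdGaussian_norm_ge_le (k : ℕ) :
    stdGaussian (EuclideanSpace ℝ (Fin k)) {a | 4 * √k ≤ ‖a‖} ≤
      ENNReal.ofReal (Real.exp (-3 * k)) := by
  rw [← map_pi_eq_stdGaussian, Measure.map_apply (by fun_prop)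
    (measurableSet_le (by fun_prop) (by fun_prop))]
  set μ := Measure.pi fun _ : Fin k => gaussianReal 0 1
  have hint : Integrable (fun x : Fin k → ℝ => ∏ i, Real.exp (x i ^ 2 / 4)) μ :=
    Integrable.fintype_prod (f := fun i (x : ℝ) => Real.exp (x ^ 2 / 4))
      fun i => integrable_exp_sq_div_four_gaussianReal
  have hval : ∫ x, ∏ i, Real.exp (x i ^ 2 / 4) ∂μ = √2 ^ k := by
    rw [integral_fintype_prod_eq_prod (f := fun i (x : ℝ) => Real.exp (x ^ 2 / 4))]
    simp [integral_exp_sq_div_four_gaussianReal]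
  -- The threshold is the value of `exp (‖a‖ ^ 2 / 4)` at `‖a‖ = 4 * √k`; the mean is only `√2 ^ k ≤
  -- exp k`.
  have hmarkov := mul_meas_ge_le_integral_of_nonneg (μ := μ)
    (f := fun x : Fin k → ℝ => ∏ i, Real.exp (x i ^ 2 / 4))
    (Filter.Eventually.of_forall fun x => Finset.prod_nonneg fun i _ => Real.exp_nonneg _) hint
    (Real.exp (4 * k))
  have hsub : WithLp.toLp 2 ⁻¹' {a : EuclideanSpace ℝ (Fin k) | 4 * √k ≤ ‖a‖} ⊆
      {x : Fin k → ℝ | Real.exp (4 * k) ≤ ∏ i, Real.exp (x i ^ 2 / 4)} := by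
    intro x hx
    simp only [Set.mem_preimage, Set.mem_ofPred_eq] at hx ⊢
    rw [← Real.exp_sum, Real.exp_le_exp, ← Finset.sum_div]
    have h3 := EuclideanSpace.real_norm_sq_eq (WithLp.toLp 2 x)
    simp only at h3
    rw [← h3]
    have h4 : (4 * √k) ^ 2 ≤ ‖WithLp.toLp 2 x‖ ^ 2 := by gcongr
    rw [mul_pow, Real.sq_sqrt (by positivity)] at h4
    linarith
  refine (measure_mono hsub).trans ?_
  rw [← ofReal_measureReal (by finiteness)]
  apply ENNReal.ofReal_le_ofReal
  rw [hval] at hmarkov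
  have h2 : √2 ^ k ≤ Real.exp k := by
    rw [← Real.exp_one_pow]
    gcongr
    have := Real.add_one_le_exp 1
    have h5 : √2 ≤ 2 := by rw [Real.sqrt_le_left (by norm_num)]; norm_num
    linarith
  have h6 : Real.exp (-3 * k) = Real.exp k / Real.exp (4 * k) := by
    rw [← Real.exp_sub]; congr 1; ring
  rw [h6, le_div_iff₀ (Real.exp_pos _)]
  linarith

/-! ### Coefficients and synthesis for a finite system of vectors -/

section Orthonormal

variable {E : Type*} [NormedAddCommGroup E] [InnerProductSpace ℝ E] [FiniteDimensional ℝ E]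

/-- The coefficient map of an orthonormal family. -/
noncomputable def coeffs {k : ℕ} (x : Fin k → E) : E →L[ℝ] EuclideanSpace ℝ (Fin k) :=
  LinearMap.toContinuousLinearMap
    { toFun := fun v => WithLp.toLp 2 fun i => inner ℝ (x i) v
      map_add' := fun u v => by ext i; simp [inner_add_right]
      map_smul' := fun r v => by ext i; simp [inner_smul_right] }

@[simp] lemma coeffs_apply {k : ℕ} (x : Fin k → E) (v : E) (i : Fin k) :
    coeffs x v i = inner ℝ (x i) v := rfl

/-- The synthesis map of a family of vectors. -/
noncomputable def synth {k : ℕ} (x : Fin k → E) : EuclideanSpace ℝ (Fin k) →L[ℝ] E :=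
  LinearMap.toContinuousLinearMap
    { toFun := fun a => ∑ i, a i • x i
      map_add' := fun u v => by simp [add_smul, Finset.sum_add_distrib]
      map_smul' := fun r v => by simp [mul_smul, Finset.smul_sum] }

lemma synth_apply {k : ℕ} (x : Fin k → E) (a : EuclideanSpace ℝ (Fin k)) :
    synth x a = ∑ i, a i • x i := rfl

lemma inner_coeffs {k : ℕ} (x : Fin k → E) (v : E) (a : EuclideanSpace ℝ (Fin k)) :
    inner ℝ (coeffs x v) a = inner ℝ v (synth x a) := by
  simp only [synth_apply, PiLp.inner_apply, coeffs_apply, inner_sum, inner_smul_right]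
  refine Finset.sum_congr rfl fun i _ => ?_
  rw [real_inner_comm v]
  simp

lemma coeffs_synth {k : ℕ} {x : Fin k → E} (hx : Orthonormal ℝ x)
    (a : EuclideanSpace ℝ (Fin k)) : coeffs x (synth x a) = a := by
  ext i
  rw [coeffs_apply, synth_apply]
  exact hx.inner_right_fintype _ _

lemma norm_synth {k : ℕ} {x : Fin k → E} (hx : Orthonormal ℝ x)
    (a : EuclideanSpace ℝ (Fin k)) : ‖synth x a‖ = ‖a‖ := by
  have h : inner ℝ (synth x a) (synth x a) = inner ℝ a a := by
    rw [← inner_coeffs, coeffs_synth hx]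
  rw [real_inner_self_eq_norm_sq, real_inner_self_eq_norm_sq] at h
  exact (sq_eq_sq₀ (norm_nonneg _) (norm_nonneg _)).1 h

lemma norm_coeffs_le {k : ℕ} {x : Fin k → E} (hx : Orthonormal ℝ x) (v : E) :
    ‖coeffs x v‖ ≤ ‖v‖ := by
  by_contra! h
  have h1 : ‖coeffs x v‖ ^ 2 ≤ ‖v‖ * ‖coeffs x v‖ := by
    rw [← real_inner_self_eq_norm_sq, inner_coeffs]
    refine (real_inner_le_norm _ _).trans ?_
    rw [norm_synth hx]
  nlinarith [norm_nonneg v]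

end Orthonormal

/-! ### Linear images of the standard Gaussian measure -/

section Map

variable {E F : Type*} [NormedAddCommGroup E] [InnerProductSpace ℝ E] [FiniteDimensional ℝ E]
  [MeasurableSpace E] [BorelSpace E] [NormedAddCommGroup F] [InnerProductSpace ℝ F]
  [FiniteDimensional ℝ F] [MeasurableSpace F] [BorelSpace F]

/-- A linear map whose adjoint is isometric maps the standard Gaussian measure to the standard
Gaussian measure. -/
lemma stdGaussian_map_of_adjoint (L : E →L[ℝ] F) (L' : F → E)
    (hadj : ∀ x y, inner ℝ (L x) y = inner ℝ x (L' y)) (hnorm : ∀ y, ‖L' y‖ = ‖y‖) :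
    (stdGaussian E).map L = stdGaussian F := by
  apply Measure.ext_of_charFun
  ext t
  have h : charFun ((stdGaussian E).map L) t = charFun (stdGaussian E) (L' t) := by
    rw [charFun_apply, charFun_apply, integral_map L.continuous.aemeasurable (by fun_prop)]
    simp_rw [hadj]
  rw [h, charFun_stdGaussian, charFun_stdGaussian, hnorm]

lemma stdGaussian_map_coeffs {k : ℕ} {x : Fin k → E} (hx : Orthonormal ℝ x) :
    (stdGaussian E).map (coeffs x) = stdGaussian (EuclideanSpace ℝ (Fin k)) :=
  stdGaussian_map_of_adjoint _ (synth x) (inner_coeffs x) (norm_synth hx)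

/-- Resampling the coordinates of a Gaussian vector with respect to an orthonormal family. -/
lemma measurePreserving_resample {k : ℕ} {x : Fin k → E} (hx : Orthonormal ℝ x) :
    MeasurePreserving (fun p : E × EuclideanSpace ℝ (Fin k) =>
      p.1 - synth x (coeffs x p.1) + synth x p.2)
      ((stdGaussian E).prod (stdGaussian (EuclideanSpace ℝ (Fin k)))) (stdGaussian E) := by
  refine ⟨by fun_prop, ?_⟩
  have : IsProbabilityMeasure (((stdGaussian E).prod (stdGaussian (EuclideanSpace ℝ (Fin k)))).map
      fun p : E × EuclideanSpace ℝ (Fin k) => p.1 - synth x (coeffs x p.1) + synth x p.2) :=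
    Measure.isProbabilityMeasure_map (Measurable.aemeasurable (by fun_prop))
  apply Measure.ext_of_charFun
  ext t
  -- The adjoint of the resampling map sends `t` to the pair of its component orthogonal to the
  -- system and its coefficients; by Pythagoras this preserves the norm, hence the characteristic
  -- function.
  have hinner : ∀ p : E × EuclideanSpace ℝ (Fin k),
      inner ℝ (p.1 - synth x (coeffs x p.1) + synth x p.2) t =
        inner ℝ p.1 (t - synth x (coeffs x t)) + inner ℝ p.2 (coeffs x t) := by
    intro p
    have h1 : inner ℝ (synth x (coeffs x p.1)) t = inner ℝ p.1 (synth x (coeffs x t)) := by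
      rw [real_inner_comm, ← inner_coeffs, real_inner_comm, inner_coeffs]
    have h2 : inner ℝ (synth x p.2) t = inner ℝ p.2 (coeffs x t) := by
      rw [real_inner_comm, ← inner_coeffs, real_inner_comm]
    rw [inner_add_left, inner_sub_left, inner_sub_right, h1, h2]
  have h : charFun (((stdGaussian E).prod (stdGaussian (EuclideanSpace ℝ (Fin k)))).map
      fun p : E × EuclideanSpace ℝ (Fin k) => p.1 - synth x (coeffs x p.1) + synth x p.2) t =
      charFun (stdGaussian E) (t - synth x (coeffs x t)) *
        charFun (stdGaussian (EuclideanSpace ℝ (Fin k))) (coeffs x t) := by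
    rw [charFun_apply, integral_map (Measurable.aemeasurable (by fun_prop)) (by fun_prop),
      charFun_apply, charFun_apply, ← integral_prod_mul]
    simp_rw [hinner]
    refine integral_congr_ae (Filter.Eventually.of_forall fun p => ?_)
    simp only [← Complex.exp_add]
    congr 1
    push_cast
    ring
  rw [h, charFun_stdGaussian, charFun_stdGaussian, charFun_stdGaussian, ← Complex.exp_add]
  congr 1
  have h3 : ‖t‖ ^ 2 = ‖t - synth x (coeffs x t)‖ ^ 2 + ‖coeffs x t‖ ^ 2 := by
    have h4 : inner ℝ t (synth x (coeffs x t)) = ‖coeffs x t‖ ^ 2 := by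
      rw [← inner_coeffs, real_inner_self_eq_norm_sq]
    rw [norm_sub_sq_real, h4, norm_synth hx]
    ring
  have h5 : ((‖t‖ : ℂ)) ^ 2 = (‖t - synth x (coeffs x t)‖ : ℂ) ^ 2 + (‖coeffs x t‖ : ℂ) ^ 2 := by
    exact_mod_cast h3
  rw [h5]
  ring

/-- Testing a Gaussian matrix with iid standard Gaussian rows on a unit vector. -/
lemma map_pi_inner_stdGaussian {k : ℕ} {y : E} (hy : ‖y‖ = 1) :
    (Measure.pi fun _ : Fin k => stdGaussian E).map
      (fun A => WithLp.toLp 2 fun i => inner ℝ (A i) y) =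
      stdGaussian (EuclideanSpace ℝ (Fin k)) := by
  have h1 : (stdGaussian E).map (fun v => inner ℝ v y) = gaussianReal 0 1 := by
    have h := stdGaussian_map_of_adjoint (F := ℝ) (innerSL ℝ y) (fun r => r • y)
      (fun x r => by simp [inner_smul_right, real_inner_comm])
      (fun r => by simp [norm_smul, hy])
    have h2 : stdGaussian ℝ = gaussianReal 0 1 := by
      apply Measure.ext_of_charFun
      ext t
      rw [charFun_stdGaussian, charFun_gaussianReal]
      congr 1
      simp only [Complex.ofReal_zero, mul_zero, zero_mul, NNReal.coe_one, Complex.ofReal_one,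
        one_mul, zero_sub]
      rw [← Complex.ofReal_pow, Real.norm_eq_abs, sq_abs]
      push_cast
      ring
    rw [← h2, ← h]
    congr 1
    ext v
    simp [real_inner_comm]
  have h3 : (fun A : Fin k → E => WithLp.toLp 2 fun i => inner ℝ (A i) y) =
      (WithLp.toLp 2) ∘ fun A : Fin k → E => fun i => inner ℝ (A i) y := rfl
  rw [h3, ← Measure.map_map (by fun_prop) (by fun_prop), ← map_pi_eq_stdGaussian]
  congr 1
  have : IsProbabilityMeasure ((stdGaussian E).map (fun v => inner ℝ v y)) := by
    rw [h1]; infer_instance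
  rw [Measure.pi_map_pi (f := fun _ v => inner ℝ v y) (by fun_prop)]
  simp [h1]

end Map

end GenericQuotient

namespace GenericQuotient

open ProbabilityTheory

/-! ### Absolutely convex hulls and Maurey's empirical method -/

section Hull

variable {ι E F : Type*} [Fintype ι] [NormedAddCommGroup E] [InnerProductSpace ℝ E]
  [NormedAddCommGroup F] [InnerProductSpace ℝ F]

/-- The absolutely convex hull of a finite family of vectors. -/
def absHull (w : ι → E) : Set E := {x | ∃ l : ι → ℝ, ∑ i, |l i| ≤ 1 ∧ x = ∑ i, l i • w i}

/-- The average of `m` vectors of the form `± w i`. -/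
noncomputable def signedAvg (w : ι → E) {m : ℕ} (f : Fin m → ι × Bool) : E :=
  (m : ℝ)⁻¹ • ∑ t, (if (f t).2 then (1 : ℝ) else -1) • w (f t).1

lemma map_signedAvg (L : E →L[ℝ] F) (w : ι → E) {m : ℕ} (f : Fin m → ι × Bool) :
    L (signedAvg w f) = signedAvg (fun i => L (w i)) f := by
  simp only [signedAvg, map_smul, map_sum]

lemma map_mem_absHull (L : E →L[ℝ] F) {w : ι → E} {x : E} (hx : x ∈ absHull w) :
    L x ∈ absHull fun i => L (w i) := by
  obtain ⟨l, hl, rfl⟩ := hx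
  exact ⟨l, hl, by simp⟩

lemma norm_le_of_mem_absHull {w : ι → E} {R : ℝ} (hw : ∀ i, ‖w i‖ ≤ R) (hR : 0 ≤ R) {x : E}
    (hx : x ∈ absHull w) : ‖x‖ ≤ R := by
  obtain ⟨l, hl, rfl⟩ := hx
  calc ‖∑ i, l i • w i‖ ≤ ∑ i, ‖l i • w i‖ := norm_sum_le _ _
    _ ≤ ∑ i, |l i| * R := Finset.sum_le_sum fun i _ => by
        rw [norm_smul, Real.norm_eq_abs]
        exact mul_le_mul_of_nonneg_left (hw i) (abs_nonneg _)
    _ = (∑ i, |l i|) * R := by rw [Finset.sum_mul]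
    _ ≤ 1 * R := by gcongr
    _ = R := one_mul R

/-- Average over `j` with weights `p`: the cross term vanishes because `x` is the mean of the `v j`,
and the variance is at most the second moment. Some `j` does no worse than the average. -/
lemma exists_norm_add_sq_le {κ : Type*} [Fintype κ] {p : κ → ℝ} (hp : ∀ j, 0 ≤ p j)
    (hp1 : ∑ j, p j = 1) (v : κ → E) {R : ℝ} (hv : ∀ j, ‖v j‖ ^ 2 ≤ R) {x : E}
    (hx : ∑ j, p j • v j = x) (S : E) : ∃ j, ‖S + (v j - x)‖ ^ 2 ≤ ‖S‖ ^ 2 + R := by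
  by_contra! h
  have h1 : ∑ j, p j * ‖S + (v j - x)‖ ^ 2 ≤ ‖S‖ ^ 2 + R := by
    have h2 : ∀ j, ‖S + (v j - x)‖ ^ 2 =
        ‖S - x‖ ^ 2 + 2 * inner ℝ (S - x) (v j) + ‖v j‖ ^ 2 := by
      intro j
      rw [← norm_add_sq_real]
      congr 2
      abel
    have h3 : ∑ j, p j * ‖S + (v j - x)‖ ^ 2 =
        ‖S - x‖ ^ 2 + 2 * inner ℝ (S - x) x + ∑ j, p j * ‖v j‖ ^ 2 := by
      simp_rw [h2, mul_add, Finset.sum_add_distrib, ← Finset.sum_mul, hp1, one_mul]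
      congr 2
      rw [← hx, inner_sum, Finset.mul_sum]
      refine Finset.sum_congr rfl fun j _ => ?_
      rw [inner_smul_right]
      ring
    have h4 : ∑ j, p j * ‖v j‖ ^ 2 ≤ R := by
      calc _ ≤ ∑ j, p j * R := Finset.sum_le_sum fun j _ =>
            mul_le_mul_of_nonneg_left (hv j) (hp j)
        _ = R := by rw [← Finset.sum_mul, hp1, one_mul]
    have h5 : ‖S‖ ^ 2 = ‖S - x‖ ^ 2 + 2 * inner ℝ (S - x) x + ‖x‖ ^ 2 := by
      rw [← norm_add_sq_real, sub_add_cancel]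
    nlinarith [sq_nonneg ‖x‖]
  obtain ⟨j, hj⟩ : ∃ j, 0 < p j := by
    by_contra! h0
    have : ∑ j, p j ≤ 0 := Finset.sum_nonpos fun j _ => h0 j
    linarith
  have h6 : ∑ j, p j * (‖S‖ ^ 2 + R) < ∑ j, p j * ‖S + (v j - x)‖ ^ 2 :=
    Finset.sum_lt_sum (fun j _ => mul_le_mul_of_nonneg_left (h j).le (hp j))
      ⟨j, Finset.mem_univ _, mul_lt_mul_of_pos_left (h j) hj⟩
  rw [← Finset.sum_mul, hp1, one_mul] at h6
  linarith

/-- Greedy form of the variance computation: the indices are chosen one at a time, and each adds at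
most `R` to the squared norm. -/
lemma exists_norm_sum_sub_sq_le {κ : Type*} [Fintype κ] {p : κ → ℝ} (hp : ∀ j, 0 ≤ p j)
    (hp1 : ∑ j, p j = 1) (v : κ → E) {R : ℝ} (hv : ∀ j, ‖v j‖ ^ 2 ≤ R) {x : E}
    (hx : ∑ j, p j • v j = x) (m : ℕ) :
    ∃ f : Fin m → κ, ‖∑ t, (v (f t) - x)‖ ^ 2 ≤ m * R := by
  induction m with
  | zero => exact ⟨Fin.elim0, by simp⟩
  | succ m ih =>
    obtain ⟨f, hf⟩ := ih
    obtain ⟨j, hj⟩ := exists_norm_add_sq_le hp hp1 v hv hx (∑ t, (v (f t) - x))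
    refine ⟨Fin.snoc f j, ?_⟩
    rw [Fin.sum_univ_castSucc]
    simp only [Fin.snoc_castSucc, Fin.snoc_last]
    push_cast
    linarith

lemma exists_weights_of_mem_absHull [Nonempty ι] {w : ι → E} {x : E} (hx : x ∈ absHull w) :
    ∃ p : ι × Bool → ℝ, (∀ j, 0 ≤ p j) ∧ ∑ j, p j = 1 ∧
      ∑ j, p j • ((if j.2 then (1 : ℝ) else -1) • w j.1) = x := by
  obtain ⟨l, hl, rfl⟩ := hx
  -- The mass missing from the positive and negative parts of `l` is spread evenly over all signed
  -- generators, where opposite signs cancel.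
  set d : ℝ := (1 - ∑ i, |l i|) / (2 * Fintype.card ι) with hd
  have hcard : (0 : ℝ) < Fintype.card ι := by exact_mod_cast Fintype.card_pos
  have hd0 : 0 ≤ d := div_nonneg (by linarith) (by positivity)
  refine ⟨fun j => (if j.2 then max (l j.1) 0 else max (-l j.1) 0) + d, ?_, ?_, ?_⟩
  · intro j
    dsimp only
    split_ifs <;> positivity
  · rw [Fintype.sum_prod_type]
    simp only [Fintype.univ_bool, Finset.mem_singleton, Bool.true_eq_false, not_false_eq_true,
      Finset.sum_insert, if_true, Finset.sum_singleton, Bool.false_eq_true, if_false]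
    have h1 : ∀ i, max (l i) 0 + d + (max (-l i) 0 + d) = |l i| + 2 * d := by
      intro i
      have h2 : max (l i) 0 + max (-l i) 0 = |l i| := by
        rcases le_total 0 (l i) with h | h
        · rw [max_eq_left h, max_eq_right (by linarith), abs_of_nonneg h, add_zero]
        · rw [max_eq_right h, max_eq_left (by linarith), abs_of_nonpos h, zero_add]
      linarith
    simp_rw [h1, Finset.sum_add_distrib, Finset.sum_const, Finset.card_univ, nsmul_eq_mul, hd]
    field_simp
    ring
  · rw [Fintype.sum_prod_type]
    simp only [Fintype.univ_bool, Finset.mem_singleton, Bool.true_eq_false, not_false_eq_true,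
      Finset.sum_insert, if_true, Finset.sum_singleton, Bool.false_eq_true, if_false]
    refine Finset.sum_congr rfl fun i _ => ?_
    rw [smul_smul, smul_smul, ← add_smul]
    congr 1
    rcases le_total 0 (l i) with h | h
    · rw [max_eq_left h, max_eq_right (by linarith)]
      ring
    · rw [max_eq_right h, max_eq_left (by linarith)]
      ring

/-- **Maurey's lemma**: every point of an absolutely convex hull is close to the average of few
signed generators. -/
lemma exists_norm_sub_signedAvg_le [Nonempty ι] {w : ι → E} {R : ℝ} (hw : ∀ i, ‖w i‖ ≤ R)
    {x : E} (hx : x ∈ absHull w) {m : ℕ} (hm : 0 < m) :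
    ∃ f : Fin m → ι × Bool, ‖x - signedAvg w f‖ ≤ R / √m := by
  have hR : 0 ≤ R := (norm_nonneg _).trans (hw (Classical.arbitrary ι))
  obtain ⟨p, hp, hp1, hpx⟩ := exists_weights_of_mem_absHull hx
  obtain ⟨f, hf⟩ := exists_norm_sum_sub_sq_le hp hp1
    (fun j => (if j.2 then (1 : ℝ) else -1) • w j.1) (R := R ^ 2) (fun j => by
      have : ‖(if j.2 then (1 : ℝ) else -1) • w j.1‖ = ‖w j.1‖ := by
        split_ifs <;> simp
      rw [this]
      gcongr
      exact hw _) hpx m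
  have hm' : (0 : ℝ) < m := by exact_mod_cast hm
  refine ⟨f, ?_⟩
  have h1 : x - signedAvg w f = -((m : ℝ)⁻¹ •
      ∑ t, ((if (f t).2 then (1 : ℝ) else -1) • w (f t).1 - x)) := by
    rw [Finset.sum_sub_distrib, smul_sub, signedAvg]
    simp only [Finset.sum_const, Finset.card_univ, Fintype.card_fin]
    rw [← Nat.cast_smul_eq_nsmul ℝ m x, smul_smul, inv_mul_cancel₀ hm'.ne', one_smul]
    abel
  rw [h1, norm_neg, norm_smul, Real.norm_eq_abs, abs_of_pos (inv_pos.2 hm')]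
  have h2 := Real.abs_le_sqrt hf
  rw [abs_of_nonneg (norm_nonneg _), Real.sqrt_mul hm'.le, Real.sqrt_sq hR] at h2
  calc (m : ℝ)⁻¹ * _ ≤ (m : ℝ)⁻¹ * (√m * R) := by gcongr
    _ = R / √m := by
      have h3 : (m : ℝ)⁻¹ = (√m)⁻¹ * (√m)⁻¹ := by
        rw [← mul_inv, Real.mul_self_sqrt hm'.le]
      have h4 : √(m : ℝ) ≠ 0 := by positivity
      rw [h3]
      field_simp

/-- Maurey's lemma for two norms simultaneously. -/
lemma exists_norm_sub_signedAvg_le_and [Nonempty ι] {w : ι → E} {R R' : ℝ} (hR : 0 < R)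
    (hR' : 0 < R') (hw : ∀ i, ‖w i‖ ≤ R) (L : E →L[ℝ] F) (hL : ∀ i, ‖L (w i)‖ ≤ R')
    {x : E} (hx : x ∈ absHull w) {m : ℕ} (hm : 0 < m) :
    ∃ f : Fin m → ι × Bool, ‖x - signedAvg w f‖ ≤ √2 * R / √m ∧
      ‖L x - L (signedAvg w f)‖ ≤ √2 * R' / √m := by
  -- Both norms are rescaled and combined into one Hilbert norm, in which the generators have length
  -- at most `√2`.
  let A : E →L[ℝ] WithLp 2 (E × F) :=
    (WithLp.prodContinuousLinearEquiv 2 ℝ E F).symm.toContinuousLinearMap ∘L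
      ((R⁻¹ • ContinuousLinearMap.id ℝ E).prod (R'⁻¹ • L))
  have hA : ∀ v, ‖A v‖ ^ 2 = (R⁻¹ * ‖v‖) ^ 2 + (R'⁻¹ * ‖L v‖) ^ 2 := by
    intro v
    rw [WithLp.prod_norm_sq_eq_of_L2]
    simp [A, norm_smul, abs_of_pos hR, abs_of_pos hR']
  have hAw : ∀ i, ‖A (w i)‖ ≤ √2 := by
    intro i
    apply Real.le_sqrt_of_sq_le
    rw [hA]
    have h1 : R⁻¹ * ‖w i‖ ≤ 1 := by rw [inv_mul_le_iff₀ hR]; simpa using hw i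
    have h2 : R'⁻¹ * ‖L (w i)‖ ≤ 1 := by rw [inv_mul_le_iff₀ hR']; simpa using hL i
    have h3 : (R⁻¹ * ‖w i‖) ^ 2 ≤ 1 := pow_le_one₀ (by positivity) h1
    have h4 : (R'⁻¹ * ‖L (w i)‖) ^ 2 ≤ 1 := pow_le_one₀ (by positivity) h2
    linarith
  obtain ⟨f, hf⟩ := exists_norm_sub_signedAvg_le hAw (map_mem_absHull A hx) hm
  rw [← map_signedAvg, ← map_sub] at hf
  have hf2 : (R⁻¹ * ‖x - signedAvg w f‖) ^ 2 + (R'⁻¹ * ‖L (x - signedAvg w f)‖) ^ 2 ≤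
      (√2 / √m) ^ 2 := by
    rw [← hA]
    gcongr
  refine ⟨f, ?_, ?_⟩
  · have h := abs_le_of_sq_le_sq (b := √2 / √m)
      (le_trans (le_add_of_nonneg_right (sq_nonneg _)) hf2) (by positivity)
    have h := (le_abs_self _).trans h
    rw [inv_mul_le_iff₀ hR] at h
    calc _ ≤ _ := h
      _ = _ := by ring
  · have h := abs_le_of_sq_le_sq (b := √2 / √m)
      (le_trans (le_add_of_nonneg_left (sq_nonneg _)) hf2) (by positivity)
    have h := (le_abs_self _).trans h
    rw [inv_mul_le_iff₀ hR', map_sub] at h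
    calc _ ≤ _ := h
      _ = _ := by ring

end Hull

/-! ### Sections of small diameter -/

section Section

variable {ι E : Type*} [Fintype ι] [NormedAddCommGroup E] [InnerProductSpace ℝ E]
  [FiniteDimensional ℝ E]

lemma coeffs_smul {k : ℕ} (x : Fin k → E) (r : ℝ) (v : E) : coeffs x (r • v) = r • coeffs x v :=
  map_smul _ _ _

variable [MeasurableSpace E] [BorelSpace E]

/-- `coeffs A` is a Gaussian matrix with `j` rows, so it sends a unit vector to a standard Gaussian
vector and the small ball estimate applies. The factor `exp (-5)` makes the probability small enough
to beat `exp (4 * j)` signed averages. -/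
lemma pi_stdGaussian_norm_coeffs_lt {j : ℕ} (hj : 0 < j) (y : E) :
    (Measure.pi fun _ : Fin j => stdGaussian E)
      {A | ‖coeffs A y‖ < Real.exp (-5) * √j * ‖y‖} ≤ ENNReal.ofReal (Real.exp (-(9 / 2) * j)) := by
  rcases eq_or_ne y 0 with rfl | hy
  · simp
  have hj' : (0 : ℝ) < j := by exact_mod_cast hj
  have hy' : 0 < ‖y‖ := norm_pos_iff.2 hy
  have hu : ‖(‖y‖⁻¹ • y)‖ = 1 := by
    rw [norm_smul, norm_inv, norm_norm, inv_mul_cancel₀ hy'.ne']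
  have h1 := stdGaussian_ball_le hj (s := Real.exp (-5) * √j) (by positivity) 0
  rw [← map_pi_inner_stdGaussian hu, Measure.map_apply (by fun_prop)
    (measurableSet_le (by fun_prop) (by fun_prop))] at h1
  refine (measure_mono ?_).trans (h1.trans (le_of_eq ?_))
  · intro A hA
    simp only [Set.mem_ofPred_eq, Set.mem_preimage, sub_zero] at hA ⊢
    have h2 : (WithLp.toLp 2 fun i => inner ℝ (A i) (‖y‖⁻¹ • y)) = ‖y‖⁻¹ • coeffs A y := by
      rw [← coeffs_smul]; rfl
    rw [h2, norm_smul, norm_inv, norm_norm, inv_mul_le_iff₀ hy']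
    linarith
  · congr 1
    have h3 : √(Real.exp 1 / j) * (Real.exp (-5) * √j) = Real.exp (-(9 / 2)) := by
      rw [Real.sqrt_div (Real.exp_pos _).le]
      have h4 : √(Real.exp 1) = Real.exp (1 / 2) := by rw [Real.exp_half]
      have h5 : √(j : ℝ) ≠ 0 := by positivity
      field_simp
      rw [h4, ← Real.exp_add]
      norm_num
    rw [h3, ← Real.exp_nat_mul]
    congr 1
    ring

lemma pi_stdGaussian_lt_norm_coeffs {j : ℕ} (y : E) {R : ℝ} (hR : ‖y‖ ≤ R) :
    (Measure.pi fun _ : Fin j => stdGaussian E)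
      {A | 4 * √j * R < ‖coeffs A y‖} ≤ ENNReal.ofReal (Real.exp (-3 * j)) := by
  rcases eq_or_ne y 0 with rfl | hy
  · have : {A : Fin j → E | 4 * √j * R < ‖coeffs A 0‖} = ∅ := by
      ext A
      simp only [map_zero, norm_zero, Set.mem_ofPred_eq, Set.mem_empty_iff_false, iff_false, not_lt]
      have : 0 ≤ R := (norm_nonneg _).trans hR
      positivity
    rw [this]
    simp
  have hy' : 0 < ‖y‖ := norm_pos_iff.2 hy
  have hu : ‖(‖y‖⁻¹ • y)‖ = 1 := by
    rw [norm_smul, norm_inv, norm_norm, inv_mul_cancel₀ hy'.ne']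
  have h1 := stdGaussian_norm_ge_le j
  rw [← map_pi_inner_stdGaussian hu, Measure.map_apply (by fun_prop)
    (measurableSet_le (by fun_prop) (by fun_prop))] at h1
  refine (measure_mono ?_).trans h1
  intro A hA
  simp only [Set.mem_ofPred_eq, Set.mem_preimage] at hA ⊢
  have h2 : (WithLp.toLp 2 fun i => inner ℝ (A i) (‖y‖⁻¹ • y)) = ‖y‖⁻¹ • coeffs A y := by
    rw [← coeffs_smul]; rfl
  rw [h2, norm_smul, norm_inv, norm_norm, le_inv_mul_iff₀ hy']
  have : 4 * √j * ‖y‖ ≤ 4 * √j * R := by gcongr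
  linarith

/-- The absolutely convex hull of `N` vectors of norm at most `R` has a section of codimension at
most `j` of radius of order `R * √(log N / j)`. -/
lemma exists_section_norm_le [Nonempty ι] {w : ι → E} {R : ℝ} (hR : 0 < R) (hw : ∀ i, ‖w i‖ ≤ R)
    {j m : ℕ} (hj : 0 < j) (hm : 0 < m)
    (hcount : (2 * Fintype.card ι : ℝ) ^ m ≤ Real.exp (4 * j))
    (hcard : (2 * Fintype.card ι : ℝ) ≤ Real.exp (2 * j)) :
    ∃ Y : Submodule ℝ E, Module.finrank ℝ E ≤ Module.finrank ℝ Y + j ∧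
      ∀ x ∈ Y, x ∈ absHull w → ‖x‖ ≤ (6 * Real.exp 5 + 2) * R / √m := by
  have hj' : (1 : ℝ) ≤ j := by exact_mod_cast hj
  have hm' : (0 : ℝ) < m := by exact_mod_cast hm
  set μ := Measure.pi fun _ : Fin j => stdGaussian E
  -- The bad matrices shrink some signed average too much or stretch some generator too much. The
  -- kernel of any other matrix is a suitable section.
  set S : Set (Fin j → E) := (⋃ f : Fin m → ι × Bool,
    {A | ‖coeffs A (signedAvg w f)‖ < Real.exp (-5) * √j * ‖signedAvg w f‖}) ∪
    ⋃ i, {A | 4 * √j * R < ‖coeffs A (w i)‖} with hS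
  have hμS : μ S < 1 := by
    calc μ S ≤ (∑ _f : Fin m → ι × Bool, ENNReal.ofReal (Real.exp (-(9 / 2) * j))) +
          ∑ _i : ι, ENNReal.ofReal (Real.exp (-3 * j)) := by
          refine (measure_union_le _ _).trans (add_le_add ?_ ?_)
          · exact (measure_iUnion_fintype_le _ _).trans
              (Finset.sum_le_sum fun f _ => pi_stdGaussian_norm_coeffs_lt hj _)
          · exact (measure_iUnion_fintype_le _ _).trans
              (Finset.sum_le_sum fun i _ => pi_stdGaussian_lt_norm_coeffs _ (hw i))
      _ = ENNReal.ofReal ((2 * Fintype.card ι : ℝ) ^ m * Real.exp (-(9 / 2) * j) +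
          Fintype.card ι * Real.exp (-3 * j)) := by
          simp only [Finset.sum_const, Finset.card_univ, nsmul_eq_mul, Fintype.card_fun,
            Fintype.card_prod, Fintype.card_bool, Fintype.card_fin]
          rw [ENNReal.ofReal_add (by positivity) (by positivity),
            ENNReal.ofReal_mul (by positivity), ENNReal.ofReal_mul (by positivity),
            ENNReal.ofReal_natCast]
          congr 2
          rw [← ENNReal.ofReal_natCast]
          congr 1
          push_cast
          ring
      _ < 1 := by
          rw [ENNReal.ofReal_lt_one]
          have h1 : (2 * Fintype.card ι : ℝ) ^ m * Real.exp (-(9 / 2) * j) ≤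
              Real.exp (-(1 / 2)) := by
            calc _ ≤ Real.exp (4 * j) * Real.exp (-(9 / 2) * j) := by gcongr
              _ = Real.exp (-(1 / 2) * j) := by rw [← Real.exp_add]; congr 1; ring
              _ ≤ _ := by apply Real.exp_le_exp.2; linarith
          have h2 : Fintype.card ι * Real.exp (-3 * j) ≤ Real.exp (-1) / 2 := by
            calc _ = (2 * Fintype.card ι) * Real.exp (-3 * j) / 2 := by ring
              _ ≤ Real.exp (2 * j) * Real.exp (-3 * j) / 2 := by gcongr
              _ = Real.exp (-j) / 2 := by rw [← Real.exp_add]; congr 2; ring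
              _ ≤ _ := by gcongr
          have h3 : Real.exp (-(1 / 2)) ≤ 2 / 3 := by
            rw [Real.exp_neg, inv_le_comm₀ (Real.exp_pos _) (by norm_num)]
            have := Real.add_one_le_exp (1 / 2)
            linarith
          have h4 : Real.exp (-1) ≤ 1 / 2 := by
            rw [Real.exp_neg, inv_le_comm₀ (Real.exp_pos _) (by norm_num)]
            have := Real.add_one_le_exp 1
            linarith
          linarith
  obtain ⟨A, hA⟩ : ∃ A, A ∉ S := by
    by_contra! h
    have : S = Set.univ := Set.eq_univ_of_forall h
    rw [this, measure_univ] at hμS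
    exact lt_irrefl _ hμS
  simp only [hS, Set.mem_union, Set.mem_iUnion, Set.mem_ofPred_eq, not_or, not_exists, not_lt]
    at hA
  obtain ⟨hA1, hA2⟩ := hA
  refine ⟨LinearMap.ker (coeffs A).toLinearMap, ?_, ?_⟩
  · have h1 := LinearMap.finrank_range_add_finrank_ker (coeffs A).toLinearMap
    have h2 := Submodule.finrank_le (LinearMap.range (coeffs A).toLinearMap)
    rw [finrank_euclideanSpace_fin] at h2
    omega
  · intro x hx hxw
    have hx0 : coeffs A x = 0 := hx
    have hj0 : 0 < √(j : ℝ) := by positivity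
    -- One signed average approximates `x` before and after applying the matrix. Since the matrix
    -- kills `x`, the average has small image; it is not shrunk much, so it is itself small, and so
    -- is `x`.
    obtain ⟨f, hf1, hf2⟩ := exists_norm_sub_signedAvg_le_and hR (R' := 4 * √j * R)
      (by positivity) hw (coeffs A) hA2 hxw hm
    rw [hx0, zero_sub, norm_neg] at hf2
    have h3 := (hA1 f).trans hf2
    have h4 : ‖signedAvg w f‖ ≤ Real.exp 5 * (4 * √2) * R / √m := by
      have h5 : Real.exp 5 * Real.exp (-5) = 1 := by rw [← Real.exp_add]; norm_num
      have h6 : Real.exp (-5) * ‖signedAvg w f‖ ≤ 4 * √2 * R / √m := by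
        refine le_of_mul_le_mul_left ?_ hj0
        calc √j * (Real.exp (-5) * ‖signedAvg w f‖) =
              Real.exp (-5) * √j * ‖signedAvg w f‖ := by ring
          _ ≤ _ := h3
          _ = _ := by ring
      calc ‖signedAvg w f‖ = Real.exp 5 * (Real.exp (-5) * ‖signedAvg w f‖) := by
            rw [← mul_assoc, h5, one_mul]
        _ ≤ Real.exp 5 * (4 * √2 * R / √m) := by gcongr
        _ = _ := by ring
    have h7 : √2 ≤ 3 / 2 := by rw [Real.sqrt_le_left (by norm_num)]; norm_num
    have h8 : 0 < R / √m := by positivity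
    have h9 : 0 < Real.exp 5 := Real.exp_pos _
    calc ‖x‖ = ‖(x - signedAvg w f) + signedAvg w f‖ := by rw [sub_add_cancel]
      _ ≤ √2 * R / √m + Real.exp 5 * (4 * √2) * R / √m :=
          (norm_add_le _ _).trans (add_le_add hf1 h4)
      _ = (√2 + Real.exp 5 * (4 * √2)) * (R / √m) := by ring
      _ ≤ (3 / 2 + Real.exp 5 * (4 * (3 / 2))) * (R / √m) := by gcongr
      _ ≤ (6 * Real.exp 5 + 2) * (R / √m) := by
          apply mul_le_mul_of_nonneg_right _ h8.le
          linarith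
      _ = _ := by ring

end Section

end GenericQuotient

namespace GenericQuotient

/-! ### Mixing operators -/

section Mixing

variable {E : Type*} [NormedAddCommGroup E] [InnerProductSpace ℝ E] [FiniteDimensional ℝ E]

/-- `T` maps some `k`-dimensional subspace far away from itself: compressed to a map from the span
of an orthonormal system `x` to the span of an orthonormal system `z` orthogonal to `x`, it is
bounded below by `α`. -/
def IsMixing (T : E →L[ℝ] E) (k : ℕ) (α : ℝ) : Prop :=
  ∃ x z : Fin k → E, Orthonormal ℝ x ∧ Orthonormal ℝ z ∧ (∀ i j, inner ℝ (z i) (x j) = 0) ∧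
    ∀ a, α * ‖a‖ ≤ ‖coeffs z (T (synth x a))‖

/-- A system of `l` unit vectors `x i` such that the components of `T (x i)` orthogonal to `x i` have
norm greater than `α`, with all the relevant vectors for different indices orthogonal. -/
structure IsMixingSystem (T : E →L[ℝ] E) (α : ℝ) {l : ℕ} (x : Fin l → E) : Prop where
  norm_eq : ∀ i, ‖x i‖ = 1
  inner_eq : ∀ i j, i ≠ j → inner ℝ (x i) (x j) = 0
  inner_map_eq : ∀ i j, i ≠ j → inner ℝ (T (x i)) (x j) = 0
  map_inner_map_eq : ∀ i j, i ≠ j → inner ℝ (T (x i)) (T (x j)) = 0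
  lt_norm : ∀ i, α < ‖T (x i) - inner ℝ (T (x i)) (x i) • x i‖

/-- The normalized components of `T (x i)` orthogonal to `x i` serve as the target system. With
respect to it the compression of `T` is diagonal, with the lengths of these components as entries.
-/
lemma IsMixingSystem.isMixing {T : E →L[ℝ] E} {α : ℝ} (hα : 0 ≤ α) {k : ℕ} {x : Fin k → E}
    (h : IsMixingSystem T α x) : IsMixing T k α := by
  set y : Fin k → E := fun i => T (x i) - inner ℝ (T (x i)) (x i) • x i with hy
  have hypos : ∀ i, 0 < ‖y i‖ := fun i => hα.trans_lt (h.lt_norm i)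
  have hxx : ∀ i, inner ℝ (x i) (x i) = (1 : ℝ) := fun i => by
    rw [real_inner_self_eq_norm_sq, h.norm_eq, one_pow]
  have hyx : ∀ i j, inner ℝ (y i) (x j) = 0 := by
    intro i j
    rw [hy]
    simp only [inner_sub_left, inner_smul_left, RCLike.conj_to_real]
    rcases eq_or_ne i j with rfl | hij
    · rw [hxx]; ring
    · rw [h.inner_eq i j hij, h.inner_map_eq i j hij]; ring
  have hyT : ∀ i j, i ≠ j → inner ℝ (y i) (T (x j)) = 0 := by
    intro i j hij
    rw [hy]
    simp only [inner_sub_left, inner_smul_left, RCLike.conj_to_real]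
    rw [h.map_inner_map_eq i j hij, real_inner_comm (T (x j)), h.inner_map_eq j i hij.symm]
    ring
  have hyy : ∀ i j, inner ℝ (y i) (y j) = inner ℝ (y i) (T (x j)) := by
    intro i j
    conv_lhs => rw [hy]
    simp only
    change inner ℝ (y i) (y j) = _
    rw [hy]
    simp only
    change inner ℝ (y i) (T (x j) - inner ℝ (T (x j)) (x j) • x j) = inner ℝ (y i) (T (x j))
    rw [inner_sub_right, inner_smul_right, hyx]
    ring
  refine ⟨x, fun i => ‖y i‖⁻¹ • y i, ?_, ?_, ?_, ?_⟩
  · exact ⟨h.norm_eq, fun i j hij => h.inner_eq i j hij⟩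
  · refine ⟨fun i => ?_, fun i j hij => ?_⟩
    · rw [norm_smul, norm_inv, norm_norm, inv_mul_cancel₀ (hypos i).ne']
    · simp only [inner_smul_left, inner_smul_right, hyy, hyT i j hij, mul_zero]
  · intro i j
    rw [inner_smul_left, hyx, mul_zero]
  · intro a
    have hcoef : ∀ i, coeffs (fun i => ‖y i‖⁻¹ • y i) (T (synth x a)) i = a i * ‖y i‖ := by
      intro i
      rw [coeffs_apply, synth_apply, map_sum, inner_sum, Finset.sum_eq_single i]
      · rw [map_smul, inner_smul_right, inner_smul_left, ← hyy, real_inner_self_eq_norm_sq]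
        have := (hypos i).ne'
        simp only [RCLike.conj_to_real]
        field_simp
      · intro j _ hj
        rw [map_smul, inner_smul_right, inner_smul_left, hyT i j hj.symm]
        simp
      · simp
    refine (sq_le_sq₀ (by positivity) (norm_nonneg _)).1 ?_
    rw [mul_pow, EuclideanSpace.real_norm_sq_eq, EuclideanSpace.real_norm_sq_eq, Finset.mul_sum]
    refine Finset.sum_le_sum fun i _ => ?_
    rw [hcoef, mul_pow, mul_comm]
    have := h.lt_norm i
    gcongr

lemma IsMixingSystem.snoc {T : E →L[ℝ] E} {α : ℝ} {l : ℕ} {x : Fin l → E}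
    (h : IsMixingSystem T α x) {v : E} (hv : ‖v‖ = 1) (h1 : ∀ i, inner ℝ (x i) v = 0)
    (h2 : ∀ i, inner ℝ (T (x i)) v = 0) (h3 : ∀ i, inner ℝ (x i) (T v) = 0)
    (h4 : ∀ i, inner ℝ (T (x i)) (T v) = 0) (h5 : α < ‖T v - inner ℝ (T v) v • v‖) :
    IsMixingSystem T α (Fin.snoc x v : Fin (l + 1) → E) := by
  constructor
  · intro i
    refine Fin.lastCases ?_ (fun i => ?_) i
    · simpa using hv
    · simpa using h.norm_eq i
  · intro i j
    refine Fin.lastCases ?_ (fun i => ?_) i <;> refine Fin.lastCases ?_ (fun j => ?_) j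
    · simp
    · intro _; simpa [real_inner_comm] using h1 j
    · intro _; simpa using h1 i
    · intro hij; simpa using h.inner_eq i j (fun h => hij (by rw [h]))
  · intro i j
    refine Fin.lastCases ?_ (fun i => ?_) i <;> refine Fin.lastCases ?_ (fun j => ?_) j
    · simp
    · intro _; simpa [real_inner_comm] using h3 j
    · intro _; simpa using h2 i
    · intro hij; simpa using h.inner_map_eq i j (fun h => hij (by rw [h]))
  · intro i j
    refine Fin.lastCases ?_ (fun i => ?_) i <;> refine Fin.lastCases ?_ (fun j => ?_) j
    · simp
    · intro _; simpa [real_inner_comm] using h4 j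
    · intro _; simpa using h4 i
    · intro hij; simpa using h.map_inner_map_eq i j (fun h => hij (by rw [h]))
  · intro i
    refine Fin.lastCases ?_ (fun i => ?_) i
    · simpa using h5
    · simpa using h.lt_norm i

/-- If `T` moves every vector of a subspace almost along itself, then it is almost scalar there. -/
lemma exists_norm_sub_smul_le {T : E →L[ℝ] E} {α : ℝ} (hα : 0 ≤ α) (Z : Submodule ℝ E)
    (h : ∀ v ∈ Z, ∃ r : ℝ, ‖T v - r • v‖ ≤ α * ‖v‖) :
    ∃ r : ℝ, ∀ v ∈ Z, ‖T v - r • v‖ ≤ 10 * α * ‖v‖ := by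
  rcases eq_or_ne Z ⊥ with rfl | hZ
  · refine ⟨0, fun v hv => ?_⟩
    rw [Submodule.mem_bot] at hv
    simp [hv]
  obtain ⟨u, hu, hu0⟩ := Submodule.exists_mem_ne_zero_of_ne_bot hZ
  obtain ⟨x, hx, hx1⟩ : ∃ x ∈ Z, ‖x‖ = 1 :=
    ⟨‖u‖⁻¹ • u, Z.smul_mem _ hu, by
      rw [norm_smul, norm_inv, norm_norm, inv_mul_cancel₀ (norm_ne_zero_iff.2 hu0)]⟩
  obtain ⟨r, hr⟩ := h x hx
  rw [hx1, mul_one] at hr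
  have hxx : inner ℝ x x = (1 : ℝ) := by rw [real_inner_self_eq_norm_sq, hx1, one_pow]
  have horth : ∀ y ∈ Z, ‖y‖ = 1 → inner ℝ x y = (0 : ℝ) → ‖T y - r • y‖ ≤ 8 * α := by
    intro y hy hy1 hxy
    have hyy : inner ℝ y y = (1 : ℝ) := by rw [real_inner_self_eq_norm_sq, hy1, one_pow]
    obtain ⟨b, hb⟩ := h y hy
    rw [hy1, mul_one] at hb
    obtain ⟨d, hd⟩ := h (x + y) (Z.add_mem hx hy)
    have hn : ‖x + y‖ ≤ 3 / 2 := by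
      have h1 := norm_add_sq_real x y
      rw [hx1, hy1, hxy] at h1
      nlinarith [norm_nonneg (x + y)]
    -- The approximate eigenvalue `d` of `x + y` links those of `x` and `y`. The errors are `α` for
    -- each of `x`, `y` and `3 / 2 * α` for `x + y`; taking components gives `|b - r| ≤ 7 * α`.
    have hw : ‖(r - d) • x + (b - d) • y‖ ≤ 7 / 2 * α := by
      have h2 : (r - d) • x + (b - d) • y =
          (T (x + y) - d • (x + y)) - (T x - r • x) - (T y - b • y) := by
        rw [map_add, sub_smul, sub_smul, smul_add]
        abel
      rw [h2]
      have h3 : α * ‖x + y‖ ≤ α * (3 / 2) := by gcongr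
      have h4 := norm_sub_le (T (x + y) - d • (x + y) - (T x - r • x)) (T y - b • y)
      have h5 := norm_sub_le (T (x + y) - d • (x + y)) (T x - r • x)
      linarith
    have hr' : |r - d| ≤ 7 / 2 * α := by
      have h1 := abs_real_inner_le_norm x ((r - d) • x + (b - d) • y)
      rw [inner_add_right, inner_smul_right, inner_smul_right, hxx, hxy, hx1] at h1
      simp only [mul_one, mul_zero, add_zero, one_mul] at h1
      exact h1.trans hw
    have hb' : |b - d| ≤ 7 / 2 * α := by
      have h1 := abs_real_inner_le_norm y ((r - d) • x + (b - d) • y)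
      rw [inner_add_right, inner_smul_right, inner_smul_right, hyy, real_inner_comm, hxy, hy1] at h1
      simp only [mul_one, mul_zero, zero_add, one_mul] at h1
      exact h1.trans hw
    have h6 : T y - r • y = (T y - b • y) + (b - r) • y := by
      rw [sub_smul]; abel
    rw [h6]
    refine (norm_add_le _ _).trans ?_
    rw [norm_smul, hy1, mul_one, Real.norm_eq_abs]
    have h7 : |b - r| ≤ |b - d| + |r - d| := by
      rw [abs_sub_comm r d]
      exact abs_sub_le b d r
    linarith
  refine ⟨r, fun v hv => ?_⟩
  set s : ℝ := inner ℝ x v with hs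
  have hs' : |s| ≤ ‖v‖ := by
    have := abs_real_inner_le_norm x v
    rwa [hx1, one_mul] at this
  obtain ⟨y, hy⟩ : ∃ y : E, y = v - s • x := ⟨_, rfl⟩
  have hyZ : y ∈ Z := hy ▸ Z.sub_mem hv (Z.smul_mem _ hx)
  have hxy : inner ℝ x y = (0 : ℝ) := by
    rw [hy, inner_sub_right, inner_smul_right, hxx, hs]; ring
  have hyn : ‖y‖ ≤ ‖v‖ := by
    have h1 : ‖v‖ ^ 2 = ‖y‖ ^ 2 + s ^ 2 := by
      have h2 : v = y + s • x := by rw [hy]; abel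
      conv_lhs => rw [h2]
      rw [norm_add_sq_real, inner_smul_right, real_inner_comm, hxy, norm_smul, hx1]
      simp
    exact (sq_le_sq₀ (norm_nonneg _) (norm_nonneg _)).1 (by nlinarith [sq_nonneg s])
  have hTy : ‖T y - r • y‖ ≤ 8 * α * ‖y‖ := by
    rcases eq_or_ne y 0 with h0 | h0
    · simp [h0]
    have hy0 : 0 < ‖y‖ := norm_pos_iff.2 h0
    have h1 := horth (‖y‖⁻¹ • y) (Z.smul_mem _ hyZ)
      (by rw [norm_smul, norm_inv, norm_norm, inv_mul_cancel₀ hy0.ne'])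
      (by rw [inner_smul_right, hxy, mul_zero])
    rw [map_smul, smul_comm, ← smul_sub, norm_smul, norm_inv, norm_norm, inv_mul_le_iff₀ hy0] at h1
    linarith
  have h2 : T v - r • v = s • (T x - r • x) + (T y - r • y) := by
    have h3 : v = s • x + y := by rw [hy]; abel
    conv_lhs => rw [h3]
    rw [map_add, map_smul, smul_add, smul_sub, smul_comm r s]
    abel
  rw [h2]
  refine (norm_add_le _ _).trans ?_
  rw [norm_smul, Real.norm_eq_abs]
  have h4 : |s| * ‖T x - r • x‖ ≤ ‖v‖ * α := by gcongr
  have h5 : 8 * α * ‖y‖ ≤ 8 * α * ‖v‖ := by gcongr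
  nlinarith [mul_nonneg hα (norm_nonneg v)]

/-- An operator that is not mixing is almost scalar on a subspace of small codimension. -/
lemma exists_almost_scalar_of_not_isMixing {T : E →L[ℝ] E} {k : ℕ} {α : ℝ} (hα : 0 ≤ α)
    (h : ¬ IsMixing T k α) :
    ∃ (r : ℝ) (Z : Submodule ℝ E), Module.finrank ℝ E ≤ Module.finrank ℝ Z + 4 * k ∧
      ∀ v ∈ Z, ‖T v - r • v‖ ≤ 10 * α * ‖v‖ := by
  have hk : ¬ ∃ x : Fin k → E, IsMixingSystem T α x := fun ⟨x, hx⟩ => h (hx.isMixing hα)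
  have h0 : ∃ x : Fin 0 → E, IsMixingSystem T α x :=
    ⟨Fin.elim0, ⟨fun i => i.elim0, fun i => i.elim0, fun i => i.elim0, fun i => i.elim0,
      fun i => i.elim0⟩⟩
  -- A system that cannot be lengthened: since none of length `k` exists, growth from the empty
  -- system stops before `k`.
  obtain ⟨l, hlk, ⟨x, hx⟩, hl⟩ : ∃ l < k, (∃ x : Fin l → E, IsMixingSystem T α x) ∧
      ¬ ∃ x : Fin (l + 1) → E, IsMixingSystem T α x := by
    by_contra! hcon
    have : ∀ l ≤ k, ∃ x : Fin l → E, IsMixingSystem T α x := by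
      intro l
      induction l with
      | zero => exact fun _ => h0
      | succ l ih => exact fun hl => hcon l (by omega) (ih (by omega))
    exact hk (this k le_rfl)
  set T' := ContinuousLinearMap.adjoint T with hT'
  -- Orthogonality to these four vectors per index gives all the relations needed to append a
  -- vector, whence the codimension `4 * k`. By maximality, `T` then moves every unit vector
  -- orthogonal to them almost along itself.
  let b : Fin l × Fin 4 → E := fun p => ![x p.1, T (x p.1), T' (x p.1), T' (T (x p.1))] p.2
  set W : Submodule ℝ E := Submodule.span ℝ (Set.range b) with hW
  have hWfin : Module.finrank ℝ W ≤ 4 * k := by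
    have := finrank_range_le_card (R := ℝ) b
    rw [Fintype.card_prod, Fintype.card_fin, Fintype.card_fin] at this
    unfold Set.finrank at this
    rw [hW]
    omega
  have hmem : ∀ i j, b (i, j) ∈ W := fun i j => Submodule.subset_span ⟨_, rfl⟩
  have hunit : ∀ v ∈ Wᗮ, ‖v‖ = 1 → ‖T v - inner ℝ (T v) v • v‖ ≤ α := by
    intro v hv hv1
    by_contra! hlt
    refine hl ⟨_, hx.snoc hv1 (fun i => ?_) (fun i => ?_) (fun i => ?_) (fun i => ?_) hlt⟩
    · exact hv _ (hmem i 0)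
    · exact hv _ (hmem i 1)
    · rw [← ContinuousLinearMap.adjoint_inner_left]
      exact hv _ (hmem i 2)
    · rw [← ContinuousLinearMap.adjoint_inner_left]
      exact hv _ (hmem i 3)
  obtain ⟨r, hr⟩ := exists_norm_sub_smul_le (T := T) hα Wᗮ (fun v hv => by
    rcases eq_or_ne v 0 with rfl | h0
    · exact ⟨0, by simp⟩
    have hv0 : 0 < ‖v‖ := norm_pos_iff.2 h0
    have h1 := hunit (‖v‖⁻¹ • v) (Wᗮ.smul_mem _ hv)
      (by rw [norm_smul, norm_inv, norm_norm, inv_mul_cancel₀ hv0.ne'])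
    refine ⟨inner ℝ (T (‖v‖⁻¹ • v)) (‖v‖⁻¹ • v), ?_⟩
    rw [map_smul] at h1 ⊢
    rw [smul_comm _ (‖v‖⁻¹), ← smul_sub, norm_smul, norm_inv, norm_norm,
      inv_mul_le_iff₀ hv0, mul_comm] at h1
    exact h1)
  refine ⟨r, Wᗮ, ?_, hr⟩
  have := Submodule.finrank_add_finrank_orthogonal W
  omega

end Mixing

end GenericQuotient

namespace GenericQuotient

open ProbabilityTheory

/-! ### Grids -/

/-- The point of the grid of mesh `δ` with the given (shifted) integer coordinates. -/
noncomputable def gridPoint {n : ℕ} (δ : ℝ) (L : ℕ) (z : Fin n → Fin (2 * L + 1)) :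
    EuclideanSpace ℝ (Fin n) := WithLp.toLp 2 fun i => δ * (((z i : ℕ) : ℝ) - L)

lemma norm_le_sqrt_mul_of_abs_le {n : ℕ} {v : EuclideanSpace ℝ (Fin n)} {δ : ℝ} (hδ : 0 ≤ δ)
    (h : ∀ i, |v i| ≤ δ) : ‖v‖ ≤ √n * δ := by
  rw [EuclideanSpace.norm_eq, Real.sqrt_le_left (by positivity), mul_pow,
    Real.sq_sqrt (by positivity)]
  calc ∑ i, ‖v i‖ ^ 2 ≤ ∑ _i : Fin n, δ ^ 2 := Finset.sum_le_sum fun i _ => by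
        rw [Real.norm_eq_abs]
        gcongr
        exact h i
    _ = n * δ ^ 2 := by simp

lemma sum_abs_le_sqrt_mul_norm {n : ℕ} (v : EuclideanSpace ℝ (Fin n)) :
    ∑ i, |v i| ≤ √n * ‖v‖ := by
  have h := Finset.sum_mul_sq_le_sq_mul_sq Finset.univ (fun _ : Fin n => (1 : ℝ)) fun i => |v i|
  simp only [one_mul, one_pow, Finset.sum_const, Finset.card_univ, Fintype.card_fin,
    nsmul_eq_mul, mul_one, sq_abs] at h
  rw [← EuclideanSpace.real_norm_sq_eq] at h
  calc ∑ i, |v i| ≤ √(n * ‖v‖ ^ 2) := Real.le_sqrt_of_sq_le h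
    _ = √n * ‖v‖ := by rw [Real.sqrt_mul (by positivity), Real.sqrt_sq (norm_nonneg _)]

lemma exists_norm_sub_gridPoint_le {n : ℕ} {δ : ℝ} (hδ : 0 < δ) {L : ℕ}
    {v : EuclideanSpace ℝ (Fin n)} (hv : ∀ i, |v i| ≤ δ * L) :
    ∃ z : Fin n → Fin (2 * L + 1), ‖v - gridPoint δ L z‖ ≤ √n * δ := by
  have h1 : ∀ i, ∃ z : Fin (2 * L + 1), |v i - δ * (((z : ℕ) : ℝ) - L)| ≤ δ := by
    intro i
    obtain ⟨h2, h3⟩ := abs_le.1 (hv i)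
    have h4 : -(L : ℝ) ≤ v i / δ := by rw [le_div_iff₀ hδ]; linarith
    have h5 : v i / δ ≤ L := by rw [div_le_iff₀ hδ]; linarith
    have h6 : -(L : ℤ) ≤ ⌊v i / δ⌋ := Int.le_floor.2 (by push_cast; exact h4)
    have h7 : ⌊v i / δ⌋ ≤ (L : ℤ) := by
      have := Int.floor_le_floor h5
      simpa using this
    refine ⟨⟨(⌊v i / δ⌋ + L).toNat, by omega⟩, ?_⟩
    have h8 : (((⌊v i / δ⌋ + L).toNat : ℕ) : ℝ) = ⌊v i / δ⌋ + L := by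
      have : (((⌊v i / δ⌋ + L).toNat : ℕ) : ℤ) = ⌊v i / δ⌋ + L := Int.toNat_of_nonneg (by omega)
      exact_mod_cast this
    simp only
    rw [h8, add_sub_cancel_right]
    have h9 := Int.floor_le (v i / δ)
    have h10 := Int.lt_floor_add_one (v i / δ)
    rw [le_div_iff₀ hδ] at h9
    rw [div_lt_iff₀ hδ] at h10
    rw [abs_le]
    constructor <;> linarith
  choose z hz using h1
  exact ⟨z, norm_le_sqrt_mul_of_abs_le hδ.le fun i => by simpa [gridPoint] using hz i⟩

/-! ### Random Gaussian families -/

/-- The law of a family of `N` independent standard Gaussian vectors. -/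
noncomputable def gaussianFamily (N n : ℕ) : Measure (Fin N → EuclideanSpace ℝ (Fin n)) :=
  Measure.pi fun _ => stdGaussian (EuclideanSpace ℝ (Fin n))

instance (N n : ℕ) : IsProbabilityMeasure (gaussianFamily N n) := by
  unfold gaussianFamily; infer_instance

lemma gaussianFamily_norm_gt (N n : ℕ) :
    gaussianFamily N n {g | ∃ l, 4 * √n < ‖g l‖} ≤ ENNReal.ofReal (N * Real.exp (-3 * n)) := by
  have h1 : {g : Fin N → EuclideanSpace ℝ (Fin n) | ∃ l, 4 * √n < ‖g l‖} =
      ⋃ l, {g | 4 * √n < ‖g l‖} := by ext g; simp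
  rw [h1]
  refine (measure_iUnion_fintype_le _ _).trans ?_
  have h2 : ∀ l, gaussianFamily N n {g | 4 * √n < ‖g l‖} ≤ ENNReal.ofReal (Real.exp (-3 * n)) := by
    intro l
    have h3 := (measurePreserving_eval
      (fun _ : Fin N => stdGaussian (EuclideanSpace ℝ (Fin n))) l).measure_preimage
      (s := {v | 4 * √n < ‖v‖}) (measurableSet_lt (by fun_prop) (by fun_prop)).nullMeasurableSet
    refine le_trans (le_of_eq h3) ((measure_mono ?_).trans (stdGaussian_norm_ge_le n))
    intro v hv
    simp only [Set.mem_ofPred_eq] at hv ⊢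
    exact hv.le
  refine (Finset.sum_le_sum fun l _ => h2 l).trans (le_of_eq ?_)
  rw [Finset.sum_const, Finset.card_univ, Fintype.card_fin, nsmul_eq_mul,
    ENNReal.ofReal_mul (by positivity), ENNReal.ofReal_natCast]

/-- The component along `θ / ‖θ‖` is a single Gaussian variable forced into `[-1/5, 1/5]`, which has
probability at most `√e / 5 ≤ 1 / e` because `e ^ (3 / 2) ≤ 5`. -/
lemma stdGaussian_abs_inner_le {n : ℕ} {θ : EuclideanSpace ℝ (Fin n)} (hθ : 1 / 2 ≤ ‖θ‖) :
    stdGaussian (EuclideanSpace ℝ (Fin n)) {v | |inner ℝ v θ| ≤ 1 / 10} ≤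
      ENNReal.ofReal (Real.exp (-1)) := by
  have hθ0 : 0 < ‖θ‖ := by linarith
  have hx : Orthonormal ℝ fun _ : Fin 1 => ‖θ‖⁻¹ • θ := by
    refine ⟨fun _ => ?_, fun i j hij => absurd (Subsingleton.elim i j) hij⟩
    rw [norm_smul, norm_inv, norm_norm, inv_mul_cancel₀ hθ0.ne']
  have h1 := stdGaussian_ball_le (k := 1) one_pos (s := 1 / 5) (by norm_num) 0
  rw [← stdGaussian_map_coeffs hx, Measure.map_apply (by fun_prop)
    (measurableSet_le (by fun_prop) (by fun_prop))] at h1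
  refine (measure_mono ?_).trans (h1.trans (ENNReal.ofReal_le_ofReal ?_))
  · intro v hv
    simp only [Set.mem_ofPred_eq, Set.mem_preimage, sub_zero] at hv ⊢
    rw [EuclideanSpace.norm_eq, Fin.sum_univ_one, Real.sqrt_sq (norm_nonneg _), coeffs_apply,
      inner_smul_left, Real.norm_eq_abs, abs_mul, real_inner_comm]
    simp only [RCLike.conj_to_real, abs_inv, abs_norm]
    rw [inv_mul_le_iff₀ hθ0]
    linarith
  · rw [Nat.cast_one, div_one, pow_one]
    have h4 : √(Real.exp 1) = Real.exp (1 / 2) := by rw [Real.exp_half]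
    rw [h4]
    have h5 : Real.exp (1 / 2) * (1 / 5) = Real.exp (-1) * (Real.exp (3 / 2) / 5) := by
      have h12 : Real.exp (1 / 2) = Real.exp (-1) * Real.exp (3 / 2) := by
        rw [← Real.exp_add]; norm_num
      rw [h12]
      ring
    have h6 : Real.exp (3 / 2) ≤ 5 := by
      have h7 := Real.exp_one_lt_d9
      have h8 : Real.exp (3 / 2) ^ 2 = Real.exp 1 ^ 3 := by
        rw [← Real.exp_nat_mul, ← Real.exp_nat_mul]
        norm_num
      have h9 : Real.exp 1 ^ 3 ≤ (2.7182818286 : ℝ) ^ 3 := by gcongr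
      have h10 : (2.7182818286 : ℝ) ^ 3 ≤ 5 ^ 2 := by norm_num
      exact (sq_le_sq₀ (Real.exp_pos _).le (by norm_num)).1 (by linarith)
    rw [h5]
    have h11 := Real.exp_pos (-1)
    nlinarith

/-- With high probability, a bounded Gaussian family norms the sphere. -/
lemma gaussianFamily_exists_small_inner {N n : ℕ} (hn : 80 ≤ n) :
    gaussianFamily N n {g | (∀ l, ‖g l‖ ≤ 4 * √n) ∧ ∃ θ : EuclideanSpace ℝ (Fin n), ‖θ‖ = 1 ∧
      ∀ l, |inner ℝ (g l) θ| ≤ 1 / 20} ≤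
      ENNReal.ofReal ((2 * (n : ℝ) ^ 2 + 1) ^ n * Real.exp (-N)) := by
  have hn' : (80 : ℝ) ≤ n := by exact_mod_cast hn
  -- With this mesh, rounding `θ` changes its inner products with vectors of norm at most `4 * √n`
  -- by at most `4 / n ≤ 1 / 20`.
  set δ : ℝ := 1 / (n : ℝ) ^ 2 with hδ
  have hδ0 : 0 < δ := by positivity
  set L : ℕ := n ^ 2 with hL
  have hδL : δ * L = 1 := by rw [hδ, hL]; push_cast; field_simp
  have hsq : √(n : ℝ) * √n = n := Real.mul_self_sqrt (by positivity)
  set S : (Fin n → Fin (2 * L + 1)) → Set (Fin N → EuclideanSpace ℝ (Fin n)) := fun z =>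
    {g | 1 / 2 ≤ ‖gridPoint δ L z‖ ∧ ∀ l, |inner ℝ (g l) (gridPoint δ L z)| ≤ 1 / 10} with hS
  have hsub : {g : Fin N → EuclideanSpace ℝ (Fin n) | (∀ l, ‖g l‖ ≤ 4 * √n) ∧
      ∃ θ : EuclideanSpace ℝ (Fin n), ‖θ‖ = 1 ∧ ∀ l, |inner ℝ (g l) θ| ≤ 1 / 20} ⊆ ⋃ z, S z := by
    rintro g ⟨hg, θ, hθ, hgθ⟩
    obtain ⟨z, hz⟩ := exists_norm_sub_gridPoint_le hδ0 (L := L) (v := θ) (fun i => by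
      rw [hδL, ← hθ]
      simpa using PiLp.norm_apply_le θ i)
    have hz2 : √n * (√n * δ) ≤ 1 / 80 := by
      rw [← mul_assoc, hsq, hδ, mul_one_div, div_le_div_iff₀ (by positivity) (by norm_num)]
      nlinarith
    have hsn : 1 ≤ √(n : ℝ) := by
      rw [Real.one_le_sqrt]; linarith
    have hz3 : √n * δ ≤ 1 / 80 := by
      refine le_trans ?_ hz2
      nlinarith [mul_pos (by linarith : (0 : ℝ) < √n) hδ0]
    refine Set.mem_iUnion.2 ⟨z, ?_, fun l => ?_⟩
    · have h1 := norm_sub_norm_le θ (gridPoint δ L z)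
      rw [hθ] at h1
      linarith
    · have h1 : inner ℝ (g l) (gridPoint δ L z) =
          inner ℝ (g l) θ - inner ℝ (g l) (θ - gridPoint δ L z) := by
        rw [inner_sub_right]; ring
      have h2 : |inner ℝ (g l) (θ - gridPoint δ L z)| ≤ 4 * √n * (√n * δ) :=
        (abs_real_inner_le_norm _ _).trans
          (mul_le_mul (hg l) hz (norm_nonneg _) (by positivity))
      rw [h1]
      refine (abs_sub _ _).trans ?_
      have := hgθ l
      linarith
  have hmeas : ∀ z, gaussianFamily N n (S z) ≤ ENNReal.ofReal (Real.exp (-N)) := by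
    intro z
    by_cases hz : 1 / 2 ≤ ‖gridPoint δ L z‖
    · have h1 : S z ⊆ Set.pi Set.univ fun _ => {v | |inner ℝ v (gridPoint δ L z)| ≤ 1 / 10} :=
        fun g hg l _ => hg.2 l
      refine (measure_mono h1).trans ?_
      rw [gaussianFamily, Measure.pi_pi]
      refine (Finset.prod_le_prod' fun l _ => stdGaussian_abs_inner_le hz).trans (le_of_eq ?_)
      rw [Finset.prod_const, Finset.card_univ, Fintype.card_fin,
        ← ENNReal.ofReal_pow (Real.exp_pos _).le, ← Real.exp_nat_mul]
      congr 2
      ring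
    · have : S z = ∅ := by
        ext g
        simp only [hS, Set.mem_ofPred_eq, Set.mem_empty_iff_false, iff_false, not_and]
        exact fun h => absurd h hz
      rw [this, measure_empty]
      exact bot_le
  refine (measure_mono hsub).trans ((measure_iUnion_fintype_le _ _).trans
    ((Finset.sum_le_sum fun z _ => hmeas z).trans (le_of_eq ?_)))
  rw [Finset.sum_const, Finset.card_univ, nsmul_eq_mul, Fintype.card_fun, Fintype.card_fin,
    Fintype.card_fin, ENNReal.ofReal_mul (by positivity), ← ENNReal.ofReal_natCast]
  congr 2
  rw [hL]
  push_cast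
  ring

/-! ### Mixing operators rarely map a Gaussian family into its hull -/

/-- Two points of the preimage are at distance at most `2 * r / β`, so the preimage lies in a ball
around any one of its points. -/
lemma stdGaussian_preimage_ball_le {k : ℕ} (hk : 0 < k) {r β : ℝ} (hr : 0 < r) (hβ : 0 < β)
    (M : EuclideanSpace ℝ (Fin k) →L[ℝ] EuclideanSpace ℝ (Fin k))
    (hM : ∀ a, β * ‖a‖ ≤ ‖M a‖) (c : EuclideanSpace ℝ (Fin k)) :
    stdGaussian (EuclideanSpace ℝ (Fin k)) {a | ‖M a - c‖ ≤ r} ≤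
      ENNReal.ofReal ((√(Real.exp 1 / k) * (2 * r / β)) ^ k) := by
  rcases Set.eq_empty_or_nonempty {a | ‖M a - c‖ ≤ r} with h | ⟨b, hb⟩
  · rw [h, measure_empty]
    exact bot_le
  · refine (measure_mono ?_).trans (stdGaussian_ball_le hk (s := 2 * r / β) (by positivity) b)
    intro a ha
    simp only [Set.mem_ofPred_eq] at ha hb ⊢
    rw [le_div_iff₀ hβ, mul_comm]
    refine (hM _).trans ?_
    have h1 : M (a - b) = (M a - c) - (M b - c) := by rw [map_sub]; abel
    rw [h1]
    exact (norm_sub_le _ _).trans (by linarith)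

section Resample

variable {E : Type*} [NormedAddCommGroup E] [InnerProductSpace ℝ E] [FiniteDimensional ℝ E]
  [MeasurableSpace E] [BorelSpace E]

lemma measurePreserving_pi_resample {N k : ℕ} {x : Fin k → E} (hx : Orthonormal ℝ x) :
    MeasurePreserving
      (fun (p : (Fin N → E) × (Fin N → EuclideanSpace ℝ (Fin k))) (i : Fin N) =>
        p.1 i - synth x (coeffs x (p.1 i)) + synth x (p.2 i))
      ((Measure.pi fun _ => stdGaussian E).prod (gaussianFamily N k))
      (Measure.pi fun _ => stdGaussian E) := by
  have h1 := measurePreserving_pi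
    (fun _ : Fin N => (stdGaussian E).prod (stdGaussian (EuclideanSpace ℝ (Fin k))))
    (fun _ : Fin N => stdGaussian E) fun _ => measurePreserving_resample hx
  have h2 := (measurePreserving_arrowProdEquivProdArrow E (EuclideanSpace ℝ (Fin k)) (Fin N)
    (fun _ => stdGaussian E) (fun _ => stdGaussian (EuclideanSpace ℝ (Fin k)))).symm
  exact h1.comp h2

lemma measurable_coeffs_sub_signedAvg {N k m : ℕ} (z : Fin k → E) (T : E →L[ℝ] E) (i : Fin N)
    (f : Fin m → Fin N × Bool) :
    Measurable fun g : Fin N → E => ‖coeffs z (T (g i) - signedAvg g f)‖ := by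
  unfold signedAvg
  fun_prop

/-- Only the coefficients along the system `z` are tested. As `z` is orthogonal to `x`, resampling
the `x`-components leaves the tested signed averages fixed, while the tested part of `T (g i)`
becomes a constant plus an expanding linear image of the fresh Gaussian vector of index `i`. Given
everything else, the `N` events are independent, and each is a union of `(2 * N) ^ m` small ball
events. -/
lemma pi_stdGaussian_map_close_signedAvg_le {N k m : ℕ} (hk : 0 < k) {r β : ℝ} (hr : 0 < r)
    (hβ : 0 < β) {T : E →L[ℝ] E} (hT : IsMixing T k β) :
    (Measure.pi fun _ : Fin N => stdGaussian E)
      {g | ∀ i, ∃ f : Fin m → Fin N × Bool, ‖T (g i) - signedAvg g f‖ ≤ r} ≤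
      ENNReal.ofReal ((2 * N : ℝ) ^ m * (√(Real.exp 1 / k) * (2 * r / β)) ^ k) ^ N := by
  obtain ⟨x, z, hx, hz, hzx, hxz⟩ := hT
  set q := ENNReal.ofReal ((2 * N : ℝ) ^ m * (√(Real.exp 1 / k) * (2 * r / β)) ^ k) with hq
  have hcz : ∀ a, coeffs z (synth x a) = 0 := by
    intro a
    ext i
    rw [coeffs_apply, synth_apply, inner_sum]
    exact Finset.sum_eq_zero fun j _ => by rw [inner_smul_right, hzx, mul_zero]
  set S : Set (Fin N → E) :=
    {g | ∀ i, ∃ f : Fin m → Fin N × Bool, ‖coeffs z (T (g i) - signedAvg g f)‖ ≤ r} with hS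
  have hSm : MeasurableSet S := by
    have : S = ⋂ i, ⋃ f : Fin m → Fin N × Bool,
        {g | ‖coeffs z (T (g i) - signedAvg g f)‖ ≤ r} := by
      ext g; simp only [hS, Set.mem_iInter, Set.mem_iUnion, Set.mem_ofPred_eq]
    rw [this]
    exact MeasurableSet.iInter fun i => MeasurableSet.iUnion fun f =>
      measurableSet_le (measurable_coeffs_sub_signedAvg z T i f) measurable_const
  have hsub : {g : Fin N → E | ∀ i, ∃ f : Fin m → Fin N × Bool, ‖T (g i) - signedAvg g f‖ ≤ r} ⊆
      S := by
    intro g hg i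
    obtain ⟨f, hf⟩ := hg i
    exact ⟨f, (norm_coeffs_le hz _).trans hf⟩
  refine (measure_mono hsub).trans ?_
  have hmp := measurePreserving_pi_resample (N := N) hx
  rw [← hmp.measure_preimage hSm.nullMeasurableSet]
  -- Fubini: the original family is frozen, and each slice over the fresh coefficients is bounded
  -- uniformly.
  refine (Measure.prod_apply_le (hmp.measurable hSm)).trans ?_
  refine (lintegral_mono (g := fun _ => q ^ N) fun g => ?_).trans (le_of_eq (by
    rw [lintegral_const, measure_univ, mul_one]))
  set M : EuclideanSpace ℝ (Fin k) →L[ℝ] EuclideanSpace ℝ (Fin k) :=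
    coeffs z ∘L T ∘L synth x with hM
  set c : (Fin m → Fin N × Bool) → Fin N → EuclideanSpace ℝ (Fin k) := fun f i =>
    signedAvg (fun l => coeffs z (g l)) f - coeffs z (T (g i - synth x (coeffs x (g i)))) with hc
  have hslice : ∀ a : Fin N → EuclideanSpace ℝ (Fin k),
      (fun i => g i - synth x (coeffs x (g i)) + synth x (a i)) ∈ S →
      a ∈ Set.pi Set.univ fun i => ⋃ f, {a | ‖M a - c f i‖ ≤ r} := by
    intro a ha i _
    obtain ⟨f, hf⟩ := ha i
    refine Set.mem_iUnion.2 ⟨f, ?_⟩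
    refine le_trans (le_of_eq ?_) hf
    congr 1
    have h2 : ∀ l, coeffs z (g l - synth x (coeffs x (g l)) + synth x (a l)) = coeffs z (g l) := by
      intro l
      rw [map_add, map_sub, hcz, hcz, sub_zero, add_zero]
    rw [map_sub, map_signedAvg]
    simp only [h2]
    rw [map_add T, map_add (coeffs z)]
    simp only [hM, hc, ContinuousLinearMap.comp_apply]
    abel
  refine (measure_mono fun a ha => hslice a ha).trans ?_
  rw [gaussianFamily, Measure.pi_pi]
  have h4 : ∀ i, stdGaussian (EuclideanSpace ℝ (Fin k))
      (⋃ f : Fin m → Fin N × Bool, {a | ‖M a - c f i‖ ≤ r}) ≤ q := by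
    intro i
    refine (measure_iUnion_fintype_le _ _).trans ((Finset.sum_le_sum fun f _ =>
      stdGaussian_preimage_ball_le hk hr hβ M hxz (c f i)).trans (le_of_eq ?_))
    rw [Finset.sum_const, Finset.card_univ, nsmul_eq_mul, Fintype.card_fun, Fintype.card_prod,
      Fintype.card_bool, Fintype.card_fin, Fintype.card_fin, hq,
      ENNReal.ofReal_mul (by positivity), ← ENNReal.ofReal_natCast]
    congr 2
    push_cast
    ring
  refine (Finset.prod_le_prod' fun i _ => h4 i).trans (le_of_eq ?_)
  rw [Finset.prod_const, Finset.card_univ, Fintype.card_fin]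

end Resample

lemma synth_basis {n : ℕ} (T : EuclideanSpace ℝ (Fin n) →L[ℝ] EuclideanSpace ℝ (Fin n))
    (v : EuclideanSpace ℝ (Fin n)) :
    T v = synth (fun j => T (EuclideanSpace.single j 1)) v := by
  rw [synth_apply]
  conv_lhs => rw [← (EuclideanSpace.basisFun (Fin n) ℝ).sum_repr v]
  rw [map_sum]
  simp

/-- Discretization of a mixing operator. -/
lemma exists_grid_isMixing {n k : ℕ} {δ : ℝ} (hδ : 0 < δ) {L : ℕ}
    {T : EuclideanSpace ℝ (Fin n) →L[ℝ] EuclideanSpace ℝ (Fin n)} (hT : ‖T‖ ≤ δ * L) {α : ℝ}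
    (hmix : IsMixing T k α) (hα : n * δ ≤ α / 2) :
    ∃ z : Fin n → Fin n → Fin (2 * L + 1),
      IsMixing (synth fun j => gridPoint δ L (z j)) k (α / 2) ∧
      ∀ v, ‖T v - synth (fun j => gridPoint δ L (z j)) v‖ ≤ n * δ * ‖v‖ := by
  have h1 : ∀ j, ∃ z : Fin n → Fin (2 * L + 1),
      ‖T (EuclideanSpace.single j 1) - gridPoint δ L z‖ ≤ √n * δ := by
    intro j
    refine exists_norm_sub_gridPoint_le hδ fun i => ?_
    refine le_trans ?_ hT
    have h2 := PiLp.norm_apply_le (T (EuclideanSpace.single j 1)) i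
    have h3 := T.le_opNorm (EuclideanSpace.single j 1)
    rw [PiLp.norm_single] at h3
    simp only [norm_one, mul_one] at h3
    rw [Real.norm_eq_abs] at h2
    exact h2.trans h3
  choose z hz using h1
  have hclose : ∀ v, ‖T v - synth (fun j => gridPoint δ L (z j)) v‖ ≤ n * δ * ‖v‖ := by
    intro v
    rw [synth_basis T v, synth_apply, synth_apply, ← Finset.sum_sub_distrib]
    calc ‖∑ j, (v j • T (EuclideanSpace.single j 1) - v j • gridPoint δ L (z j))‖
        ≤ ∑ j, |v j| * (√n * δ) := by
          refine (norm_sum_le _ _).trans (Finset.sum_le_sum fun j _ => ?_)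
          rw [← smul_sub, norm_smul, Real.norm_eq_abs]
          exact mul_le_mul_of_nonneg_left (hz j) (abs_nonneg _)
      _ = (∑ j, |v j|) * (√n * δ) := by rw [Finset.sum_mul]
      _ ≤ (√n * ‖v‖) * (√n * δ) := by
          gcongr
          exact sum_abs_le_sqrt_mul_norm v
      _ = (√n * √n) * δ * ‖v‖ := by ring
      _ = n * δ * ‖v‖ := by rw [Real.mul_self_sqrt (by positivity)]
  refine ⟨z, ?_, hclose⟩
  obtain ⟨x, y, hx, hy, hyx, hxy⟩ := hmix
  refine ⟨x, y, hx, hy, hyx, fun a => ?_⟩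
  set T' := synth fun j => gridPoint δ L (z j)
  have h2 := hxy a
  have h3 : coeffs y (T (synth x a)) =
      coeffs y (T' (synth x a)) + coeffs y (T (synth x a) - T' (synth x a)) := by
    rw [← map_add]
    congr 1
    abel
  rw [h3] at h2
  have h4 : ‖coeffs y (T (synth x a) - T' (synth x a))‖ ≤ n * δ * ‖a‖ := by
    refine (norm_coeffs_le hy _).trans ((hclose _).trans (le_of_eq ?_))
    rw [norm_synth hx]
  have h5 := norm_add_le (coeffs y (T' (synth x a))) (coeffs y (T (synth x a) - T' (synth x a)))
  have h6 : n * δ * ‖a‖ ≤ α / 2 * ‖a‖ := by gcongr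
  linarith

/-- With high probability, no mixing operator maps a bounded Gaussian family into its hull. -/
lemma gaussianFamily_exists_isMixing_le {N n k m : ℕ} (hN : 0 < N) (hn : 0 < n) (hk : 0 < k)
    (hkn : k ≤ n) (hm : 0 < m) (hmn : m ≤ n) {α : ℝ}
    (hα : α = 32 * Real.exp 6 * √n / (√k * √m))
    (hcount : (2 * N : ℝ) ^ m ≤ Real.exp (4 * k)) :
    gaussianFamily N n {g | (∀ l, ‖g l‖ ≤ 4 * √n) ∧
      ∃ T : EuclideanSpace ℝ (Fin n) →L[ℝ] EuclideanSpace ℝ (Fin n), ‖T‖ ≤ n ∧ IsMixing T k α ∧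
        ∀ i, T (g i) ∈ absHull g} ≤
      ENNReal.ofReal ((2 * (n : ℝ) ^ 4 + 1) ^ (n ^ 2) * Real.exp (-(k * N))) := by
  have hk' : (1 : ℝ) ≤ k := by exact_mod_cast hk
  have hn' : (1 : ℝ) ≤ n := by exact_mod_cast hn
  have hm' : (1 : ℝ) ≤ m := by exact_mod_cast hm
  have hkn' : (k : ℝ) ≤ n := by exact_mod_cast hkn
  have hmn' : (m : ℝ) ≤ n := by exact_mod_cast hmn
  have hsk : 1 ≤ √(k : ℝ) := Real.one_le_sqrt.2 hk'
  have hsn : 1 ≤ √(n : ℝ) := Real.one_le_sqrt.2 hn'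
  have hsm : 1 ≤ √(m : ℝ) := Real.one_le_sqrt.2 hm'
  have hskn : √(k : ℝ) ≤ √n := Real.sqrt_le_sqrt hkn'
  have hsmn : √(m : ℝ) ≤ √n := Real.sqrt_le_sqrt hmn'
  have hsnn : √(n : ℝ) ≤ n := by
    rw [Real.sqrt_le_left (by positivity)]; nlinarith
  have hsq : √(n : ℝ) * √n = n := Real.mul_self_sqrt (by positivity)
  have he6 : 1 ≤ Real.exp 6 := Real.one_le_exp (by norm_num)
  have : Nonempty (Fin N) := ⟨⟨0, hN⟩⟩
  -- Rounding the matrix entries at this mesh moves an operator by at most `n * δ = 1 / n ^ 2`,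
  -- below half the mixing level; `L = n ^ 4` steps cover entries up to `n`.
  set δ : ℝ := 1 / (n : ℝ) ^ 3 with hδ
  have hδ0 : 0 < δ := by positivity
  set L : ℕ := n ^ 4 with hL
  have hδL : δ * L = n := by rw [hδ, hL]; push_cast; field_simp
  have hnδ : n * δ = 1 / (n : ℝ) ^ 2 := by rw [hδ]; field_simp
  have hα0 : 0 < α := by rw [hα]; positivity
  have hαδ : n * δ ≤ α / 2 := by
    rw [hnδ, hα]
    have h1 : 1 / (n : ℝ) ^ 2 ≤ 1 / n := by
      apply one_div_le_one_div_of_le (by positivity); nlinarith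
    have h2 : (1 : ℝ) / n ≤ √n / (√k * √m) := by
      rw [div_le_div_iff₀ (by positivity) (by positivity)]
      calc 1 * (√(k : ℝ) * √m) ≤ 1 * (√n * √n) := by gcongr
        _ ≤ √n * n := by rw [hsq]; nlinarith
    have h3 : 0 < √(n : ℝ) / (√k * √m) := by positivity
    have h4 : 32 * Real.exp 6 * √n / (√k * √m) / 2 = 16 * Real.exp 6 * (√n / (√k * √m)) := by ring
    rw [h4]
    nlinarith
  -- Half of `r` is the error in Maurey's lemma, the other half pays for rounding the operator.
  set r : ℝ := 8 * √n / √m with hr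
  have hr0 : 0 < r := by positivity
  set S : (Fin n → Fin n → Fin (2 * L + 1)) → Set (Fin N → EuclideanSpace ℝ (Fin n)) := fun z =>
    {g | IsMixing (synth fun j => gridPoint δ L (z j)) k (α / 2) ∧
      ∀ i, ∃ f : Fin m → Fin N × Bool,
        ‖synth (fun j => gridPoint δ L (z j)) (g i) - signedAvg g f‖ ≤ r} with hS
  have hsub : {g : Fin N → EuclideanSpace ℝ (Fin n) | (∀ l, ‖g l‖ ≤ 4 * √n) ∧
      ∃ T : EuclideanSpace ℝ (Fin n) →L[ℝ] EuclideanSpace ℝ (Fin n), ‖T‖ ≤ n ∧ IsMixing T k α ∧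
        ∀ i, T (g i) ∈ absHull g} ⊆ ⋃ z, S z := by
    rintro g ⟨hg, T, hTn, hTmix, hTg⟩
    obtain ⟨z, hz1, hz2⟩ := exists_grid_isMixing hδ0 (L := L) (hδL ▸ hTn) hTmix hαδ
    refine Set.mem_iUnion.2 ⟨z, hz1, fun i => ?_⟩
    obtain ⟨f, hf⟩ := exists_norm_sub_signedAvg_le hg (hTg i) hm
    refine ⟨f, ?_⟩
    set T' := synth fun j => gridPoint δ L (z j)
    have h1 : T' (g i) - signedAvg g f = (T (g i) - signedAvg g f) - (T (g i) - T' (g i)) := by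
      abel
    rw [h1]
    refine (norm_sub_le _ _).trans ?_
    have h2 : n * δ * ‖g i‖ ≤ 1 / n ^ 2 * (4 * √n) := by
      rw [hnδ]
      gcongr
      exact hg i
    have h3 : 1 / (n : ℝ) ^ 2 * (4 * √n) ≤ 4 * √n / √m := by
      rw [one_div_mul_eq_div]
      gcongr
      nlinarith
    have h4 : 4 * √(n : ℝ) / √m + 4 * √n / √m = r := by rw [hr]; ring
    have := hz2 (g i)
    linarith
  set q : ℝ := (2 * N : ℝ) ^ m * (√(Real.exp 1 / k) * (2 * r / (α / 2))) ^ k with hq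
  have hq0 : 0 ≤ q := by positivity
  have hqk : q ≤ Real.exp (-k) := by
    -- The constant `32 * exp 6` in `α` is tuned for this: `exp (-(11 / 2) * k)` beats the `exp (4 *
    -- k)` signed averages and leaves more than `exp (-k)`'s worth of decay.
    have h1 : √(Real.exp 1 / k) * (2 * r / (α / 2)) = Real.exp (-(11 / 2)) := by
      rw [Real.sqrt_div (Real.exp_pos _).le, hr, hα]
      have h4 : √(Real.exp 1) = Real.exp (1 / 2) := by rw [Real.exp_half]
      have h5 : Real.exp (1 / 2) = Real.exp (-(11 / 2)) * Real.exp 6 := by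
        rw [← Real.exp_add]; norm_num
      rw [h4, h5]
      field_simp
      norm_num
    calc q ≤ Real.exp (4 * k) * Real.exp (-(11 / 2)) ^ k := by rw [hq, h1]; gcongr
      _ = Real.exp (4 * k - 11 / 2 * k) := by
          rw [← Real.exp_nat_mul, ← Real.exp_add]
          congr 1
          ring
      _ ≤ _ := by apply Real.exp_le_exp.2; linarith
  have hmeas : ∀ z, gaussianFamily N n (S z) ≤ ENNReal.ofReal (Real.exp (-(k * N))) := by
    intro z
    by_cases hz : IsMixing (synth fun j => gridPoint δ L (z j)) k (α / 2)
    · refine (measure_mono (fun g hg => hg.2)).trans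
        ((pi_stdGaussian_map_close_signedAvg_le hk hr0 (by positivity) hz).trans ?_)
      rw [← hq, ← ENNReal.ofReal_pow hq0]
      apply ENNReal.ofReal_le_ofReal
      calc q ^ N ≤ Real.exp (-k) ^ N := by gcongr
        _ = _ := by rw [← Real.exp_nat_mul]; congr 1; ring
    · have : S z = ∅ := by
        ext g
        simp only [hS, Set.mem_ofPred_eq, Set.mem_empty_iff_false, iff_false, not_and]
        exact fun h => absurd h hz
      rw [this, measure_empty]
      exact bot_le
  refine (measure_mono hsub).trans ((measure_iUnion_fintype_le _ _).trans
    ((Finset.sum_le_sum fun z _ => hmeas z).trans (le_of_eq ?_)))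
  rw [Finset.sum_const, Finset.card_univ, nsmul_eq_mul, Fintype.card_fun, Fintype.card_fun,
    Fintype.card_fin, Fintype.card_fin, ENNReal.ofReal_mul (by positivity),
    ← ENNReal.ofReal_natCast]
  congr 2
  rw [hL]
  push_cast
  rw [← pow_mul]
  congr 1
  ring

end GenericQuotient

namespace GenericQuotient

open ProbabilityTheory

/-! ### Regular families -/

/-- The number of terms used in Maurey's lemma at dimension `k`. -/
noncomputable def maureyLength (n k : ℕ) : ℕ := ⌈(k : ℝ) / Real.log n⌉₊

/-- The mixing threshold at dimension `k`. -/
noncomputable def mixingLevel (n k : ℕ) : ℝ :=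
  32 * Real.exp 6 * √n / (√k * √(maureyLength n k))

/-- The size condition used to compare powers, exponentials and logarithms. -/
structure IsLarge (n : ℕ) : Prop where
  le : 10 ^ 4 ≤ n
  log_le : Real.log n ≤ √n / 100
  sqrt_le : 200 * √(n : ℝ) ≤ (n : ℝ) ^ (2 / 3 : ℝ)

lemma eventually_isLarge : ∀ᶠ n : ℕ in Filter.atTop, IsLarge n := by
  have h1 : (fun x : ℝ => Real.log x) =o[Filter.atTop] fun x => x ^ (1 / 2 : ℝ) :=
    isLittleO_log_rpow_atTop (by norm_num)
  have h2 := (h1.comp_tendsto tendsto_natCast_atTop_atTop).bound (c := 1 / 100) (by norm_num)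
  have h3 := ((tendsto_rpow_atTop (y := (1 / 6 : ℝ)) (by norm_num)).comp
    tendsto_natCast_atTop_atTop).eventually_ge_atTop (200 : ℝ)
  filter_upwards [h2, h3, Filter.eventually_ge_atTop (10 ^ 4)] with n hn1 hn3 hn2
  have hsqrt : 200 * √(n : ℝ) ≤ (n : ℝ) ^ (2 / 3 : ℝ) := by
    have hn : (0 : ℝ) < n := by
      have : 0 < n := lt_of_lt_of_le (by norm_num) hn2
      exact_mod_cast this
    calc 200 * √(n : ℝ) ≤ (n : ℝ) ^ (1 / 6 : ℝ) * (n : ℝ) ^ (1 / 2 : ℝ) := by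
          rw [Real.sqrt_eq_rpow]
          gcongr
          exact hn3
      _ = _ := by rw [← Real.rpow_add hn]; norm_num
  refine ⟨hn2, ?_, hsqrt⟩
  simp only [Function.comp_apply, ← Real.sqrt_eq_rpow, Real.norm_eq_abs] at hn1
  rw [abs_of_nonneg (Real.sqrt_nonneg _)] at hn1
  have := le_abs_self (Real.log n)
  linarith

/-! ### Elementary inequalities in large dimension -/

namespace IsLarge

variable {n k : ℕ}

lemma hundred_le_sqrt (h : IsLarge n) : 100 ≤ √(n : ℝ) := by
  apply Real.le_sqrt_of_sq_le
  have : ((10 ^ 4 : ℕ) : ℝ) ≤ n := by exact_mod_cast h.le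
  push_cast at this
  linarith

lemma one_le_log (h : IsLarge n) : 1 ≤ Real.log n := by
  have h1 : ((10 ^ 4 : ℕ) : ℝ) ≤ n := by exact_mod_cast h.le
  push_cast at h1
  rw [Real.le_log_iff_exp_le (by linarith)]
  have := Real.exp_one_lt_d9
  linarith

lemma sq_sqrt (_h : IsLarge n) : √(n : ℝ) ^ 2 = n := Real.sq_sqrt (by positivity)

lemma exp_log (h : IsLarge n) : Real.exp (Real.log n) = n := Real.exp_log (by
  have := h.hundred_le_sqrt
  have := h.sq_sqrt
  nlinarith)

lemma two_mul_sq_le (h : IsLarge n) : 2 * ((n ^ 2 : ℕ) : ℝ) ≤ Real.exp (3 * Real.log n) := by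
  have h1 : Real.exp (3 * Real.log n) = (n : ℝ) ^ 3 := by
    rw [show (3 : ℝ) = ((3 : ℕ) : ℝ) by norm_num, Real.exp_nat_mul, h.exp_log]
  rw [h1]
  have h2 := h.hundred_le_sqrt
  have h3 := h.sq_sqrt
  have h4 : (2 : ℝ) ≤ n := by nlinarith
  push_cast
  calc 2 * (n : ℝ) ^ 2 ≤ n * (n : ℝ) ^ 2 := by gcongr
    _ = _ := by ring

lemma log_le_div (h : IsLarge n) (hk : √(n : ℝ) ≤ k) :
    Real.log n ≤ k / 100 := h.log_le.trans (by gcongr)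

lemma maureyLength_pos (h : IsLarge n) (hk : √(n : ℝ) ≤ k) : 0 < maureyLength n k := by
  unfold maureyLength
  rw [Nat.ceil_pos]
  have := h.one_le_log
  have := h.hundred_le_sqrt
  have : (0 : ℝ) < k := by linarith
  positivity

lemma maureyLength_le (h : IsLarge n) (_hk : √(n : ℝ) ≤ k) (hkn : k ≤ n) : maureyLength n k ≤ n := by
  unfold maureyLength
  rw [Nat.ceil_le]
  have h1 := h.one_le_log
  have h2 : (k : ℝ) ≤ n := by exact_mod_cast hkn
  rw [div_le_iff₀ (by linarith)]
  nlinarith [(Nat.cast_nonneg k : (0 : ℝ) ≤ k)]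

lemma two_mul_card_le (h : IsLarge n) (hk : √(n : ℝ) ≤ k) :
    2 * ((n ^ 2 : ℕ) : ℝ) ≤ Real.exp (2 * k) := by
  refine h.two_mul_sq_le.trans (Real.exp_le_exp.2 ?_)
  have := h.log_le_div hk
  have : (0 : ℝ) ≤ k := Nat.cast_nonneg k
  linarith

/-- The length is about `k / log n` and each factor is at most `exp (3 * log n)`, which costs `3 *
k`; rounding the length up costs another `3 * log n`, small compared with `k`. -/
lemma two_mul_card_pow_le (h : IsLarge n) (hk : √(n : ℝ) ≤ k) :
    (2 * ((n ^ 2 : ℕ) : ℝ)) ^ maureyLength n k ≤ Real.exp (4 * k) := by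
  have h1 := h.one_le_log
  have h2 := h.log_le_div hk
  have h3 : (0 : ℝ) ≤ k := Nat.cast_nonneg k
  calc (2 * ((n ^ 2 : ℕ) : ℝ)) ^ maureyLength n k
      ≤ Real.exp (3 * Real.log n) ^ maureyLength n k := by
        gcongr
        exact h.two_mul_sq_le
    _ = Real.exp (maureyLength n k * (3 * Real.log n)) := by rw [Real.exp_nat_mul]
    _ ≤ _ := by
        apply Real.exp_le_exp.2
        have h4 : (maureyLength n k : ℝ) < k / Real.log n + 1 :=
          Nat.ceil_lt_add_one (by positivity)
        calc (maureyLength n k : ℝ) * (3 * Real.log n)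
            ≤ (k / Real.log n + 1) * (3 * Real.log n) := by gcongr
          _ = 3 * k + 3 * Real.log n := by field_simp
          _ ≤ 4 * k := by linarith

lemma inv_sqrt_maureyLength_le (h : IsLarge n) (hk : √(n : ℝ) ≤ k) :
    (√(maureyLength n k : ℝ))⁻¹ ≤ √(Real.log n) / √k := by
  have h1 := h.one_le_log
  have h2 := h.hundred_le_sqrt
  have h3 : (0 : ℝ) < k := by linarith
  rw [← Real.sqrt_div (by linarith), ← Real.sqrt_inv]
  apply Real.sqrt_le_sqrt
  rw [← inv_div]
  apply inv_anti₀ (by positivity)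
  exact Nat.le_ceil _

end IsLarge

/-- The properties of a family of `n ^ 2` vectors that are used to control the operators on the
corresponding quotient of `l_1`. -/
structure IsRegular {n : ℕ} (g : Fin (n ^ 2) → EuclideanSpace ℝ (Fin n)) : Prop where
  norm_le : ∀ l, ‖g l‖ ≤ 4 * √n
  norming : ∀ θ : EuclideanSpace ℝ (Fin n), (∀ l, |inner ℝ (g l) θ| ≤ 1) → ‖θ‖ ≤ 20
  not_isMixing : ∀ k : ℕ, √(n : ℝ) ≤ k → k ≤ n →
    ∀ T : EuclideanSpace ℝ (Fin n) →L[ℝ] EuclideanSpace ℝ (Fin n), ‖T‖ ≤ n →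
      (∀ i, T (g i) ∈ absHull g) → ¬ IsMixing T k (mixingLevel n k)

lemma norming_of_unit {n N : ℕ} {g : Fin N → EuclideanSpace ℝ (Fin n)}
    (h : ∀ θ : EuclideanSpace ℝ (Fin n), ‖θ‖ = 1 → ∃ l, 1 / 20 < |inner ℝ (g l) θ|)
    (θ : EuclideanSpace ℝ (Fin n)) (hθ : ∀ l, |inner ℝ (g l) θ| ≤ 1) : ‖θ‖ ≤ 20 := by
  rcases eq_or_ne θ 0 with rfl | h0
  · simp
  have hpos : 0 < ‖θ‖ := norm_pos_iff.2 h0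
  obtain ⟨l, hl⟩ := h (‖θ‖⁻¹ • θ)
    (by rw [norm_smul, norm_inv, norm_norm, inv_mul_cancel₀ hpos.ne'])
  rw [inner_smul_right, abs_mul, abs_inv, abs_norm, lt_inv_mul_iff₀ hpos] at hl
  have := hθ l
  linarith

/-- A Gaussian family of `n ^ 2` vectors is regular with overwhelming probability. -/
theorem gaussianFamily_not_isRegular_le {n : ℕ} (h : IsLarge n) :
    gaussianFamily (n ^ 2) n {g | ¬ IsRegular g} ≤ ENNReal.ofReal (Real.exp (-n)) := by
  set s : ℝ := √n with hs
  have hs100 : 100 ≤ s := h.hundred_le_sqrt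
  have hsq : s ^ 2 = n := h.sq_sqrt
  have hlog := h.log_le
  have hlog1 := h.one_le_log
  have hn : (0 : ℝ) < n := by rw [← hsq]; positivity
  have hn4 : (10 : ℝ) ^ 4 ≤ n := by rw [← hsq]; nlinarith
  have hn0 : 0 < n := by exact_mod_cast hn
  set S₁ : Set (Fin (n ^ 2) → EuclideanSpace ℝ (Fin n)) := {g | ∃ l, 4 * √n < ‖g l‖} with hS₁
  set S₂ : Set (Fin (n ^ 2) → EuclideanSpace ℝ (Fin n)) := {g | (∀ l, ‖g l‖ ≤ 4 * √n) ∧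
    ∃ θ : EuclideanSpace ℝ (Fin n), ‖θ‖ = 1 ∧ ∀ l, |inner ℝ (g l) θ| ≤ 1 / 20} with hS₂
  set S₃ : Fin (n + 1) → Set (Fin (n ^ 2) → EuclideanSpace ℝ (Fin n)) := fun k =>
    {g | √(n : ℝ) ≤ (k : ℕ) ∧ (∀ l, ‖g l‖ ≤ 4 * √n) ∧
      ∃ T : EuclideanSpace ℝ (Fin n) →L[ℝ] EuclideanSpace ℝ (Fin n), ‖T‖ ≤ n ∧
        IsMixing T k (mixingLevel n k) ∧ ∀ i, T (g i) ∈ absHull g} with hS₃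
  have hsub : {g : Fin (n ^ 2) → EuclideanSpace ℝ (Fin n) | ¬ IsRegular g} ⊆
      S₁ ∪ (S₂ ∪ ⋃ k, S₃ k) := by
    intro g hg
    by_contra hcon
    simp only [Set.mem_union, not_or, hS₁, hS₂, Set.mem_ofPred_eq, not_exists, not_lt, not_and,
      Set.mem_iUnion, hS₃] at hcon
    obtain ⟨h1, h2, h3⟩ := hcon
    refine hg ⟨h1, norming_of_unit fun θ hθ => ?_, fun k hk hkn T hT hTg hmix => ?_⟩
    · have h4 := h2 h1 θ hθ
      push Not at h4
      exact h4
    · exact h3 ⟨k, by omega⟩ hk h1 T hT hmix hTg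
  have hlogN : Real.exp (Real.log n) = n := h.exp_log
  have b₁ : gaussianFamily (n ^ 2) n S₁ ≤ ENNReal.ofReal (Real.exp (-n) / 3) := by
    refine (gaussianFamily_norm_gt (n ^ 2) n).trans (ENNReal.ofReal_le_ofReal ?_)
    have h1 : ((n ^ 2 : ℕ) : ℝ) ≤ Real.exp (3 * Real.log n) := by
      have := h.two_mul_sq_le
      have h2 : (0 : ℝ) ≤ ((n ^ 2 : ℕ) : ℝ) := Nat.cast_nonneg _
      linarith
    have h3 : Real.exp (-2) ≤ 1 / 3 := by
      rw [Real.exp_neg, inv_le_comm₀ (Real.exp_pos _) (by norm_num)]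
      have := Real.add_one_le_exp 2
      linarith
    calc ((n ^ 2 : ℕ) : ℝ) * Real.exp (-3 * n) ≤ Real.exp (3 * Real.log n) * Real.exp (-3 * n) := by
          gcongr
      _ = Real.exp (3 * Real.log n + -3 * n) := by rw [Real.exp_add]
      _ ≤ Real.exp (-n + -2) := by
          apply Real.exp_le_exp.2
          nlinarith
      _ = Real.exp (-n) * Real.exp (-2) := by rw [Real.exp_add]
      _ ≤ Real.exp (-n) * (1 / 3) := by gcongr
      _ = _ := by ring
  have h3 : Real.exp (-2) ≤ 1 / 3 := by
    rw [Real.exp_neg, inv_le_comm₀ (Real.exp_pos _) (by norm_num)]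
    have := Real.add_one_le_exp 2
    linarith
  have b₂ : gaussianFamily (n ^ 2) n S₂ ≤ ENNReal.ofReal (Real.exp (-n) / 3) := by
    refine (gaussianFamily_exists_small_inner (by have := h.le; omega)).trans
      (ENNReal.ofReal_le_ofReal ?_)
    have h1 : 2 * (n : ℝ) ^ 2 + 1 ≤ Real.exp (3 * Real.log n) := by
      rw [show (3 : ℝ) = ((3 : ℕ) : ℝ) by norm_num, Real.exp_nat_mul, hlogN]
      nlinarith
    calc (2 * (n : ℝ) ^ 2 + 1) ^ n * Real.exp (-((n ^ 2 : ℕ) : ℝ))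
        ≤ Real.exp (3 * Real.log n) ^ n * Real.exp (-((n ^ 2 : ℕ) : ℝ)) := by gcongr
      _ = Real.exp (n * (3 * Real.log n) + -(n : ℝ) ^ 2) := by
          rw [← Real.exp_nat_mul, Real.exp_add]
          push_cast
          rfl
      _ ≤ Real.exp (-n + -2) := by
          apply Real.exp_le_exp.2
          have h4 : Real.log n ≤ n / 100 := by nlinarith
          nlinarith
      _ = Real.exp (-n) * Real.exp (-2) := by rw [Real.exp_add]
      _ ≤ Real.exp (-n) * (1 / 3) := by gcongr
      _ = _ := by ring
  have b₃ : ∀ k, gaussianFamily (n ^ 2) n (S₃ k) ≤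
      ENNReal.ofReal (Real.exp (-n) / (3 * (n + 1))) := by
    intro k
    by_cases hk : √(n : ℝ) ≤ (k : ℕ)
    · have hk1 : (100 : ℝ) ≤ (k : ℕ) := hs100.trans hk
      have hk0 : 0 < (k : ℕ) := by
        have : (0 : ℝ) < (k : ℕ) := by linarith
        exact_mod_cast this
      have hkn : (k : ℕ) ≤ n := by omega
      refine (measure_mono fun g hg => hg.2).trans
        ((gaussianFamily_exists_isMixing_le (m := maureyLength n k) (by positivity) hn0 hk0 hkn
          (h.maureyLength_pos hk) (h.maureyLength_le hk hkn) rfl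
          (h.two_mul_card_pow_le hk)).trans (ENNReal.ofReal_le_ofReal ?_))
      have h1 : 2 * (n : ℝ) ^ 4 + 1 ≤ Real.exp (5 * Real.log n) := by
        rw [show (5 : ℝ) = ((5 : ℕ) : ℝ) by norm_num, Real.exp_nat_mul, hlogN]
        have h5 : (1 : ℝ) ≤ (n : ℝ) ^ 4 := one_le_pow₀ (by linarith)
        calc 2 * (n : ℝ) ^ 4 + 1 ≤ 3 * (n : ℝ) ^ 4 := by linarith
          _ ≤ n * (n : ℝ) ^ 4 := by gcongr; linarith
          _ = _ := by ring
      have h6 : (n : ℝ) + 1 ≤ Real.exp n := Real.add_one_le_exp _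
      -- The decisive comparison: the entropy `5 * n ^ 2 * log n` of the operator grid against `k *
      -- n ^ 2 ≥ n ^ (5 / 2)`. The surplus `exp (-n)` pays for the `n + 1` values of `k`.
      calc (2 * (n : ℝ) ^ 4 + 1) ^ (n ^ 2) * Real.exp (-((k : ℕ) * ((n ^ 2 : ℕ) : ℝ)))
          ≤ Real.exp (5 * Real.log n) ^ (n ^ 2) * Real.exp (-(s * ((n ^ 2 : ℕ) : ℝ))) := by gcongr
        _ = Real.exp ((n : ℝ) ^ 2 * (5 * Real.log n) + -(s * (n : ℝ) ^ 2)) := by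
            rw [← Real.exp_nat_mul, Real.exp_add]
            push_cast
            rfl
        _ ≤ Real.exp (-n + -2 + -n) := by
            apply Real.exp_le_exp.2
            have h4 : (n : ℝ) ^ 2 * (5 * Real.log n) ≤ (n : ℝ) ^ 2 * (s / 20) := by
              gcongr
              linarith
            have h7 : (n : ℝ) ^ 2 * 100 ≤ (n : ℝ) ^ 2 * s := by gcongr
            nlinarith
        _ = Real.exp (-n) * Real.exp (-2) * Real.exp (-n) := by rw [Real.exp_add, Real.exp_add]
        _ ≤ Real.exp (-n) * (1 / 3) * (1 / (n + 1)) := by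
            gcongr
            rw [Real.exp_neg, ← one_div]
            gcongr
        _ = _ := by field_simp
    · have : S₃ k = ∅ := by
        ext g
        simp only [hS₃, Set.mem_ofPred_eq, Set.mem_empty_iff_false, iff_false, not_and]
        exact fun h => absurd h hk
      rw [this, measure_empty]
      exact bot_le
  have b₃' : gaussianFamily (n ^ 2) n (⋃ k, S₃ k) ≤ ENNReal.ofReal (Real.exp (-n) / 3) := by
    refine (measure_iUnion_fintype_le _ _).trans ((Finset.sum_le_sum fun k _ => b₃ k).trans
      (le_of_eq ?_))
    rw [Finset.sum_const, Finset.card_univ, Fintype.card_fin, nsmul_eq_mul,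
      ← ENNReal.ofReal_natCast, ← ENNReal.ofReal_mul (by positivity)]
    congr 1
    push_cast
    field_simp
  refine (measure_mono hsub).trans ((measure_union_le _ _).trans
    ((add_le_add b₁ ((measure_union_le _ _).trans (add_le_add b₂ b₃'))).trans (le_of_eq ?_)))
  rw [← ENNReal.ofReal_add (by positivity) (by positivity),
    ← ENNReal.ofReal_add (by positivity) (by positivity)]
  congr 1
  ring

end GenericQuotient

namespace GenericQuotient

/-! ### Gelfand numbers -/

section Gelfand

variable {X : Type*} [NormedAddCommGroup X] [NormedSpace ℝ X]

lemma gelfandNumber_nonneg {Y : Type*} [NormedAddCommGroup Y] [NormedSpace ℝ Y] (k : ℕ)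
    (u : X →L[ℝ] Y) : 0 ≤ gelfandNumber k u := by
  apply Real.sInf_nonneg
  rintro r ⟨Z, _, rfl⟩
  exact ContinuousLinearMap.opNorm_nonneg _

lemma gelfandNumber_le {Y : Type*} [NormedAddCommGroup Y] [NormedSpace ℝ Y]
    [FiniteDimensional ℝ X] {k : ℕ} (u : X →L[ℝ] Y) {W : Submodule ℝ X}
    (hW : Module.finrank ℝ X < Module.finrank ℝ W + k) {B : ℝ} (hB : 0 ≤ B)
    (h : ∀ x ∈ W, ‖u x‖ ≤ B * ‖x‖) : gelfandNumber k u ≤ B := by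
  have hrank : Module.rank ℝ (X ⧸ W) < (k : Cardinal) := by
    rw [← Module.finrank_eq_rank]
    have := W.finrank_quotient_add_finrank
    have : Module.finrank ℝ (X ⧸ W) < k := by omega
    exact_mod_cast this
  have hle : gelfandNumber k u ≤ ‖u.comp W.subtypeL‖ := by
    refine csInf_le ⟨0, ?_⟩ ⟨W, hrank, rfl⟩
    rintro r ⟨Z, _, rfl⟩
    exact ContinuousLinearMap.opNorm_nonneg _
  exact hle.trans (ContinuousLinearMap.opNorm_le_bound _ hB fun x => h x x.2)

lemma bddBelow_range_sum_gelfandNumber (T : X →L[ℝ] X) (s : Finset ℕ) :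
    BddBelow (Set.range fun r : ℝ =>
      ∑ i ∈ s, gelfandNumber i (T - r • ContinuousLinearMap.id ℝ X)) :=
  ⟨0, by rintro _ ⟨r, rfl⟩; exact Finset.sum_nonneg fun i _ => gelfandNumber_nonneg _ _⟩

/-- A quotient norm controls lifts only on the open unit ball, so `x` is rescaled by some `c > ‖x‖`
and `c` tends to `‖x‖`. -/
lemma norm_map_le_of_norm_map_le_of_lt_one {E : Type*} [NormedAddCommGroup E] [NormedSpace ℝ E]
    (φ : X →ₗ[ℝ] E) (W : Submodule ℝ X) {C : ℝ} (h : ∀ x ∈ W, ‖x‖ < 1 → ‖φ x‖ ≤ C) :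
    ∀ x ∈ W, ‖φ x‖ ≤ C * ‖x‖ := by
  intro x hx
  have hC : 0 ≤ C := (norm_nonneg _).trans (h 0 W.zero_mem (by simp))
  have h1 : ∀ c : ℝ, ‖x‖ < c → ‖φ x‖ ≤ C * c := by
    intro c hc
    have hc0 : 0 < c := (norm_nonneg _).trans_lt hc
    have h2 := h (c⁻¹ • x) (W.smul_mem _ hx) (by
      rw [norm_smul, norm_inv, Real.norm_eq_abs, abs_of_pos hc0, inv_mul_lt_iff₀ hc0, mul_one]
      exact hc)
    rw [map_smul, norm_smul, norm_inv, Real.norm_eq_abs, abs_of_pos hc0, inv_mul_le_iff₀ hc0] at h2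
    linarith
  have h2 : Filter.Tendsto (fun c => C * c) (nhdsWithin ‖x‖ (Set.Ioi ‖x‖)) (nhds (C * ‖x‖)) :=
    ((continuous_const.mul continuous_id).tendsto _).mono_left nhdsWithin_le_nhds
  exact ge_of_tendsto h2 (Filter.eventually_of_mem self_mem_nhdsWithin fun c hc => h1 c hc)

end Gelfand

/-- The radius of the small sections at codimension `k`. -/
noncomputable def sectionRadius (n k : ℕ) : ℝ :=
  (6 * Real.exp 5 + 2) * (4 * √n) / √(maureyLength n k)

/-- The constant in the estimate of the Gelfand numbers. -/
noncomputable def gelfandConst : ℝ := 3000 * (600 * (32 * Real.exp 6 * ((6 * Real.exp 5 + 2) * 4))) + 2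

lemma two_le_gelfandConst : 2 ≤ gelfandConst := by
  unfold gelfandConst
  have : 0 < 3000 * (600 * (32 * Real.exp 6 * ((6 * Real.exp 5 + 2) * 4))) := by positivity
  linarith

lemma mixingLevel_nonneg (n k : ℕ) : 0 ≤ mixingLevel n k := by
  unfold mixingLevel; positivity

/-- With `m ≥ k / log n` the product is of order `n / (√k * m) ≤ n * log n / k ^ (3 / 2)`. The
factor 20 comes from the norming property, 30 from using a common scalar, and `3000 = 200 * 15` from
replacing `k` by `t`. -/
lemma IsLarge.mixingLevel_mul_sectionRadius_le {n : ℕ} (h : IsLarge n) {k : ℕ}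
    (hk : √(n : ℝ) ≤ k) {t : ℝ} (ht : 0 < t) (htk : t ≤ 200 * k) :
    20 * (30 * mixingLevel n k) * sectionRadius n k ≤
      (gelfandConst - 2) * n * Real.log n / (t * √t) := by
  have hs := h.hundred_le_sqrt
  have hlog := h.one_le_log
  have hk0 : (0 : ℝ) < k := by linarith
  have h1 := h.inv_sqrt_maureyLength_le hk
  have h2 : ((√(maureyLength n k : ℝ))⁻¹) ^ 2 ≤ Real.log n / k := by
    calc _ ≤ (√(Real.log n) / √k) ^ 2 := by gcongr
      _ = _ := by rw [div_pow, Real.sq_sqrt (by linarith), Real.sq_sqrt hk0.le]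
  set A : ℝ := 600 * (32 * Real.exp 6 * ((6 * Real.exp 5 + 2) * 4)) with hA
  have hA0 : 0 < A := by positivity
  have hC : gelfandConst - 2 = 3000 * A := by unfold gelfandConst; rw [hA]; ring
  have hsn : √(n : ℝ) * √n = n := Real.mul_self_sqrt (by positivity)
  have h3 : t * √t ≤ 3000 * (k * √k) := by
    have h4 : √t ≤ 15 * √k := by
      rw [Real.sqrt_le_left (by positivity), mul_pow, Real.sq_sqrt hk0.le]
      linarith
    calc t * √t ≤ (200 * k) * (15 * √k) := by gcongr
      _ = _ := by ring
  calc 20 * (30 * mixingLevel n k) * sectionRadius n k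
      = A * (√n * √n) / √k * ((√(maureyLength n k : ℝ))⁻¹) ^ 2 := by
        unfold mixingLevel sectionRadius
        rw [hA]
        ring
    _ ≤ A * n / √k * (Real.log n / k) := by rw [hsn]; gcongr
    _ = A * n * Real.log n / (k * √k) := by ring
    _ = 3000 * A * n * Real.log n / (3000 * (k * √k)) := by field_simp
    _ ≤ 3000 * A * n * Real.log n / (t * √t) := by gcongr
    _ = _ := by rw [hC]

lemma IsLarge.mixingLevel_anti {n : ℕ} (h : IsLarge n) {k k' : ℕ} (hk : √(n : ℝ) ≤ k)
    (hkk' : k ≤ k') : mixingLevel n k' ≤ mixingLevel n k := by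
  unfold mixingLevel
  have hs := h.hundred_le_sqrt
  have hlog := h.one_le_log
  have h1 : (k : ℝ) ≤ k' := by exact_mod_cast hkk'
  have h2 : maureyLength n k ≤ maureyLength n k' := by
    unfold maureyLength
    apply Nat.ceil_mono
    gcongr
  have h3 : (maureyLength n k : ℝ) ≤ maureyLength n k' := by exact_mod_cast h2
  have h4 : (0 : ℝ) < maureyLength n k := by exact_mod_cast h.maureyLength_pos hk
  have h5 : (0 : ℝ) < k := by linarith
  gcongr

/-! ### Operators on a space normed by the hull of a regular family -/

section Operators

variable {n : ℕ} {g : Fin (n ^ 2) → EuclideanSpace ℝ (Fin n)}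
  {X : Type*} [NormedAddCommGroup X] [NormedSpace ℝ X]

/-- Duality: a functional of norm at most one attaining the norm of `ψ.symm v` is at most one on
every `g l`, so the vector `θ` representing it has length at most 20. -/
lemma norm_symm_le_of_norming (hg : IsRegular g) (ψ : X ≃ₗ[ℝ] EuclideanSpace ℝ (Fin n))
    (hψ : ∀ l, ‖ψ.symm (g l)‖ ≤ 1) (v : EuclideanSpace ℝ (Fin n)) :
    ‖ψ.symm v‖ ≤ 20 * ‖v‖ := by
  obtain ⟨f, hf, hfv⟩ := exists_dual_vector'' ℝ (ψ.symm v)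
  let F : EuclideanSpace ℝ (Fin n) →L[ℝ] ℝ :=
    LinearMap.toContinuousLinearMap (f.toLinearMap ∘ₗ ψ.symm.toLinearMap)
  have hF : ∀ w, F w = f (ψ.symm w) := fun w => rfl
  set θ := (InnerProductSpace.toDual ℝ (EuclideanSpace ℝ (Fin n))).symm F with hθ
  have hinner : ∀ w, inner ℝ θ w = f (ψ.symm w) := by
    intro w
    rw [hθ, InnerProductSpace.toDual_symm_apply, hF]
  have h1 : ‖θ‖ ≤ 20 := hg.norming θ fun l => by
    rw [real_inner_comm, hinner, ← Real.norm_eq_abs]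
    calc _ ≤ ‖f‖ * ‖ψ.symm (g l)‖ := f.le_opNorm _
      _ ≤ 1 * 1 := by gcongr; exact hψ l
      _ = 1 := one_mul 1
  have h2 : ‖ψ.symm v‖ = inner ℝ θ v := by
    rw [hinner, hfv]
    simp
  rw [h2]
  refine (real_inner_le_norm _ _).trans ?_
  gcongr

/-- At each dimension `k`, an operator of norm less than one is almost scalar in the Euclidean norm
on a subspace of small codimension where the Euclidean norm is small. -/
lemma exists_subspace_almost_scalar (h : IsLarge n) (hg : IsRegular g)
    (ψ : X ≃ₗ[ℝ] EuclideanSpace ℝ (Fin n)) (hψ : ∀ l, ‖ψ.symm (g l)‖ ≤ 1)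
    (hball : ∀ x, ‖x‖ < 1 → ψ x ∈ absHull g) {T : X →L[ℝ] X} (hT : ‖T‖ < 1) {k : ℕ}
    (hk : √(n : ℝ) ≤ k) (hkn : k ≤ n) :
    ∃ (r : ℝ) (W : Submodule ℝ X), n ≤ Module.finrank ℝ W + 5 * k ∧
      (∀ x ∈ W, ‖ψ (T x) - r • ψ x‖ ≤ 10 * mixingLevel n k * ‖ψ x‖) ∧
      ∀ x ∈ W, ‖ψ x‖ ≤ sectionRadius n k * ‖x‖ := by
  have hs := h.hundred_le_sqrt
  have hsq := h.sq_sqrt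
  have hk0 : 0 < k := by
    have : (0 : ℝ) < k := by linarith
    exact_mod_cast this
  have hn0 : 0 < n := by omega
  have : Nonempty (Fin (n ^ 2)) := ⟨⟨0, by positivity⟩⟩
  have hψn : ∀ x, ‖ψ x‖ ≤ 4 * √n * ‖x‖ := fun x =>
    norm_map_le_of_norm_map_le_of_lt_one ψ.toLinearMap ⊤
      (fun x _ hx => norm_le_of_mem_absHull hg.norm_le (by positivity) (hball x hx)) x trivial
  let T' : EuclideanSpace ℝ (Fin n) →L[ℝ] EuclideanSpace ℝ (Fin n) :=
    LinearMap.toContinuousLinearMap (ψ.toLinearMap ∘ₗ T.toLinearMap ∘ₗ ψ.symm.toLinearMap)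
  have hT' : ∀ v, T' v = ψ (T (ψ.symm v)) := fun v => rfl
  have hTn : ‖T'‖ ≤ n := by
    refine ContinuousLinearMap.opNorm_le_bound _ (by positivity) fun v => ?_
    rw [hT']
    calc ‖ψ (T (ψ.symm v))‖ ≤ 4 * √n * ‖T (ψ.symm v)‖ := hψn _
      _ ≤ 4 * √n * (1 * (20 * ‖v‖)) := by
          gcongr
          exact (T.le_opNorm _).trans (mul_le_mul hT.le (norm_symm_le_of_norming hg ψ hψ v)
            (norm_nonneg _) zero_le_one)
      _ = 80 * √n * ‖v‖ := by ring
      _ ≤ n * ‖v‖ := by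
          have h80 : 80 * √(n : ℝ) ≤ √n ^ 2 := by nlinarith
          rw [hsq] at h80
          gcongr
  -- The strict bound `‖T‖ < 1` puts the images into the open unit ball, where `hball` applies.
  have hTg : ∀ i, T' (g i) ∈ absHull g := by
    intro i
    rw [hT']
    apply hball
    calc ‖T (ψ.symm (g i))‖ ≤ ‖T‖ * ‖ψ.symm (g i)‖ := T.le_opNorm _
      _ ≤ ‖T‖ * 1 := by gcongr; exact hψ i
      _ < 1 := by rwa [mul_one]
  obtain ⟨r, Z, hZ, hZT⟩ := exists_almost_scalar_of_not_isMixing (mixingLevel_nonneg n k)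
    (hg.not_isMixing k hk hkn T' hTn hTg)
  obtain ⟨Y, hY, hYg⟩ := exists_section_norm_le (R := 4 * √n) (by positivity) hg.norm_le hk0
    (h.maureyLength_pos hk) (by rw [Fintype.card_fin]; exact h.two_mul_card_pow_le hk)
    (by rw [Fintype.card_fin]; exact h.two_mul_card_le hk)
  rw [finrank_euclideanSpace_fin] at hZ hY
  -- Codimension at most `4 * k` from `Z` and at most `k` from `Y`.
  refine ⟨r, (Z ⊓ Y).comap ψ.toLinearMap, ?_, ?_, ?_⟩
  · have h1 : Module.finrank ℝ ((Z ⊓ Y).comap ψ.toLinearMap) =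
        Module.finrank ℝ (Z ⊓ Y : Submodule ℝ (EuclideanSpace ℝ (Fin n))) :=
      LinearEquiv.finrank_eq (ψ.ofSubmodule' (Z ⊓ Y))
    have h2 := Submodule.finrank_sup_add_finrank_inf_eq Z Y
    have h3 := Submodule.finrank_le (Z ⊔ Y)
    rw [finrank_euclideanSpace_fin] at h3
    omega
  · intro x hx
    have := hZT (ψ x) hx.1
    rwa [hT', ψ.symm_apply_apply] at this
  · refine norm_map_le_of_norm_map_le_of_lt_one ψ.toLinearMap _ fun x hx hx1 => ?_
    exact hYg _ hx.2 (hball x hx1)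

/-- The bound for the `i`-th Gelfand number. -/
noncomputable def gelfandBound (n i : ℕ) : ℝ :=
  if (i : ℝ) ≤ (n : ℝ) ^ (2 / 3 : ℝ) then 2 * gelfandConst
  else gelfandConst * n * Real.log n / (i * √i)

lemma gelfandBound_nonneg (n i : ℕ) : 0 ≤ gelfandBound n i := by
  unfold gelfandBound
  have := two_le_gelfandConst
  have := Real.log_natCast_nonneg n
  split_ifs <;> positivity

lemma exists_ne_zero_mem_inf {V : Type*} [AddCommGroup V] [Module ℝ V] [FiniteDimensional ℝ V]
    (W W' : Submodule ℝ V)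
    (h : Module.finrank ℝ V < Module.finrank ℝ W + Module.finrank ℝ W') :
    ∃ x ∈ W, x ∈ W' ∧ x ≠ 0 := by
  have h1 := Submodule.finrank_sup_add_finrank_inf_eq W W'
  have h2 := Submodule.finrank_le (W ⊔ W')
  have h3 : W ⊓ W' ≠ ⊥ := by
    intro h0
    rw [h0, finrank_bot] at h1
    omega
  obtain ⟨x, hx, hx0⟩ := Submodule.exists_mem_ne_zero_of_ne_bot h3
  exact ⟨x, hx.1, hx.2, hx0⟩

/-- An operator of norm less than one is a multiple of the identity up to an operator with small
Gelfand numbers. -/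
lemma exists_scalar_forall_gelfandBound (h : IsLarge n) (hg : IsRegular g)
    (ψ : X ≃ₗ[ℝ] EuclideanSpace ℝ (Fin n)) (hψ : ∀ l, ‖ψ.symm (g l)‖ ≤ 1)
    (hball : ∀ x, ‖x‖ < 1 → ψ x ∈ absHull g) {T : X →L[ℝ] X} (hT : ‖T‖ < 1) :
    ∃ r : ℝ, ∀ i ∈ Finset.Icc 1 n, ∃ W : Submodule ℝ X, n < Module.finrank ℝ W + i ∧
      ∀ x ∈ W, ‖T x - r • x‖ ≤ gelfandBound n i * ‖x‖ := by
  have hs := h.hundred_le_sqrt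
  have hsq := h.sq_sqrt
  have hlog := h.one_le_log
  have hn1 : (1 : ℝ) ≤ n := by rw [← hsq]; nlinarith
  have hp := h.sqrt_le
  have hpn : (n : ℝ) ^ (2 / 3 : ℝ) ≤ n := by
    calc (n : ℝ) ^ (2 / 3 : ℝ) ≤ (n : ℝ) ^ (1 : ℝ) :=
          Real.rpow_le_rpow_of_exponent_le hn1 (by norm_num)
      _ = n := Real.rpow_one _
  have : FiniteDimensional ℝ X := ψ.symm.finiteDimensional
  have hfin : Module.finrank ℝ X = n := by rw [ψ.finrank_eq, finrank_euclideanSpace_fin]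
  -- The `i`-th Gelfand number is handled at dimension `k = i / 100`, rounded down: codimension `5 *
  -- k` is less than `i`, yet `k` is still comparable with `i`.
  have hdiv : ∀ i : ℕ, 200 * √(n : ℝ) ≤ i →
      √(n : ℝ) ≤ (i / 100 : ℕ) ∧ (i : ℝ) ≤ 200 * (i / 100 : ℕ) := by
    intro i hi
    have h1 : (i : ℝ) < 100 * ((i / 100 : ℕ) : ℝ) + 100 := by
      have : i < 100 * (i / 100) + 100 := by omega
      exact_mod_cast this
    constructor <;> linarith
  obtain ⟨hK, hK2⟩ := hdiv n (hp.trans hpn)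
  set K : ℕ := n / 100 with hKdef
  -- The scalar is fixed once and for all at the largest dimension `K`, where the mixing level is
  -- smallest.
  obtain ⟨r, W, hW, hWT, hWn⟩ := exists_subspace_almost_scalar h hg ψ hψ hball hT hK (by omega)
  have key : ∀ k : ℕ, √(n : ℝ) ≤ k → k ≤ K → ∃ W' : Submodule ℝ X,
      n ≤ Module.finrank ℝ W' + 5 * k ∧
      ∀ x ∈ W', ‖T x - r • x‖ ≤ 20 * (30 * mixingLevel n k) * sectionRadius n k * ‖x‖ := by
    intro k hk hkK
    obtain ⟨r', W', hW', hWT', hWn'⟩ :=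
      exists_subspace_almost_scalar h hg ψ hψ hball hT hk (by omega)
    have hα := h.mixingLevel_anti hk hkK
    -- `W` and `W'` have codimension at most `n / 20`, so they share a nonzero vector; it is an
    -- approximate eigenvector for both scalars.
    have hrr : |r' - r| ≤ 20 * mixingLevel n k := by
      have hn0 : 0 < n := by
        have : (0 : ℝ) < n := by linarith
        exact_mod_cast this
      obtain ⟨x, hx, hx', hx0⟩ := exists_ne_zero_mem_inf W W' (by rw [hfin]; omega)
      have hψ0 : 0 < ‖ψ x‖ := norm_pos_iff.2 (by simpa using hx0)
      refine le_of_mul_le_mul_right ?_ hψ0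
      rw [← Real.norm_eq_abs, ← norm_smul]
      have h1 : (r' - r) • ψ x = (ψ (T x) - r • ψ x) - (ψ (T x) - r' • ψ x) := by
        rw [sub_smul]; abel
      rw [h1]
      refine (norm_sub_le _ _).trans ?_
      have h2 := hWT x hx
      have h3 := hWT' x hx'
      have h4 : 10 * mixingLevel n K * ‖ψ x‖ ≤ 10 * mixingLevel n k * ‖ψ x‖ := by gcongr
      linarith
    refine ⟨W', hW', fun x hx => ?_⟩
    have h1 : ‖ψ (T x) - r • ψ x‖ ≤ 30 * mixingLevel n k * ‖ψ x‖ := by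
      have h2 : ψ (T x) - r • ψ x = (ψ (T x) - r' • ψ x) + (r' - r) • ψ x := by
        rw [sub_smul]; abel
      rw [h2]
      refine (norm_add_le _ _).trans ?_
      rw [norm_smul, Real.norm_eq_abs]
      have h3 : |r' - r| * ‖ψ x‖ ≤ 20 * mixingLevel n k * ‖ψ x‖ := by gcongr
      have h4 := hWT' x hx
      linarith
    have h5 : T x - r • x = ψ.symm (ψ (T x) - r • ψ x) := by simp
    rw [h5]
    calc _ ≤ 20 * ‖ψ (T x) - r • ψ x‖ := norm_symm_le_of_norming hg ψ hψ _
      _ ≤ 20 * (30 * mixingLevel n k * (sectionRadius n k * ‖x‖)) := by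
          gcongr
          refine h1.trans ?_
          have := mixingLevel_nonneg n k
          gcongr
          exact hWn' x hx
      _ = _ := by ring
  have hC := two_le_gelfandConst
  -- On some nonzero vector both `T` and `T - r` are bounded, hence so is `r`.
  have hr : |r| ≤ gelfandConst := by
    obtain ⟨W', hW', hWT'⟩ := key K hK le_rfl
    have hn0 : 0 < n := by
      have : (0 : ℝ) < n := by linarith
      exact_mod_cast this
    obtain ⟨x, hx, -, hx0⟩ := exists_ne_zero_mem_inf W' W' (by rw [hfin]; omega)
    have hxpos : 0 < ‖x‖ := norm_pos_iff.2 hx0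
    have h1 := h.mixingLevel_mul_sectionRadius_le hK (t := n) (by linarith) hK2
    have h2 : (gelfandConst - 2) * n * Real.log n / (n * √n) ≤ gelfandConst - 2 := by
      rw [div_le_iff₀ (by positivity)]
      have h3 : Real.log n ≤ √n := by have := h.log_le; linarith
      calc (gelfandConst - 2) * n * Real.log n ≤ (gelfandConst - 2) * n * √n := by
            gcongr
        _ = _ := by ring
    refine le_of_mul_le_mul_right ?_ hxpos
    rw [← Real.norm_eq_abs, ← norm_smul]
    have h4 : r • x = T x - (T x - r • x) := by abel
    rw [h4]
    refine (norm_sub_le _ _).trans ?_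
    have h5 : ‖T x‖ ≤ 1 * ‖x‖ := (T.le_opNorm x).trans (by gcongr)
    have h6 : ‖T x - r • x‖ ≤ (gelfandConst - 2) * ‖x‖ := (hWT' x hx).trans (by
      gcongr
      exact h1.trans h2)
    nlinarith
  refine ⟨r, fun i hi => ?_⟩
  rw [Finset.mem_Icc] at hi
  by_cases hip : (i : ℝ) ≤ (n : ℝ) ^ (2 / 3 : ℝ)
  -- For small `i` the trivial bound `‖T‖ + |r|` on the whole space is enough.
  · refine ⟨⊤, by rw [finrank_top, hfin]; omega, fun x _ => ?_⟩
    rw [gelfandBound, if_pos hip]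
    refine (norm_sub_le _ _).trans ?_
    rw [norm_smul, Real.norm_eq_abs]
    have h5 : ‖T x‖ ≤ 1 * ‖x‖ := (T.le_opNorm x).trans (by gcongr)
    have h6 : |r| * ‖x‖ ≤ gelfandConst * ‖x‖ := by gcongr
    nlinarith [norm_nonneg x]
  · push Not at hip
    obtain ⟨hk1, hk2⟩ := hdiv i (hp.trans hip.le)
    obtain ⟨W', hW', hWT'⟩ := key (i / 100) hk1 (Nat.div_le_div_right hi.2)
    refine ⟨W', by omega, fun x hx => (hWT' x hx).trans ?_⟩
    have hi0 : (0 : ℝ) < i := by exact_mod_cast hi.1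
    rw [gelfandBound, if_neg (not_le.2 hip)]
    gcongr
    refine (h.mixingLevel_mul_sectionRadius_le hk1 hi0 hk2).trans ?_
    gcongr
    linarith

end Operators

/-! ### Summation of the Gelfand number bounds -/

lemma sum_inv_mul_sqrt_le {q n : ℕ} (hq : 0 < q) (hqn : q ≤ n) :
    ∑ i ∈ Finset.Ioc q n, 1 / ((i : ℝ) * √i) ≤ 2 / √q - 2 / √n := by
  induction n, hqn using Nat.le_induction with
  | base => simp
  | succ n hn ih =>
    rw [← Finset.insert_Ioc_right_eq_Ioc_add_one hn, Finset.sum_insert (by simp)]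
    have hn0 : (0 : ℝ) < n := by
      have : 0 < n := by omega
      exact_mod_cast this
    have ha : 0 < √(n : ℝ) := Real.sqrt_pos.2 hn0
    have hb : 0 < √((n + 1 : ℕ) : ℝ) := by positivity
    have ha2 : √(n : ℝ) ^ 2 = n := Real.sq_sqrt hn0.le
    have hb2 : √((n + 1 : ℕ) : ℝ) ^ 2 = n + 1 := by
      rw [Real.sq_sqrt (by positivity)]; push_cast; ring
    have hab : √(n : ℝ) ≤ √((n + 1 : ℕ) : ℝ) := Real.sqrt_le_sqrt (by push_cast; linarith)
    have h1 : 1 / (((n + 1 : ℕ) : ℝ) * √((n + 1 : ℕ) : ℝ)) ≤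
        2 / √(n : ℝ) - 2 / √((n + 1 : ℕ) : ℝ) := by
      have h2 : ((n + 1 : ℕ) : ℝ) = √((n + 1 : ℕ) : ℝ) ^ 2 := by rw [hb2]; push_cast; ring
      set a := √(n : ℝ)
      set b := √((n + 1 : ℕ) : ℝ)
      rw [h2, div_sub_div _ _ ha.ne' hb.ne', div_le_div_iff₀ (by positivity) (by positivity)]
      have h3 : b ^ 2 - a ^ 2 = 1 := by rw [ha2, hb2]; ring
      have h4 : (b - a) * (b + a) = 1 := by rw [← h3]; ring
      have h5 : 1 ≤ (b - a) * (2 * b) := by nlinarith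
      have h6 : a * b ≤ b ^ 2 := by nlinarith
      calc 1 * (a * b) ≤ b ^ 2 * 1 := by linarith
        _ ≤ b ^ 2 * ((b - a) * (2 * b)) := by gcongr
        _ = _ := by ring
    linarith

/-- Up to the logarithm, `n ^ (2 / 3)` is where `n / i ^ (3 / 2)` reaches constant size. The head
contributes a multiple of `p = n ^ (2 / 3)`, the tail a multiple of `n / √p = p` times `log n`. -/
lemma IsLarge.sum_gelfandBound_le {n : ℕ} (h : IsLarge n) :
    ∑ i ∈ Finset.Icc 1 n, gelfandBound n i ≤
      6 * gelfandConst * (n : ℝ) ^ (2 / 3 : ℝ) * Real.log n := by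
  have hs := h.hundred_le_sqrt
  have hsq := h.sq_sqrt
  have hlog := h.one_le_log
  have hC := two_le_gelfandConst
  have hn1 : (1 : ℝ) ≤ n := by rw [← hsq]; nlinarith
  set p : ℝ := (n : ℝ) ^ (2 / 3 : ℝ) with hp
  have hp2 : 2 ≤ p := by have := h.sqrt_le; linarith
  have hpn : p ≤ n := by
    calc (n : ℝ) ^ (2 / 3 : ℝ) ≤ (n : ℝ) ^ (1 : ℝ) :=
          Real.rpow_le_rpow_of_exponent_le hn1 (by norm_num)
      _ = n := Real.rpow_one _
  set q : ℕ := ⌊p⌋₊ with hq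
  have hq0 : 0 < q := Nat.floor_pos.2 (by linarith)
  have hqp : (q : ℝ) ≤ p := Nat.floor_le (by linarith)
  have hpq : p < q + 1 := Nat.lt_floor_add_one p
  have hqn : q ≤ n := by exact_mod_cast hqp.trans hpn
  have hsplit : Finset.Icc 1 n = Finset.Ioc 0 n := rfl
  rw [hsplit, ← Finset.sum_Ioc_consecutive _ (Nat.zero_le q) hqn]
  have h1 : ∑ i ∈ Finset.Ioc 0 q, gelfandBound n i ≤ 2 * gelfandConst * p := by
    calc ∑ i ∈ Finset.Ioc 0 q, gelfandBound n i ≤ ∑ _i ∈ Finset.Ioc 0 q, 2 * gelfandConst := by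
          refine Finset.sum_le_sum fun i hi => ?_
          rw [Finset.mem_Ioc] at hi
          have : (i : ℝ) ≤ q := by exact_mod_cast hi.2
          rw [gelfandBound, if_pos (this.trans hqp)]
      _ = q * (2 * gelfandConst) := by simp
      _ ≤ p * (2 * gelfandConst) := by gcongr
      _ = _ := by ring
  have h2 : ∑ i ∈ Finset.Ioc q n, gelfandBound n i ≤ 4 * gelfandConst * p * Real.log n := by
    calc ∑ i ∈ Finset.Ioc q n, gelfandBound n i
        ≤ ∑ i ∈ Finset.Ioc q n, gelfandConst * n * Real.log n * (1 / (i * √i)) := by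
          refine Finset.sum_le_sum fun i hi => ?_
          rw [Finset.mem_Ioc] at hi
          have : (q : ℝ) + 1 ≤ i := by exact_mod_cast hi.1
          rw [gelfandBound, if_neg (by rw [not_le]; exact hpq.trans_le this)]
          exact le_of_eq (by ring)
      _ = gelfandConst * n * Real.log n * ∑ i ∈ Finset.Ioc q n, 1 / ((i : ℝ) * √i) := by
          rw [Finset.mul_sum]
      _ ≤ gelfandConst * n * Real.log n * (2 / √q) := by
          gcongr
          refine (sum_inv_mul_sqrt_le hq0 hqn).trans ?_
          have : 0 ≤ 2 / √(n : ℝ) := by positivity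
          linarith
      _ ≤ gelfandConst * n * Real.log n * (4 / √p) := by
          gcongr gelfandConst * n * Real.log n * ?_
          rw [div_le_div_iff₀ (by positivity) (by positivity)]
          have h3 : √p ≤ 2 * √q := by
            rw [Real.sqrt_le_left (by positivity), mul_pow, Real.sq_sqrt (by positivity)]
            have : (1 : ℝ) ≤ q := by exact_mod_cast hq0
            linarith
          linarith
      _ = 4 * gelfandConst * (n / √p) * Real.log n := by ring
      _ = _ := by
          congr 2
          rw [div_eq_iff (by positivity), hp, Real.sqrt_eq_rpow, ← Real.rpow_mul (by linarith),
            ← Real.rpow_add (by linarith)]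
          norm_num
  have h3 : 2 * gelfandConst * p ≤ 2 * gelfandConst * p * Real.log n :=
    le_mul_of_one_le_right (by positivity) hlog
  linarith

section Operators

variable {n : ℕ} {g : Fin (n ^ 2) → EuclideanSpace ℝ (Fin n)}
  {X : Type*} [NormedAddCommGroup X] [NormedSpace ℝ X]

/-- The estimate of the Gelfand numbers of operators on a space whose unit ball is the hull of a
regular family. -/
theorem iInf_sum_gelfandNumber_le (h : IsLarge n) (hg : IsRegular g)
    (ψ : X ≃ₗ[ℝ] EuclideanSpace ℝ (Fin n)) (hψ : ∀ l, ‖ψ.symm (g l)‖ ≤ 1)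
    (hball : ∀ x, ‖x‖ < 1 → ψ x ∈ absHull g) (T : X →L[ℝ] X) :
    ⨅ r : ℝ, ∑ i ∈ Finset.Icc 1 n, gelfandNumber i (T - r • ContinuousLinearMap.id ℝ X) ≤
      12 * gelfandConst * (n : ℝ) ^ (2 / 3 : ℝ) * Real.log n * ‖T‖ := by
  have : FiniteDimensional ℝ X := ψ.symm.finiteDimensional
  have hfin : Module.finrank ℝ X = n := by rw [ψ.finrank_eq, finrank_euclideanSpace_fin]
  rcases eq_or_ne T 0 with rfl | hT0
  · refine (ciInf_le (bddBelow_range_sum_gelfandNumber _ _) 0).trans ?_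
    simp only [zero_smul, sub_zero, norm_zero, mul_zero]
    refine Finset.sum_nonpos fun i hi => gelfandNumber_le _ (W := ⊤) ?_ le_rfl fun x _ => by simp
    rw [finrank_top]
    have := (Finset.mem_Icc.1 hi).1
    omega
  · have hTpos : 0 < ‖T‖ := norm_pos_iff.2 hT0
    -- Dividing by twice the norm makes the norm strictly less than one; this doubles the constant
    -- 6.
    set s : ℝ := 2 * ‖T‖ with hs
    have hs0 : 0 < s := by positivity
    obtain ⟨r, hr⟩ := exists_scalar_forall_gelfandBound h hg ψ hψ hball (T := s⁻¹ • T) (by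
      rw [norm_smul, norm_inv, Real.norm_eq_abs, abs_of_pos hs0, inv_mul_lt_iff₀ hs0]
      linarith)
    refine (ciInf_le (bddBelow_range_sum_gelfandNumber _ _) (s * r)).trans ?_
    have h1 : ∀ i ∈ Finset.Icc 1 n,
        gelfandNumber i (T - (s * r) • ContinuousLinearMap.id ℝ X) ≤ s * gelfandBound n i := by
      intro i hi
      obtain ⟨W, hW, hWx⟩ := hr i hi
      refine gelfandNumber_le _ (by rwa [hfin]) (mul_nonneg hs0.le (gelfandBound_nonneg n i))
        fun x hx => ?_
      have h2 : (T - (s * r) • ContinuousLinearMap.id ℝ X) x = s • ((s⁻¹ • T) x - r • x) := by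
        simp [smul_sub, smul_smul, hs0.ne']
      rw [h2, norm_smul, Real.norm_eq_abs, abs_of_pos hs0, mul_assoc s (gelfandBound n i)]
      exact mul_le_mul_of_nonneg_left (hWx x hx) hs0.le
    refine (Finset.sum_le_sum h1).trans ?_
    rw [← Finset.mul_sum]
    calc s * ∑ i ∈ Finset.Icc 1 n, gelfandBound n i
        ≤ s * (6 * gelfandConst * (n : ℝ) ^ (2 / 3 : ℝ) * Real.log n) := by
          gcongr
          exact h.sum_gelfandBound_le
      _ = _ := by rw [hs]; ring

end Operators

end GenericQuotient

namespace GenericQuotient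

open ProbabilityTheory

/-! ### Rotations of Gaussian families -/

section Rotation

variable {N n : ℕ}

/-- The action of matrices on families of vectors. -/
noncomputable def matAct (A : Matrix (Fin N) (Fin N) ℝ) (g : Fin N → EuclideanSpace ℝ (Fin n)) :
    Fin N → EuclideanSpace ℝ (Fin n) := fun i => ∑ l, A i l • g l

lemma matAct_matAct (A B : Matrix (Fin N) (Fin N) ℝ) (g : Fin N → EuclideanSpace ℝ (Fin n)) :
    matAct A (matAct B g) = matAct (A * B) g := by
  funext i
  simp only [matAct, Finset.smul_sum, smul_smul, Matrix.mul_apply, Finset.sum_smul]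
  exact Finset.sum_comm

lemma matAct_one (g : Fin N → EuclideanSpace ℝ (Fin n)) : matAct 1 g = g := by
  funext i
  simp [matAct, Matrix.one_apply, ite_smul]

lemma coeffs_matAct (A : Matrix (Fin N) (Fin N) ℝ) (g : Fin N → EuclideanSpace ℝ (Fin n))
    (θ : EuclideanSpace ℝ (Fin n)) :
    coeffs (matAct A g) θ = Matrix.toEuclideanLin A (coeffs g θ) := by
  ext i
  rw [coeffs_apply]
  simp [matAct, sum_inner, inner_smul_left, Matrix.mulVec, dotProduct]

lemma measurable_matAct :
    Measurable fun p : Matrix.orthogonalGroup (Fin N) ℝ × (Fin N → EuclideanSpace ℝ (Fin n)) =>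
      matAct (p.1 : Matrix (Fin N) (Fin N) ℝ) p.2 := by
  refine measurable_pi_iff.2 fun i => ?_
  refine Finset.measurable_sum _ fun l _ => ?_
  have h0 : Measurable fun p : Matrix.orthogonalGroup (Fin N) ℝ ×
      (Fin N → EuclideanSpace ℝ (Fin n)) => p.2 l :=
    (measurable_pi_apply l).comp measurable_snd
  have h : Continuous fun U : Matrix.orthogonalGroup (Fin N) ℝ =>
      (U : Matrix (Fin N) (Fin N) ℝ) i l :=
    (continuous_apply_apply i l).comp continuous_subtype_val
  have h1 : Measurable fun p : Matrix.orthogonalGroup (Fin N) ℝ ×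
      (Fin N → EuclideanSpace ℝ (Fin n)) => (p.1 : Matrix (Fin N) (Fin N) ℝ) i l :=
    h.measurable.comp measurable_fst
  exact h1.smul h0

lemma sum_inner_matAct (A : Matrix (Fin N) (Fin N) ℝ)
    (g t : Fin N → EuclideanSpace ℝ (Fin n)) :
    ∑ i, inner ℝ (matAct A g i) (t i) = ∑ l, inner ℝ (g l) (matAct A.transpose t l) := by
  simp only [matAct, sum_inner, inner_sum, inner_smul_left, inner_smul_right, RCLike.conj_to_real,
    Matrix.transpose_apply]
  exact Finset.sum_comm

lemma charFun_map_toLp_gaussianFamily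
    (t : PiLp 2 fun _ : Fin N => EuclideanSpace ℝ (Fin n)) :
    charFun ((gaussianFamily N n).map (WithLp.toLp 2)) t =
      Complex.exp (-((∑ i, inner ℝ (t i) (t i) : ℝ) : ℂ) / 2) := by
  rw [gaussianFamily, charFun_pi]
  simp_rw [charFun_stdGaussian]
  rw [← Complex.exp_sum]
  congr 1
  simp_rw [real_inner_self_eq_norm_sq]
  push_cast
  rw [← Finset.sum_div, Finset.sum_neg_distrib]

/-- The matrix mixes the `N` vectors of the family. Its adjoint acts by the transpose and preserves
`∑ i, ‖t i‖ ^ 2`, on which alone the characteristic function depends. The passage to `PiLp 2`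
supplies the inner product for characteristic functions. -/
lemma measurePreserving_matAct (U : Matrix.orthogonalGroup (Fin N) ℝ) :
    MeasurePreserving (matAct (U : Matrix (Fin N) (Fin N) ℝ)) (gaussianFamily N n)
      (gaussianFamily N n) := by
  have hmeas : Measurable (matAct (n := n) (U : Matrix (Fin N) (Fin N) ℝ)) :=
    measurable_matAct.comp measurable_prodMk_left
  refine ⟨hmeas, ?_⟩
  have hU : (U : Matrix (Fin N) (Fin N) ℝ) * (U : Matrix (Fin N) (Fin N) ℝ).transpose = 1 :=
    (Matrix.mem_orthogonalGroup_iff (Fin N) ℝ).1 U.2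
  have hprob : IsProbabilityMeasure ((gaussianFamily N n).map (matAct (U : Matrix (Fin N) (Fin N) ℝ))) :=
    Measure.isProbabilityMeasure_map hmeas.aemeasurable
  have hto : Measurable (WithLp.toLp 2 : (Fin N → EuclideanSpace ℝ (Fin n)) → PiLp 2 _) := by
    fun_prop
  have h1 : ((gaussianFamily N n).map (matAct (U : Matrix (Fin N) (Fin N) ℝ))).map
      (WithLp.toLp 2 : _ → PiLp 2 fun _ : Fin N => EuclideanSpace ℝ (Fin n)) =
      (gaussianFamily N n).map (WithLp.toLp 2) := by
    have := Measure.isProbabilityMeasure_map (μ := gaussianFamily N n) hto.aemeasurable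
    have := Measure.isProbabilityMeasure_map
      (μ := (gaussianFamily N n).map (matAct (U : Matrix (Fin N) (Fin N) ℝ))) hto.aemeasurable
    apply Measure.ext_of_charFun
    ext t
    set t' : PiLp 2 fun _ : Fin N => EuclideanSpace ℝ (Fin n) :=
      WithLp.toLp 2 (matAct (U : Matrix (Fin N) (Fin N) ℝ).transpose t.ofLp) with ht'
    have h2 : charFun (((gaussianFamily N n).map (matAct (U : Matrix (Fin N) (Fin N) ℝ))).map
        (WithLp.toLp 2)) t = charFun ((gaussianFamily N n).map (WithLp.toLp 2)) t' := by
      rw [charFun_apply, charFun_apply, integral_map hto.aemeasurable (by fun_prop),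
        integral_map hto.aemeasurable (by fun_prop),
        integral_map hmeas.aemeasurable (by fun_prop)]
      refine integral_congr_ae (Filter.Eventually.of_forall fun g => ?_)
      have h4 : inner ℝ (WithLp.toLp 2 (matAct (U : Matrix (Fin N) (Fin N) ℝ) g)) t =
          inner ℝ (WithLp.toLp 2 g) t' :=
        (PiLp.inner_apply _ _).trans ((sum_inner_matAct _ _ _).trans
          (PiLp.inner_apply (WithLp.toLp 2 g) t').symm)
      exact congrArg (fun z : ℝ => Complex.exp (z * Complex.I)) h4
    rw [h2, charFun_map_toLp_gaussianFamily, charFun_map_toLp_gaussianFamily]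
    congr 4
    simp only [ht']
    rw [← sum_inner_matAct, matAct_matAct, hU, matAct_one]
  have h3 := congrArg (Measure.map (WithLp.ofLp :
    (PiLp 2 fun _ : Fin N => EuclideanSpace ℝ (Fin n)) → _)) h1
  have hof : Measurable (WithLp.ofLp :
      (PiLp 2 fun _ : Fin N => EuclideanSpace ℝ (Fin n)) → _) := by fun_prop
  rw [Measure.map_map hof hto, Measure.map_map hof hto] at h3
  simpa [Function.comp_def] using h3

end Rotation

/-! ### The Haar measure on the Grassmann manifold -/

section Haar

variable {N n : ℕ}

instance (N : ℕ) : IsProbabilityMeasure (orthogonalHaar N) :=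
  ⟨by
    have := Measure.haarMeasure_self (K₀ := (⊤ : TopologicalSpace.PositiveCompacts
      (Matrix.orthogonalGroup (Fin N) ℝ)))
    simpa [orthogonalHaar] using this⟩

instance (N : ℕ) : (orthogonalHaar N).IsHaarMeasure := by
  unfold orthogonalHaar; infer_instance

/-- A right translate of Haar measure is again a left invariant probability measure, and there is
only one. -/
lemma orthogonalHaar_preimage_mul_right (V : Matrix.orthogonalGroup (Fin N) ℝ)
    {s : Set (Matrix.orthogonalGroup (Fin N) ℝ)} (hs : MeasurableSet s) :
    orthogonalHaar N ((fun U => U * V) ⁻¹' s) = orthogonalHaar N s := by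
  have h0 : Measurable fun U : Matrix.orthogonalGroup (Fin N) ℝ => U * V :=
    (continuous_mul_const V).measurable
  have : IsProbabilityMeasure ((orthogonalHaar N).map (fun U => U * V)) :=
    Measure.isProbabilityMeasure_map h0.aemeasurable
  have : ((orthogonalHaar N).map (fun U => U * V)).IsHaarMeasure := inferInstance
  have h := Measure.isHaarMeasure_eq_of_isProbabilityMeasure
    ((orthogonalHaar N).map (fun U => U * V)) (orthogonalHaar N)
  rw [← Measure.map_apply h0 hs, h]

lemma measurable_rotate_coordSubspace (h : n ≤ N) :
    Measurable fun U => rotate U (coordSubspace h) := fun _ hs => hs h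

lemma rotate_mul (U V : Matrix.orthogonalGroup (Fin N) ℝ) (F : Grassmannian n N) :
    rotate (U * V) F = rotate U (rotate V F) := by
  apply Subtype.ext
  simp only [rotate]
  rw [← Submodule.map_comp]
  congr 1
  ext x i
  simp [Matrix.mulVec_mulVec]

/-- Matching orthonormal bases gives an isometry from `F` onto `F'`; it extends to an isometry of
the whole space, whose matrix is orthogonal. -/
lemma exists_rotate_eq (F F' : Grassmannian n N) :
    ∃ V : Matrix.orthogonalGroup (Fin N) ℝ, rotate V F = F' := by
  let e : F.1 ≃ₗᵢ[ℝ] F'.1 := (stdOrthonormalBasis ℝ F.1).equiv (stdOrthonormalBasis ℝ F'.1)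
    (finCongr (F.2.trans F'.2.symm))
  let L : EuclideanSpace ℝ (Fin N) →ₗᵢ[ℝ] EuclideanSpace ℝ (Fin N) :=
    (F'.1.subtypeₗᵢ.comp e.toLinearIsometry).extend
  have hL : ∀ x : F.1, L x = e x := fun x =>
    LinearIsometry.extend_apply (F'.1.subtypeₗᵢ.comp e.toLinearIsometry) x
  set A : Matrix (Fin N) (Fin N) ℝ := Matrix.toEuclideanLin.symm L.toLinearMap with hA
  have hAL : ∀ x, Matrix.toEuclideanLin A x = L x := by
    intro x
    rw [hA, LinearEquiv.apply_symm_apply]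
    rfl
  have hAmem : A ∈ Matrix.orthogonalGroup (Fin N) ℝ := by
    rw [Matrix.mem_orthogonalGroup_iff']
    apply Matrix.toEuclideanLin.injective
    refine LinearMap.ext fun x => ?_
    have h1 : Matrix.toEuclideanLin (star A * A) x =
        x := by
      refine ext_inner_left ℝ fun v => ?_
      have h2 : Matrix.toEuclideanLin (star A * A) x =
          LinearMap.adjoint (Matrix.toEuclideanLin A)
            (Matrix.toEuclideanLin A x) := by
        rw [← Matrix.toEuclideanLin_conjTranspose_eq_adjoint, Matrix.star_eq_conjTranspose]
        simp [Matrix.toLpLin_apply, Matrix.mulVec_mulVec]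
      rw [h2, LinearMap.adjoint_inner_right, hAL, hAL, L.inner_map_map]
    exact h1.trans (by simp)
  refine ⟨⟨A, hAmem⟩, Subtype.ext ?_⟩
  simp only [rotate]
  apply le_antisymm
  · rintro _ ⟨x, hx, rfl⟩
    rw [hAL, hL ⟨x, hx⟩]
    exact (e ⟨x, hx⟩).2
  · intro y hy
    refine ⟨e.symm ⟨y, hy⟩, (e.symm ⟨y, hy⟩).2, ?_⟩
    rw [hAL, hL, e.apply_symm_apply]

/-- Comparison of the Haar measure on the Grassmann manifold with the Gaussian measure: if a family
outside `B` spans a subspace outside `A`, the measure of `A` is at most the probability of `B`. -/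
theorem grassmannMeasure_le_gaussianFamily (h : n ≤ N) {A : Set (Grassmannian n N)}
    (hA : MeasurableSet {U | rotate U (coordSubspace h) ∈ A})
    {B : Set (Fin N → EuclideanSpace ℝ (Fin n))}
    (hinj : ∀ g ∉ B, Function.Injective (coeffs g))
    (hAB : ∀ g ∉ B, ∀ F : Grassmannian n N, F.1 = LinearMap.range (coeffs g).toLinearMap → F ∉ A) :
    grassmannMeasure h A ≤ gaussianFamily N n B := by
  have hmeas := measurable_rotate_coordSubspace (N := N) h
  have hprob : IsProbabilityMeasure (grassmannMeasure h) := by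
    unfold grassmannMeasure
    exact Measure.isProbabilityMeasure_map hmeas.aemeasurable
  rcases le_or_gt 1 (gaussianFamily N n B) with h1 | h1
  · exact prob_le_one.trans h1
  set B' := toMeasurable (gaussianFamily N n) B with hB'
  have hBB' : B ⊆ B' := subset_toMeasurable _ _
  have hB'm : MeasurableSet B' := measurableSet_toMeasurable _ _
  have hB'v : gaussianFamily N n B' = gaussianFamily N n B := measure_toMeasurable _
  set S : Set (Matrix.orthogonalGroup (Fin N) ℝ × (Fin N → EuclideanSpace ℝ (Fin n))) :=
    (fun p => matAct (p.1 : Matrix (Fin N) (Fin N) ℝ) p.2) ⁻¹' B' with hS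
  have hSm : MeasurableSet S := measurable_matAct hB'm
  have hSv : ((orthogonalHaar N).prod (gaussianFamily N n)) S = gaussianFamily N n B := by
    rw [Measure.prod_apply hSm]
    have : ∀ U : Matrix.orthogonalGroup (Fin N) ℝ,
        gaussianFamily N n (Prod.mk U ⁻¹' S) = gaussianFamily N n B := by
      intro U
      rw [← hB'v, ← (measurePreserving_matAct U).measure_preimage hB'm.nullMeasurableSet]
      rfl
    simp_rw [this]
    rw [lintegral_const, measure_univ, mul_one]
  rw [Measure.prod_apply_symm hSm] at hSv
  -- By rotation invariance every `U`-slice of `S` has the measure of `B`. Integrating in the other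
  -- order, some fixed `g` has a set of bad rotations of Haar measure at most that.
  obtain ⟨g, hg⟩ := exists_le_lintegral (μ := gaussianFamily N n)
    (measurable_measure_prodMk_right hSm (μ := orthogonalHaar N)).aemeasurable
  rw [hSv] at hg
  -- One good rotation of `g` suffices to show that `g` itself spans an `n`-dimensional subspace;
  -- this needs the measure of `B` to be less than one.
  obtain ⟨U₀, hU₀⟩ : ∃ U₀ : Matrix.orthogonalGroup (Fin N) ℝ, (U₀, g) ∉ S := by
    by_contra! hcon
    have : (fun U => (U, g)) ⁻¹' S = Set.univ := Set.eq_univ_of_forall hcon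
    rw [this, measure_univ] at hg
    exact absurd (hg.trans_lt h1) (lt_irrefl _)
  have hginj : Function.Injective (coeffs g) := by
    intro x y hxy
    apply hinj _ (fun hB => hU₀ (hBB' hB))
    rw [coeffs_matAct, coeffs_matAct, hxy]
  set F₀ : Grassmannian n N := ⟨LinearMap.range (coeffs g).toLinearMap, by
    rw [LinearMap.finrank_range_of_inj hginj, finrank_euclideanSpace_fin]⟩ with hF₀
  obtain ⟨V, hV⟩ := exists_rotate_eq (coordSubspace h) F₀
  have hA' : MeasurableSet A := fun _ => hA
  rw [grassmannMeasure, Measure.map_apply hmeas hA']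
  change orthogonalHaar N {U | rotate U (coordSubspace h) ∈ A} ≤ _
  rw [← orthogonalHaar_preimage_mul_right V hA]
  refine (measure_mono fun U hU => ?_).trans hg
  simp only [Set.mem_preimage, Set.mem_ofPred_eq] at hU
  rw [rotate_mul, hV] at hU
  by_contra hUB
  refine hAB (matAct (U : Matrix (Fin N) (Fin N) ℝ) g) (fun hB => hUB (hBB' hB)) _ ?_ hU
  simp only [rotate, hF₀]
  rw [← LinearMap.range_comp]
  congr 1
  ext1 θ
  exact (coeffs_matAct _ _ _).symm

end Haar

end GenericQuotient

namespace GenericQuotient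

/-! ### Gelfand numbers under isomorphisms -/

section Ideal

/-- Ideal property: a subspace competing for `u` is pulled back along `a`, which does not increase
the codimension because the quotient by the pullback embeds into the original quotient. -/
lemma gelfandNumber_comp_comp_le {X Y : Type} [NormedAddCommGroup X] [NormedSpace ℝ X]
    [NormedAddCommGroup Y] [NormedSpace ℝ Y] {k : ℕ} (hk : 1 ≤ k) (u : Y →L[ℝ] Y) {a : X →L[ℝ] Y}
    {b : Y →L[ℝ] X} {C D : ℝ} (hC : 0 < C) (hD : 0 < D) (ha : ‖a‖ ≤ C) (hb : ‖b‖ ≤ D) :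
    gelfandNumber k (b.comp (u.comp a)) ≤ C * D * gelfandNumber k u := by
  rw [← div_le_iff₀' (by positivity)]
  refine le_csInf ⟨_, ⊤, ?_, rfl⟩ ?_
  · rw [rank_subsingleton']
    exact_mod_cast hk
  rintro _ ⟨Z, hZ, rfl⟩
  rw [div_le_iff₀' (by positivity)]
  set W : Submodule ℝ X := Z.comap a.toLinearMap with hW
  have hrank : Module.rank ℝ (X ⧸ W) < (k : Cardinal) := by
    refine lt_of_le_of_lt (LinearMap.rank_le_of_injective (W.mapQ Z a.toLinearMap le_rfl) ?_) hZ
    rw [← LinearMap.ker_eq_bot, Submodule.ker_mapQ]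
    exact W.mkQ_map_self
  have hle : gelfandNumber k (b.comp (u.comp a)) ≤ ‖(b.comp (u.comp a)).comp W.subtypeL‖ := by
    refine csInf_le ⟨0, ?_⟩ ⟨W, hrank, rfl⟩
    rintro r ⟨Z, _, rfl⟩
    exact ContinuousLinearMap.opNorm_nonneg _
  refine hle.trans (ContinuousLinearMap.opNorm_le_bound _ (by positivity) fun x => ?_)
  have h1 : ‖u (a x)‖ ≤ ‖u.comp Z.subtypeL‖ * ‖a x‖ :=
    (u.comp Z.subtypeL).le_opNorm ⟨a x, x.2⟩
  calc ‖b (u (a x))‖ ≤ D * ‖u (a x)‖ := b.le_of_opNorm_le hb _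
    _ ≤ D * (‖u.comp Z.subtypeL‖ * (C * ‖(x : X)‖)) := by
        gcongr
        exact h1.trans (by gcongr; exact a.le_of_opNorm_le ha _)
    _ = C * D * ‖u.comp Z.subtypeL‖ * ‖x‖ := by rw [Submodule.coe_norm]; ring

/-- Since `b ∘ a` is the identity, `T - r = b ∘ (a ∘ T ∘ b - r) ∘ a` with the same scalar `r` on
both sides. -/
lemma iInf_sum_gelfandNumber_le_mul {X Y : Type} [NormedAddCommGroup X] [NormedSpace ℝ X]
    [NormedAddCommGroup Y] [NormedSpace ℝ Y] (T : X →L[ℝ] X) (n : ℕ) {a : X →L[ℝ] Y}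
    {b : Y →L[ℝ] X} (hba : ∀ x, b (a x) = x) {C D : ℝ} (hC : 0 < C)
    (hD : 0 < D) (ha : ‖a‖ ≤ C) (hb : ‖b‖ ≤ D) :
    ⨅ r : ℝ, ∑ i ∈ Finset.Icc 1 n, gelfandNumber i (T - r • ContinuousLinearMap.id ℝ X) ≤
      C * D * ⨅ r : ℝ, ∑ i ∈ Finset.Icc 1 n,
        gelfandNumber i (a.comp (T.comp b) - r • ContinuousLinearMap.id ℝ Y) := by
  rw [← div_le_iff₀' (by positivity)]
  refine le_ciInf fun r => ?_
  rw [div_le_iff₀' (by positivity), Finset.mul_sum]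
  refine (ciInf_le (bddBelow_range_sum_gelfandNumber T _) r).trans
    (Finset.sum_le_sum fun i hi => ?_)
  have h1 : T - r • ContinuousLinearMap.id ℝ X =
      b.comp ((a.comp (T.comp b) - r • ContinuousLinearMap.id ℝ Y).comp a) := by
    ext x
    simp [hba]
  rw [h1]
  exact gelfandNumber_comp_comp_le (Finset.mem_Icc.1 hi).1 _ hC hD ha hb

end Ideal

/-! ### The quotients of `l_1^N` -/

section L1Quotient

variable {n N : ℕ}

/-- The quotient map of `l_1^N` onto `l_1^N / E^⊥`. -/
noncomputable def l1Mk (E : Grassmannian n N) : (PiLp 1 fun _ : Fin N => ℝ) →ₗ[ℝ] L1Quotient E :=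
  (perpInL1 E).mkQ

lemma l1Mk_surjective (E : Grassmannian n N) : Function.Surjective (l1Mk E) :=
  (perpInL1 E).mkQ_surjective

lemma norm_l1Mk_le (E : Grassmannian n N) (x : PiLp 1 fun _ : Fin N => ℝ) : ‖l1Mk E x‖ ≤ ‖x‖ :=
  Submodule.Quotient.norm_mk_le _ x

lemma exists_l1Mk_eq_norm_lt (E : Grassmannian n N) (x : L1Quotient E) {c : ℝ} (hc : ‖x‖ < c) :
    ∃ y, l1Mk E y = x ∧ ‖y‖ < c := by
  obtain ⟨m, hm, hlt⟩ := Submodule.Quotient.norm_mk_lt (S := perpInL1 E) x (sub_pos.2 hc)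
  exact ⟨m, hm, hlt.trans_eq (add_sub_cancel _ _)⟩

instance (E : Grassmannian n N) : FiniteDimensional ℝ (L1Quotient E) :=
  Module.Finite.of_surjective (l1Mk E) (l1Mk_surjective E)

lemma mem_perpInL1 (E : Grassmannian n N) (x : PiLp 1 fun _ : Fin N => ℝ) :
    x ∈ perpInL1 E ↔ ∀ v ∈ E.1, v.ofLp ⬝ᵥ x.ofLp = 0 := by
  rw [perpInL1, Submodule.mem_comap, Submodule.mem_orthogonal]
  refine forall₂_congr fun v _ => ?_
  rw [PiLp.inner_apply, dotProduct]
  simp [mul_comm]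

lemma ker_l1Mk (E : Grassmannian n N) : LinearMap.ker (l1Mk E) = perpInL1 E :=
  (perpInL1 E).ker_mkQ

lemma l1Mk_eq_zero_iff (E : Grassmannian n N) (x : PiLp 1 fun _ : Fin N => ℝ) :
    l1Mk E x = 0 ↔ ∀ v ∈ E.1, v.ofLp ⬝ᵥ x.ofLp = 0 := by
  rw [← mem_perpInL1, ← ker_l1Mk, LinearMap.mem_ker]

lemma finrank_l1Quotient (E : Grassmannian n N) :
    Module.finrank ℝ (L1Quotient E) = n := by
  have h1 : Module.finrank ℝ (L1Quotient E) + Module.finrank ℝ (perpInL1 E) = N := by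
    have := (perpInL1 E).finrank_quotient_add_finrank
    rw [(WithLp.linearEquiv 1 ℝ (Fin N → ℝ)).finrank_eq] at this
    exact this.trans (by simp)
  have h2 : Module.finrank ℝ (perpInL1 E) = Module.finrank ℝ E.1ᗮ := by
    set e := (WithLp.linearEquiv 1 ℝ (Fin N → ℝ)).trans
      (WithLp.linearEquiv 2 ℝ (Fin N → ℝ)).symm with he
    have : perpInL1 E = (E.1ᗮ).map e.symm.toLinearMap := by
      rw [perpInL1, Submodule.map_equiv_eq_comap_symm]
      rfl
    rw [this]
    exact e.symm.finrank_map_eq _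
  have h3 := E.1.finrank_add_finrank_orthogonal
  rw [E.2, finrank_euclideanSpace_fin] at h3
  omega

/-- The spaces `l_1^N / E^⊥` with `E` spanned by the coordinates of a family of vectors: the unit
ball is the absolutely convex hull of the family. -/
lemma exists_equiv_absHull {g : Fin N → EuclideanSpace ℝ (Fin n)}
    (hg : Function.Injective (coeffs g)) {E : Grassmannian n N}
    (hE : E.1 = LinearMap.range (coeffs g).toLinearMap) :
    ∃ ψ : L1Quotient E ≃ₗ[ℝ] EuclideanSpace ℝ (Fin n),
      (∀ l, ‖ψ.symm (g l)‖ ≤ 1) ∧ ∀ x, ‖x‖ < 1 → ψ x ∈ absHull g := by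
  set q : (PiLp 1 fun _ : Fin N => ℝ) →ₗ[ℝ] EuclideanSpace ℝ (Fin n) :=
    (synth g).toLinearMap ∘ₗ ((WithLp.linearEquiv 1 ℝ (Fin N → ℝ)).trans
      (WithLp.linearEquiv 2 ℝ (Fin N → ℝ)).symm).toLinearMap with hq
  have hqa : ∀ x, q x = ∑ l, x l • g l := fun x => synth_apply _ _
  have hin : ∀ x v, inner ℝ v (q x) = (coeffs g v).ofLp ⬝ᵥ x.ofLp := by
    intro x v
    rw [hqa, inner_sum, dotProduct]
    refine Finset.sum_congr rfl fun l _ => ?_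
    rw [inner_smul_right, coeffs_apply, real_inner_comm, mul_comm]
  have hker : LinearMap.ker q = perpInL1 E := by
    ext x
    rw [LinearMap.mem_ker, mem_perpInL1, hE]
    constructor
    · rintro hx _ ⟨v, rfl⟩
      have := hin x v
      rw [hx, inner_zero_right] at this
      exact this.symm
    · intro hx
      refine ext_inner_left ℝ fun v => ?_
      rw [hin, inner_zero_right]
      exact hx _ ⟨v, rfl⟩
  have hsurj : Function.Surjective q := by
    rw [← LinearMap.range_eq_top, ← Submodule.orthogonal_eq_bot_iff, Submodule.eq_bot_iff]
    intro v hv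
    apply hg
    rw [map_zero]
    ext l
    have := (Submodule.mem_orthogonal' _ _).1 hv _ ⟨PiLp.single 1 l 1, rfl⟩
    rw [hin] at this
    simpa using this
  let ψ : L1Quotient E ≃ₗ[ℝ] EuclideanSpace ℝ (Fin n) :=
    (Submodule.quotEquivOfEq _ _ hker.symm).trans (q.quotKerEquivOfSurjective hsurj)
  have hψ : ∀ x, ψ (l1Mk E x) = q x := fun x => rfl
  refine ⟨ψ, fun l => ?_, fun x hx => ?_⟩
  · have h1 : g l = ψ (l1Mk E (PiLp.single 1 l 1)) := by
      rw [hψ, hqa]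
      simp [ite_smul]
    rw [h1, LinearEquiv.symm_apply_apply]
    refine (norm_l1Mk_le _ _).trans ?_
    rw [PiLp.norm_single, norm_one]
  · obtain ⟨y, rfl, hy⟩ := exists_l1Mk_eq_norm_lt E x hx
    rw [PiLp.norm_eq_of_L1] at hy
    exact ⟨y.ofLp, hy.le, (hψ y).trans (hqa y)⟩

/-- A bound for the norm of a matrix as an operator of `l_1^N`, close to `1` near the identity. -/
noncomputable def l1Bound (A : Matrix (Fin N) (Fin N) ℝ) : ℝ :=
  1 + ∑ i, ∑ j, |(A - 1) i j|

lemma one_le_l1Bound (A : Matrix (Fin N) (Fin N) ℝ) : 1 ≤ l1Bound A := by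
  have : 0 ≤ ∑ i, ∑ j, |(A - 1) i j| := by positivity
  unfold l1Bound; linarith

lemma sum_abs_mulVec_le (A : Matrix (Fin N) (Fin N) ℝ) (x : Fin N → ℝ) :
    ∑ i, |(A.mulVec x) i| ≤ l1Bound A * ∑ i, |x i| := by
  have h1 : ∀ i, |(A.mulVec x) i| ≤ |x i| + (∑ j, |(A - 1) i j|) * ∑ j, |x j| := by
    intro i
    have h2 : A.mulVec x i = x i + ∑ j, (A - 1) i j * x j := by
      have : A.mulVec x = x + (A - 1).mulVec x := by
        rw [Matrix.sub_mulVec, Matrix.one_mulVec, add_sub_cancel]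
      rw [this]
      rfl
    rw [h2, Finset.sum_mul]
    refine (abs_add_le _ _).trans (add_le_add le_rfl
      ((Finset.abs_sum_le_sum_abs _ _).trans (Finset.sum_le_sum fun j _ => ?_)))
    rw [abs_mul]
    gcongr
    exact Finset.single_le_sum (f := fun j => |x j|) (fun j _ => abs_nonneg _) (Finset.mem_univ j)
  calc _ ≤ ∑ i, (|x i| + (∑ j, |(A - 1) i j|) * ∑ j, |x j|) := Finset.sum_le_sum fun i _ => h1 i
    _ = _ := by
      rw [Finset.sum_add_distrib, ← Finset.sum_mul, l1Bound]
      ring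

/-- An orthogonal matrix carries `E^⊥` into the orthogonal complement of the rotated space, so it
descends to the quotients; its norm there is controlled by its norm on `ℓ_1^N`. -/
lemma exists_map_l1Quotient {E E' : Grassmannian n N} (A : Matrix.orthogonalGroup (Fin N) ℝ)
    (h : rotate A E = E') :
    ∃ φ : L1Quotient E →L[ℝ] L1Quotient E',
      (∀ x : PiLp 1 fun _ : Fin N => ℝ,
        φ (l1Mk E x) = l1Mk E' (WithLp.toLp 1 ((A : Matrix (Fin N) (Fin N) ℝ).mulVec x.ofLp))) ∧
      ‖φ‖ ≤ l1Bound (A : Matrix (Fin N) (Fin N) ℝ) := by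
  subst h
  set M : (PiLp 1 fun _ : Fin N => ℝ) →ₗ[ℝ] (PiLp 1 fun _ : Fin N => ℝ) :=
    Matrix.toLpLin 1 1 (A : Matrix (Fin N) (Fin N) ℝ) with hM
  have hA : (A : Matrix (Fin N) (Fin N) ℝ).transpose * (A : Matrix (Fin N) (Fin N) ℝ) = 1 :=
    (Matrix.mem_orthogonalGroup_iff' (Fin N) ℝ).1 A.2
  have hker : perpInL1 E ≤ LinearMap.ker (l1Mk (rotate A E) ∘ₗ M) := by
    intro x hx
    rw [mem_perpInL1] at hx
    rw [LinearMap.mem_ker, LinearMap.comp_apply, l1Mk_eq_zero_iff]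
    rintro _ ⟨v, hv, rfl⟩
    change (A : Matrix (Fin N) (Fin N) ℝ).mulVec v.ofLp ⬝ᵥ
      (A : Matrix (Fin N) (Fin N) ℝ).mulVec x.ofLp = 0
    rw [Matrix.dotProduct_mulVec, ← Matrix.vecMul_transpose, Matrix.vecMul_vecMul, hA,
      Matrix.vecMul_one]
    exact hx v hv
  let φ : L1Quotient E →ₗ[ℝ] L1Quotient (rotate A E) := (perpInL1 E).liftQ _ hker
  have hφ : ∀ x, φ (l1Mk E x) = l1Mk (rotate A E) (M x) := fun x => rfl
  have hbd : ∀ x, ‖φ x‖ ≤ l1Bound (A : Matrix (Fin N) (Fin N) ℝ) * ‖x‖ := by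
    have := norm_map_le_of_norm_map_le_of_lt_one φ ⊤
      (C := l1Bound (A : Matrix (Fin N) (Fin N) ℝ)) ?_
    · exact fun x => this x trivial
    intro x _ hx
    obtain ⟨y, rfl, hy⟩ := exists_l1Mk_eq_norm_lt E x hx
    rw [hφ]
    refine (norm_l1Mk_le _ _).trans ?_
    rw [PiLp.norm_eq_of_L1] at hy ⊢
    refine (sum_abs_mulVec_le _ _).trans ?_
    exact mul_le_of_le_one_right (zero_le_one.trans (one_le_l1Bound _)) hy.le
  exact ⟨φ.mkContinuous _ hbd, fun x => hφ x,
    φ.mkContinuous_norm_le (zero_le_one.trans (one_le_l1Bound _)) _⟩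

lemma continuous_l1Bound : Continuous (l1Bound (N := N)) := by
  unfold l1Bound
  refine continuous_const.add (continuous_finsetSum _ fun i _ => continuous_finsetSum _
    fun j _ => ?_)
  exact ((continuous_apply_apply i j).comp (continuous_id.sub continuous_const)).abs

/-- Violating the inequality between the sum of the Gelfand numbers and the operator norm is an open
condition. -/
lemma isOpen_setOf_not_iInf_sum_gelfandNumber_le (F : Grassmannian n N) (k : ℕ) {K : ℝ}
    (hK : 0 ≤ K) :
    IsOpen {U : Matrix.orthogonalGroup (Fin N) ℝ |
      ¬ ∀ T : L1Quotient (rotate U F) →L[ℝ] L1Quotient (rotate U F),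
        (⨅ r : ℝ, ∑ i ∈ Finset.Icc 1 k, gelfandNumber i
          (T - r • ContinuousLinearMap.id ℝ (L1Quotient (rotate U F)))) ≤ K * ‖T‖} := by
  rw [isOpen_iff_mem_nhds]
  intro U₀ hU₀
  simp only [Set.mem_ofPred_eq, not_forall, not_le] at hU₀
  obtain ⟨T, hT⟩ := hU₀
  set G := ⨅ r : ℝ, ∑ i ∈ Finset.Icc 1 k, gelfandNumber i
    (T - r • ContinuousLinearMap.id ℝ (L1Quotient (rotate U₀ F))) with hG
  -- `c U` bounds the distortion between the spaces at `U` and `U₀` and tends to 1 at `U₀`.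
  -- Transferring `T` loses it twice, in the Gelfand numbers and in the norm, which a strict
  -- inequality tolerates near `U₀`.
  let c : Matrix.orthogonalGroup (Fin N) ℝ → ℝ := fun U =>
    l1Bound ((U * U₀⁻¹ : Matrix.orthogonalGroup (Fin N) ℝ) : Matrix (Fin N) (Fin N) ℝ) *
      l1Bound ((U₀ * U⁻¹ : Matrix.orthogonalGroup (Fin N) ℝ) : Matrix (Fin N) (Fin N) ℝ)
  have hc : Continuous c := by
    refine (continuous_l1Bound.comp (continuous_subtype_val.comp ?_)).mul
      (continuous_l1Bound.comp (continuous_subtype_val.comp ?_))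
    · exact continuous_id.mul continuous_const
    · exact continuous_const.mul continuous_inv
  have hc0 : c U₀ = 1 := by simp [c, l1Bound]
  have hnear : ∀ᶠ U in nhds U₀, c U * (K * (c U * ‖T‖)) < G := by
    refine (Continuous.tendsto (by fun_prop) U₀ : Filter.Tendsto
      (fun U => c U * (K * (c U * ‖T‖))) _ _).eventually_lt_const ?_
    simpa [hc0] using hT
  filter_upwards [hnear] with U hU
  have e1 : rotate (U * U₀⁻¹) (rotate U₀ F) = rotate U F := by
    rw [← rotate_mul, inv_mul_cancel_right]
  have e2 : rotate (U₀ * U⁻¹) (rotate U F) = rotate U₀ F := by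
    rw [← rotate_mul, inv_mul_cancel_right]
  obtain ⟨a, ha, han⟩ := exists_map_l1Quotient _ e1
  obtain ⟨b, hb, hbn⟩ := exists_map_l1Quotient _ e2
  have hba : ∀ x, b (a x) = x := by
    intro x
    obtain ⟨y, rfl⟩ := l1Mk_surjective _ x
    rw [ha, hb, Matrix.mulVec_mulVec, ← Submonoid.coe_mul]
    simp
  have hA0 := zero_lt_one.trans_le
    (one_le_l1Bound ((U * U₀⁻¹ : Matrix.orthogonalGroup (Fin N) ℝ) : Matrix (Fin N) (Fin N) ℝ))
  have hB0 := zero_lt_one.trans_le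
    (one_le_l1Bound ((U₀ * U⁻¹ : Matrix.orthogonalGroup (Fin N) ℝ) : Matrix (Fin N) (Fin N) ℝ))
  have h1 := iInf_sum_gelfandNumber_le_mul T k hba hA0 hB0 han hbn
  have hnorm : ‖a.comp (T.comp b)‖ ≤ c U * ‖T‖ := by
    calc ‖a.comp (T.comp b)‖ ≤ ‖a‖ * (‖T‖ * ‖b‖) := (a.opNorm_comp_le _).trans
          (by gcongr; exact T.opNorm_comp_le _)
      _ ≤ l1Bound _ * (‖T‖ * l1Bound _) := by gcongr
      _ = c U * ‖T‖ := by simp only [c]; ring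
  simp only [not_forall, not_le]
  refine ⟨a.comp (T.comp b), ?_⟩
  have h2 : c U * (K * (c U * ‖T‖)) < c U * _ := hU.trans_le h1
  have hcU : 0 < c U := mul_pos hA0 hB0
  exact lt_of_le_of_lt (by gcongr) (lt_of_mul_lt_mul_left h2 hcU.le)

end L1Quotient

end GenericQuotient

/-! ### Small dimensions and the conclusion -/

namespace GenericQuotient

/-- A nonzero vector of the kernel could be scaled to norm 21, against the norming property. -/
lemma IsRegular.injective_coeffs {n : ℕ} {g : Fin (n ^ 2) → EuclideanSpace ℝ (Fin n)}
    (hg : IsRegular g) : Function.Injective (coeffs g) := by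
  refine (injective_iff_map_eq_zero _).2 fun v hv => ?_
  have h1 : ∀ l, inner ℝ (g l) v = 0 := fun l => by
    rw [← coeffs_apply, hv]
    rfl
  have h2 : ‖(21 / ‖v‖) • v‖ ≤ 20 := by
    refine hg.norming _ fun l => ?_
    rw [inner_smul_right, h1]
    simp
  by_contra hne
  rw [norm_smul, norm_div, norm_norm, div_mul_cancel₀ _ (norm_ne_zero_iff.2 hne)] at h2
  norm_num at h2

lemma sum_gelfandNumber_le {X : Type*} [NormedAddCommGroup X] [NormedSpace ℝ X]
    [FiniteDimensional ℝ X] (n : ℕ) (T : X →L[ℝ] X) :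
    ∑ i ∈ Finset.Icc 1 n, gelfandNumber i T ≤ n * ‖T‖ := by
  refine (Finset.sum_le_card_nsmul _ _ ‖T‖ fun i hi => ?_).trans (by simp)
  refine gelfandNumber_le T (W := ⊤) ?_ (norm_nonneg _) fun x _ => T.le_opNorm x
  rw [finrank_top]
  have := (Finset.mem_Icc.1 hi).1
  omega

lemma iInf_sum_gelfandNumber_le_mul_norm {X : Type*} [NormedAddCommGroup X] [NormedSpace ℝ X]
    [FiniteDimensional ℝ X] (n : ℕ) (T : X →L[ℝ] X) :
    ⨅ r : ℝ, ∑ i ∈ Finset.Icc 1 n, gelfandNumber i (T - r • ContinuousLinearMap.id ℝ X) ≤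
      n * ‖T‖ := by
  refine (ciInf_le (bddBelow_range_sum_gelfandNumber T _) 0).trans ?_
  simpa using sum_gelfandNumber_le n T

/-- In dimension at most one every operator is a scalar. The bound zero is needed for `n ≤ 1`, where
the logarithm, and with it the right-hand side of the theorem, vanishes. -/
lemma iInf_sum_gelfandNumber_le_zero {X : Type*} [NormedAddCommGroup X] [NormedSpace ℝ X]
    [FiniteDimensional ℝ X] (hX : Module.finrank ℝ X ≤ 1) (n : ℕ) (T : X →L[ℝ] X) :
    ⨅ r : ℝ, ∑ i ∈ Finset.Icc 1 n, gelfandNumber i (T - r • ContinuousLinearMap.id ℝ X) ≤ 0 := by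
  obtain ⟨v, hv⟩ := finrank_le_one_iff.1 hX
  obtain ⟨r, hr⟩ := hv (T v)
  have hT : T - r • ContinuousLinearMap.id ℝ X = 0 := by
    ext x
    obtain ⟨s, rfl⟩ := hv x
    simp [← hr]
  refine (ciInf_le (bddBelow_range_sum_gelfandNumber T _) r).trans ?_
  simpa [hT] using sum_gelfandNumber_le n (0 : X →L[ℝ] X)

lemma quarter_le_log_rpow {n : ℕ} (hn : 2 ≤ n) : 1 / 4 ≤ Real.log n ^ (3 / 2 : ℝ) := by
  have h1 : (1 / 2 : ℝ) ≤ Real.log n := by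
    have h2 : Real.log 2 ≤ Real.log n := Real.log_le_log two_pos (by exact_mod_cast hn)
    linarith [Real.log_two_gt_d9]
  calc (1 / 4 : ℝ) = (1 / 2 : ℝ) ^ (2 : ℝ) := by norm_num
    _ ≤ (1 / 2 : ℝ) ^ (3 / 2 : ℝ) :=
        Real.rpow_le_rpow_of_exponent_ge (by norm_num) (by norm_num) (by norm_num)
    _ ≤ _ := Real.rpow_le_rpow (by norm_num) h1 (by norm_num)

end GenericQuotient

theorem theorem3p1 :
    ∃ c : ℝ, 0 < c ∧
      GenericQuotient.IsGeneric (fun n => n ^ 2) (fun n => Nat.le_self_pow two_ne_zero n)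
        (fun n E => ∀ T : GenericQuotient.L1Quotient E →L[ℝ] GenericQuotient.L1Quotient E,
          (⨅ r : ℝ, ∑ i ∈ Finset.Icc 1 n, GenericQuotient.gelfandNumber i
              (T - r • ContinuousLinearMap.id ℝ (GenericQuotient.L1Quotient E))) ≤
            c * (n : ℝ) ^ (2 / 3 : ℝ) * Real.log n ^ (3 / 2 : ℝ) * ‖T‖) := by
  obtain ⟨n₀, hn₀⟩ := Filter.eventually_atTop.1 GenericQuotient.eventually_isLarge
  have hcon := GenericQuotient.two_le_gelfandConst
  have hc : 0 < 12 * GenericQuotient.gelfandConst + 4 * n₀ := by positivity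
  -- The first summand serves `n ≥ n₀`. The second serves `2 ≤ n < n₀`, where the trivial bound `n *
  -- ‖T‖` suffices because `(log n) ^ (3 / 2) ≥ 1 / 4`.
  refine ⟨12 * GenericQuotient.gelfandConst + 4 * n₀, hc, Real.exp (-1), Real.exp_pos _,
    Real.exp_lt_one_iff.2 (by norm_num), fun n => ?_⟩
  have hlog0 : 0 ≤ Real.log n := Real.log_natCast_nonneg n
  rcases le_or_gt n₀ n with hn | hn
  · have h := hn₀ n hn
    rw [← Real.exp_nat_mul, mul_neg_one]
    refine le_trans (GenericQuotient.grassmannMeasure_le_gaussianFamily _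
      (B := {g | ¬ GenericQuotient.IsRegular g}) ?_ ?_ ?_)
      (GenericQuotient.gaussianFamily_not_isRegular_le h)
    · exact (GenericQuotient.isOpen_setOf_not_iInf_sum_gelfandNumber_le _ n
        (K := (12 * GenericQuotient.gelfandConst + 4 * n₀) * (n : ℝ) ^ (2 / 3 : ℝ) *
          Real.log n ^ (3 / 2 : ℝ)) (by positivity)).measurableSet
    · intro g hg
      exact (not_not.1 hg).injective_coeffs
    · intro g hg F hF hFA
      refine hFA fun T => ?_
      have hg' : GenericQuotient.IsRegular g := not_not.1 hg
      obtain ⟨ψ, hψ, hball⟩ := GenericQuotient.exists_equiv_absHull hg'.injective_coeffs hF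
      refine (GenericQuotient.iInf_sum_gelfandNumber_le h hg' ψ hψ hball T).trans ?_
      -- The argument yields a single logarithm, which is weakened to the stated power.
      have hlog : Real.log n ≤ Real.log n ^ (3 / 2 : ℝ) :=
        Real.self_le_rpow_of_one_le h.one_le_log (by norm_num)
      gcongr
      linarith [Nat.cast_nonneg (α := ℝ) n₀]
  · have hall : ∀ (E : GenericQuotient.Grassmannian n (n ^ 2))
        (T : GenericQuotient.L1Quotient E →L[ℝ] GenericQuotient.L1Quotient E),
        (⨅ r : ℝ, ∑ i ∈ Finset.Icc 1 n, GenericQuotient.gelfandNumber i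
          (T - r • ContinuousLinearMap.id ℝ (GenericQuotient.L1Quotient E))) ≤
          (12 * GenericQuotient.gelfandConst + 4 * n₀) * (n : ℝ) ^ (2 / 3 : ℝ) *
            Real.log n ^ (3 / 2 : ℝ) * ‖T‖ := by
      intro E T
      rcases le_or_gt n 1 with h1 | h1
      · exact (GenericQuotient.iInf_sum_gelfandNumber_le_zero
          ((GenericQuotient.finrank_l1Quotient E).trans_le h1) n T).trans (by positivity)
      refine (GenericQuotient.iInf_sum_gelfandNumber_le_mul_norm n T).trans ?_
      refine mul_le_mul_of_nonneg_right ?_ (norm_nonneg _)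
      have h2 : (1 : ℝ) ≤ (n : ℝ) ^ (2 / 3 : ℝ) :=
        Real.one_le_rpow (by exact_mod_cast h1.le) (by norm_num)
      have h3 := GenericQuotient.quarter_le_log_rpow h1
      have h4 : (n : ℝ) ≤ n₀ := by exact_mod_cast hn.le
      calc (n : ℝ) ≤ (12 * GenericQuotient.gelfandConst + 4 * n₀) * 1 * (1 / 4) := by linarith
        _ ≤ _ := by gcongr
    have hempty : {E : GenericQuotient.Grassmannian n (n ^ 2) |
        ¬ ∀ T : GenericQuotient.L1Quotient E →L[ℝ] GenericQuotient.L1Quotient E,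
          (⨅ r : ℝ, ∑ i ∈ Finset.Icc 1 n, GenericQuotient.gelfandNumber i
            (T - r • ContinuousLinearMap.id ℝ (GenericQuotient.L1Quotient E))) ≤
            (12 * GenericQuotient.gelfandConst + 4 * n₀) * (n : ℝ) ^ (2 / 3 : ℝ) *
              Real.log n ^ (3 / 2 : ℝ) * ‖T‖} = ∅ :=
      Set.eq_empty_of_forall_notMem fun E hE => hE (hall E)
    exact (measure_mono_null hempty.subset measure_empty).trans_le bot_le
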